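/- Let $M$ be a smooth manifold and let $(E,\pi,\langle\cdot,\cdot\rangle,[\cdot,\cdot])$ be an exact real Courant algebroid over $M$, that is, a smooth real vector bundle $E$ with a nondegenerate symmetric pairing, a surjective anchor $\pi:E\to TM$ with $(\ker\pi)^\perp=\ker\pi$ (so that $E$ is an extension of $TM$ by $T^*M$) and a Courant (Dorfman) bracket on its sheaf of smooth sections, normalized by $\langle[a,b]+[b,a],c\rangle=\pi(c)\langle a,b\rangle$. Let $(\mathcal J_+,\mathcal J_-)$ be a generalized Kähler structure on $E$: two commuting smooth orthogonal endomorphisms of $E$ with square $-1$ whose $+i$-eigenbundles $L_\pm\subset E\otimes\mathbb C$ are involutive, such that $\langle\mathcal J_+x,\mathcal J_-x\rangle>0$ for $x\neq0$. Let $C_\pm\subset E$ be the $\pm1$-eigenbundles of $-\mathcal J_+\mathcal J_-$; the anchor restricts to isomorphisms $C_\pm\to TM$, and $I_\pm$ denotes the endomorphism of $TM$ corresponding to $\mathcal J_+|_{C_\pm}$. Put $\ell_+=L_+\cap L_-$ and $\ell_-=L_+\cap\overline{L_-}$. Then $I_\pm$ are integrable complex structures, giving complex manifolds $X_\pm=(M,I_\pm)$,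 and $\overline{\ell}_\pm$ is an isotropic involutive smooth subbundle of $E\otimes\mathbb C$ which $\pi$ maps isomorphically onto $T_{0,1}X_\pm$. The quotient $\mathcal E_\pm=\overline{\ell}_\pm^{\,\perp}/\overline{\ell}_\pm$ is an exact holomorphic Courant algebroid over $X_\pm$, where the pairing is induced from $E$, the anchor is the $(1,0)_\pm$-part of $\pi$, the holomorphic structure is given by the flat operator $\overline\partial_Xs=[\tilde X,\tilde s]\bmod\overline{\ell}_\pm$ ($\tilde X$ the section of $\overline{\ell}_\pm$ lifting the $(0,1)_\pm$-field $X$, and $\tilde s$ any section of $\overline{\ell}_\pm^{\,\perp}$ lifting $s$), and the bracket of holomorphic sections is induced from the bracket of lifts to $\overline{\ell}_\pm^{\,\perp}$. For a Dirac structure $L\subset E\otimes\mathbb C$ such that $L\cap\overline{\ell}_\pm^{\,\perp}$ has constant rank and $[\Gamma(\overline{\ell}_\pm),\Gamma(L)]\subset\Gamma(L)$ on local sections, its reduction to $\mathcal E_\pm$ is $(L\cap\overline{\ell}_\pm^{\,\perp}+\overline{\ell}_\pm)/\overline{\ell}_\pm$. The $-i$-eigenbundle of $\mathcal J_+$ satisfies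 these conditions for both signs, the $-i$-eigenbundle of $\mathcal J_-$ satisfies them for the sign $+$, and the $+i$-eigenbundle of $\mathcal J_-$ satisfies them for the sign $-$. Let $\mathcal A_\pm\subset\mathcal E_\pm$ both be the reduction of the $-i$-eigenbundle of $\mathcal J_+$, let $\mathcal B_+\subset\mathcal E_+$ be the reduction of the $-i$-eigenbundle of $\mathcal J_-$, and let $\mathcal B_-\subset\mathcal E_-$ be the reduction of the $+i$-eigenbundle of $\mathcal J_-$. Then $\mathcal A_\pm$ and $\mathcal B_\pm$ are holomorphic Dirac structures in $\mathcal E_\pm$ (holomorphic subbundles that are maximal isotropic and involutive), and they are transverse: $$\mathcal E_\pm=\mathcal A_\pm\oplus\mathcal B_\pm .$$ -/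

import Mathlib

open Bundle Set TensorProduct
open scoped Manifold ContDiff Topology

universe u v w

noncomputable section

namespace GKGeom

/-! ### Complexification -/

section Complexification

variable {W : Type*} [AddCommGroup W] [Module ℝ W]

/-- The real part of an element of the complexification. -/
def cre : ℂ ⊗[ℝ] W →ₗ[ℝ] W :=
  (TensorProduct.lid ℝ W).toLinearMap ∘ₗ LinearMap.rTensor W Complex.reLm

/-- The imaginary part of an element of the complexification. -/
def cim : ℂ ⊗[ℝ] W →ₗ[ℝ] W :=
  (TensorProduct.lid ℝ W).toLinearMap ∘ₗ LinearMap.rTensor W Complex.imLm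

/-- The element `a + i b` of the complexification. -/
def cmk (a b : W) : ℂ ⊗[ℝ] W := (1 : ℂ) ⊗ₜ[ℝ] a + Complex.I ⊗ₜ[ℝ] b

/-- The complex bilinear extension of a bilinear operation on (arbitrary) sections of a family of
real vector spaces. -/
def complexify {M : Type*} {E : M → Type*} [∀ x, AddCommGroup (E x)] [∀ x, Module ℝ (E x)]
    (br : (Π x, E x) → (Π x, E x) → Π x, E x)
    (s t : Π x, ℂ ⊗[ℝ] E x) (x : M) : ℂ ⊗[ℝ] E x :=
  cmk
    (br (fun y => cre (s y)) (fun y => cre (t y)) x -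
      br (fun y => cim (s y)) (fun y => cim (t y)) x)
    (br (fun y => cre (s y)) (fun y => cim (t y)) x +
      br (fun y => cim (s y)) (fun y => cre (t y)) x)

end Complexification

/-! ### Smooth functions, sections and vector fields over open subsets of a manifold -/

section Smooth

variable (V : Type u) [NormedAddCommGroup V] [NormedSpace ℝ V]
  {M : Type v} [TopologicalSpace M] [ChartedSpace V M]

/-- The complexified tangent space. -/
abbrev CT (x : M) : Type u := ℂ ⊗[ℝ] TangentSpace 𝓘(ℝ, V) x

/-- Smoothness over `U` of a real function. -/
def SmoothFun (f : M → ℝ) (U : Set M) : Prop := ContMDiffOn 𝓘(ℝ, V) 𝓘(ℝ, ℝ) ∞ f U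

/-- Smoothness over `U` of a complex function. -/
def SmoothCFun (f : M → ℂ) (U : Set M) : Prop := ContMDiffOn 𝓘(ℝ, V) 𝓘(ℝ, ℂ) ∞ f U

/-- The derivative of a real function along a tangent vector. -/
def deriv1 (f : M → ℝ) (x : M) (a : TangentSpace 𝓘(ℝ, V) x) : ℝ :=
  mfderiv 𝓘(ℝ, V) 𝓘(ℝ, ℝ) f x a

/-- The derivative of a complex function along a complex tangent vector. -/
def cderiv1 (f : M → ℂ) (x : M) (a : CT V x) : ℂ :=
  let d : TangentSpace 𝓘(ℝ, V) x → ℂ := fun b => mfderiv 𝓘(ℝ, V) 𝓘(ℝ, ℂ) f x b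
  d (cre a) + Complex.I * d (cim a)

variable (F : Type*) [NormedAddCommGroup F] [NormedSpace ℝ F]
  {E : M → Type*} [TopologicalSpace (TotalSpace F E)] [∀ x, TopologicalSpace (E x)]
  [FiberBundle F E]

/-- Smoothness over `U` of a section of a real vector bundle with model fibre `F`. -/
def SmoothSec (s : Π x, E x) (U : Set M) : Prop :=
  ContMDiffOn 𝓘(ℝ, V) (𝓘(ℝ, V).prod 𝓘(ℝ, F)) ∞ (fun x => TotalSpace.mk' F x (s x)) U

/-- Smoothness over `U` of a section of the complexification of a real vector bundle. -/
def SmoothCSec [∀ x, AddCommGroup (E x)] [∀ x, Module ℝ (E x)]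
    (s : Π x, ℂ ⊗[ℝ] E x) (U : Set M) : Prop :=
  SmoothSec V F (fun x => cre (s x)) U ∧ SmoothSec V F (fun x => cim (s x)) U

/-- A family of complex subspaces of the complexification of a real vector bundle is a smooth
subbundle if it has smooth local frames. -/
def IsSmoothSubbundle [∀ x, AddCommGroup (E x)] [∀ x, Module ℝ (E x)]
    (L : Π x, Submodule ℂ (ℂ ⊗[ℝ] E x)) : Prop :=
  ∀ x₀ : M, ∃ U : Set M, IsOpen U ∧ x₀ ∈ U ∧ ∃ (n : ℕ) (e : Fin n → Π x, ℂ ⊗[ℝ] E x),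
    (∀ i, SmoothCSec V F (e i) U) ∧
    ∀ y ∈ U, LinearIndependent ℂ (fun i => e i y) ∧
      Submodule.span ℂ (range fun i => e i y) = L y

/-- Smoothness over `U` of a complex vector field. -/
def SmoothCVF [IsManifold 𝓘(ℝ, V) ∞ M] (X : Π x : M, CT V x) (U : Set M) : Prop :=
  SmoothCSec V V (E := fun x : M => TangentSpace 𝓘(ℝ, V) x) X U

/-- The complex bilinear Lie bracket of complex vector fields. -/
def cLie (X Y : Π x : M, CT V x) : Π x : M, CT V x :=
  complexify (VectorField.mlieBracket 𝓘(ℝ, V)) X Y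

end Smooth

/-! ### Complex structures -/

section ComplexStructure

variable {V : Type u} [NormedAddCommGroup V] [NormedSpace ℝ V]
  {M : Type v} [TopologicalSpace M] [ChartedSpace V M]

/-- A field of endomorphisms of the tangent bundle. -/
abbrev TEnd (V : Type u) [NormedAddCommGroup V] [NormedSpace ℝ V]
    (M : Type v) [TopologicalSpace M] [ChartedSpace V M] : Type (max u v) :=
  Π x : M, TangentSpace 𝓘(ℝ, V) x →ₗ[ℝ] TangentSpace 𝓘(ℝ, V) x

/-- The `+i`-eigenbundle of `J` in the complexified tangent bundle. -/
def T10 (J : TEnd V M) (x : M) : Submodule ℂ (CT V x) :=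
  Module.End.eigenspace ((J x).baseChange ℂ) Complex.I

/-- The `-i`-eigenbundle of `J` in the complexified tangent bundle. -/
def T01 (J : TEnd V M) (x : M) : Submodule ℂ (CT V x) :=
  Module.End.eigenspace ((J x).baseChange ℂ) (-Complex.I)

/-- The operator `(1 - i J) / 2`, i.e. the projection to `T10` along `T01`. -/
def P10 (J : TEnd V M) (x : M) : CT V x →ₗ[ℂ] CT V x :=
  (1 / 2 : ℂ) • (LinearMap.id - Complex.I • (J x).baseChange ℂ)

/-- An integrable complex structure: a smooth almost complex structure whose `+i`-eigenbundle is
involutive. -/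
structure IsComplexStructure [IsManifold 𝓘(ℝ, V) ∞ M] (J : TEnd V M) : Prop where
  sq : ∀ (x : M) (a : TangentSpace 𝓘(ℝ, V) x), J x (J x a) = -a
  smooth : ∀ (U : Set M), IsOpen U → ∀ X : Π x : M, TangentSpace 𝓘(ℝ, V) x,
    SmoothSec V V X U → SmoothSec V V (fun x => J x (X x)) U
  integrable : ∀ (U : Set M), IsOpen U → ∀ X Y : Π x : M, CT V x,
    SmoothCVF V X U → SmoothCVF V Y U → (∀ x ∈ U, X x ∈ T10 J x) → (∀ x ∈ U, Y x ∈ T10 J x) →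
    ∀ x ∈ U, cLie V X Y x ∈ T10 J x

/-- Smooth vector fields of type `(0,1)` over `U`. -/
def IsVF01 [IsManifold 𝓘(ℝ, V) ∞ M] (J : TEnd V M) (X : Π x : M, CT V x) (U : Set M) : Prop :=
  SmoothCVF V X U ∧ ∀ x ∈ U, X x ∈ T01 J x

/-- Holomorphic functions over the open set `U`. -/
def IsHolFun (J : TEnd V M) (f : M → ℂ) (U : Set M) : Prop :=
  SmoothCFun V f U ∧ ∀ x ∈ U, ∀ a ∈ T01 J x, cderiv1 V f x a = 0

end ComplexStructure

/-! ### Complex vector bundles, holomorphic vector bundles, holomorphic Courant algebroids -/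

/-- A smooth complex vector bundle, given by its fibres and its sheaf of smooth sections, which is
required to be locally free: near each point there is a frame such that the smooth sections are
exactly the combinations of the frame with smooth coefficients.  `IsSmooth s U` depends only on
the values of `s` on `U` and is meaningful for open `U`. -/
structure SmoothCBundle (V : Type u) [NormedAddCommGroup V] [NormedSpace ℝ V]
    (M : Type v) [TopologicalSpace M] [ChartedSpace V M] where
  Fiber : M → Type w
  [acg : ∀ x, AddCommGroup (Fiber x)]
  [mod : ∀ x, Module ℂ (Fiber x)]
  IsSmooth : (Π x, Fiber x) → Set M → Prop
  smooth_iff_locally : ∀ (U : Set M), IsOpen U → ∀ s : Π x, Fiber x,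
    IsSmooth s U ↔ ∀ x ∈ U, ∃ W : Set M, IsOpen W ∧ x ∈ W ∧ IsSmooth s W
  exists_frame : ∀ x₀ : M, ∃ U : Set M, IsOpen U ∧ x₀ ∈ U ∧ ∃ (n : ℕ) (e : Fin n → Π x, Fiber x),
    (∀ y ∈ U, LinearIndependent ℂ (fun i => e i y) ∧
      Submodule.span ℂ (range fun i => e i y) = ⊤) ∧
    ∀ W : Set M, IsOpen W → W ⊆ U → ∀ s : Π x, Fiber x,
      IsSmooth s W ↔ ∃ f : Fin n → M → ℂ, (∀ i, SmoothCFun V (f i) W) ∧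
        ∀ y ∈ W, s y = ∑ i, f i y • e i y

attribute [instance] SmoothCBundle.acg SmoothCBundle.mod

/-- A holomorphic vector bundle over `(M, J)`: a smooth complex vector bundle with a flat
`T01`-connection `dbar X s` (the Dolbeault operator of the bundle), acting on local smooth sections;
only its values on smooth `(0,1)`-fields `X` and smooth sections `s` are meaningful. -/
structure HolVectorBundle {V : Type u} [NormedAddCommGroup V] [NormedSpace ℝ V]
    {M : Type v} [TopologicalSpace M] [ChartedSpace V M] [IsManifold 𝓘(ℝ, V) ∞ M]
    (J : TEnd V M) extends SmoothCBundle.{u, v, w} V M where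
  dbar : (Π x : M, CT V x) → (Π x, Fiber x) → Π x, Fiber x
  dbar_congr : ∀ (U : Set M), IsOpen U → ∀ (X X' : Π x : M, CT V x) (s s' : Π x, Fiber x),
    IsVF01 J X U → IsSmooth s U → (∀ x ∈ U, X x = X' x) → (∀ x ∈ U, s x = s' x) →
    ∀ x ∈ U, dbar X s x = dbar X' s' x
  dbar_smooth : ∀ (U : Set M), IsOpen U → ∀ (X : Π x : M, CT V x) (s : Π x, Fiber x),
    IsVF01 J X U → IsSmooth s U → IsSmooth (dbar X s) U
  dbar_add_vf : ∀ (U : Set M), IsOpen U → ∀ (X Y : Π x : M, CT V x) (s : Π x, Fiber x),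
    IsVF01 J X U → IsVF01 J Y U → IsSmooth s U →
    ∀ x ∈ U, dbar (fun y => X y + Y y) s x = dbar X s x + dbar Y s x
  dbar_smul_vf : ∀ (U : Set M), IsOpen U → ∀ (f : M → ℂ) (X : Π x : M, CT V x) (s : Π x, Fiber x),
    SmoothCFun V f U → IsVF01 J X U → IsSmooth s U →
    ∀ x ∈ U, dbar (fun y => f y • X y) s x = f x • dbar X s x
  dbar_add : ∀ (U : Set M), IsOpen U → ∀ (X : Π x : M, CT V x) (s t : Π x, Fiber x),
    IsVF01 J X U → IsSmooth s U → IsSmooth t U →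
    ∀ x ∈ U, dbar X (fun y => s y + t y) x = dbar X s x + dbar X t x
  dbar_leibniz : ∀ (U : Set M), IsOpen U →
    ∀ (f : M → ℂ) (X : Π x : M, CT V x) (s : Π x, Fiber x),
    SmoothCFun V f U → IsVF01 J X U → IsSmooth s U →
    ∀ x ∈ U, dbar X (fun y => f y • s y) x = f x • dbar X s x + cderiv1 V f x (X x) • s x
  dbar_flat : ∀ (U : Set M), IsOpen U → ∀ (X Y : Π x : M, CT V x) (s : Π x, Fiber x),
    IsVF01 J X U → IsVF01 J Y U → IsSmooth s U →
    ∀ x ∈ U, dbar X (dbar Y s) x - dbar Y (dbar X s) x = dbar (cLie V X Y) s x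

/-- The sheaf of holomorphic sections: smooth sections over `U` annihilated by `dbar`. -/
def HolVectorBundle.IsHol {V : Type u} [NormedAddCommGroup V] [NormedSpace ℝ V]
    {M : Type v} [TopologicalSpace M] [ChartedSpace V M] [IsManifold 𝓘(ℝ, V) ∞ M]
    {J : TEnd V M} (𝓔 : HolVectorBundle.{u, v, w} J) (s : Π x, 𝓔.Fiber x) (U : Set M) : Prop :=
  𝓔.IsSmooth s U ∧ ∀ W : Set M, IsOpen W → W ⊆ U → ∀ X : Π x : M, CT V x, IsVF01 J X W →
    ∀ x ∈ W, 𝓔.dbar X s x = 0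

/-- An (exact) holomorphic Courant algebroid over the complex manifold `(M, J)`: a holomorphic
vector bundle with a holomorphic nondegenerate symmetric pairing, a holomorphic surjective anchor
onto the holomorphic tangent bundle `T10`, whose kernel is its own orthogonal complement (so that
it is the image of the dual of `T10` under the adjoint of the anchor), and a bracket on the sheaf of
holomorphic sections, subject to the usual axioms.  The holomorphic structure of `T10` is
`dbar X Y = P10 [X, Y]`.  Only the values of `bracket` on holomorphic sections are meaningful. -/
structure HolCourantAlgebroid {V : Type u} [NormedAddCommGroup V] [NormedSpace ℝ V]
    {M : Type v} [TopologicalSpace M] [ChartedSpace V M] [IsManifold 𝓘(ℝ, V) ∞ M]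
    (J : TEnd V M) extends HolVectorBundle.{u, v, w} J where
  pairing : Π x, LinearMap.BilinForm ℂ (Fiber x)
  pairing_symm : ∀ x a b, pairing x a b = pairing x b a
  pairing_nondeg : ∀ x a, (∀ b, pairing x a b = 0) → a = 0
  pairing_smooth : ∀ (U : Set M), IsOpen U → ∀ s t : Π x, Fiber x,
    IsSmooth s U → IsSmooth t U → SmoothCFun V (fun x => pairing x (s x) (t x)) U
  pairing_holomorphic : ∀ (U : Set M), IsOpen U → ∀ (X : Π x : M, CT V x) (s t : Π x, Fiber x),
    IsVF01 J X U → IsSmooth s U → IsSmooth t U →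
    ∀ x ∈ U, cderiv1 V (fun y => pairing y (s y) (t y)) x (X x) =
      pairing x (dbar X s x) (t x) + pairing x (s x) (dbar X t x)
  anchor : Π x : M, Fiber x →ₗ[ℂ] CT V x
  anchor_range : ∀ x, LinearMap.range (anchor x) = T10 J x
  anchor_ker : ∀ x, (pairing x).orthogonal (LinearMap.ker (anchor x)) = LinearMap.ker (anchor x)
  anchor_smooth : ∀ (U : Set M), IsOpen U → ∀ s : Π x, Fiber x,
    IsSmooth s U → SmoothCVF V (fun x => anchor x (s x)) U
  anchor_holomorphic : ∀ (U : Set M), IsOpen U → ∀ (X : Π x : M, CT V x) (s : Π x, Fiber x),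
    IsVF01 J X U → IsSmooth s U →
    ∀ x ∈ U, anchor x (dbar X s x) = P10 J x (cLie V X (fun y => anchor y (s y)) x)
  bracket : (Π x, Fiber x) → (Π x, Fiber x) → Π x, Fiber x
  bracket_congr : ∀ (U : Set M), IsOpen U → ∀ a a' b b' : Π x, Fiber x,
    toHolVectorBundle.IsHol a U → toHolVectorBundle.IsHol b U →
    (∀ x ∈ U, a x = a' x) → (∀ x ∈ U, b x = b' x) → ∀ x ∈ U, bracket a b x = bracket a' b' x
  bracket_hol : ∀ (U : Set M), IsOpen U → ∀ a b : Π x, Fiber x,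
    toHolVectorBundle.IsHol a U → toHolVectorBundle.IsHol b U →
    toHolVectorBundle.IsHol (bracket a b) U
  bracket_add_left : ∀ (U : Set M), IsOpen U → ∀ a a' b : Π x, Fiber x,
    toHolVectorBundle.IsHol a U → toHolVectorBundle.IsHol a' U → toHolVectorBundle.IsHol b U →
    ∀ x ∈ U, bracket (fun y => a y + a' y) b x = bracket a b x + bracket a' b x
  bracket_add_right : ∀ (U : Set M), IsOpen U → ∀ a b b' : Π x, Fiber x,
    toHolVectorBundle.IsHol a U → toHolVectorBundle.IsHol b U → toHolVectorBundle.IsHol b' U →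
    ∀ x ∈ U, bracket a (fun y => b y + b' y) x = bracket a b x + bracket a b' x
  bracket_smul_left : ∀ (U : Set M), IsOpen U → ∀ (c : ℂ) (a b : Π x, Fiber x),
    toHolVectorBundle.IsHol a U → toHolVectorBundle.IsHol b U →
    ∀ x ∈ U, bracket (fun y => c • a y) b x = c • bracket a b x
  bracket_leibniz : ∀ (U : Set M), IsOpen U → ∀ (f : M → ℂ) (a b : Π x, Fiber x),
    IsHolFun J f U → toHolVectorBundle.IsHol a U → toHolVectorBundle.IsHol b U →
    ∀ x ∈ U, bracket a (fun y => f y • b y) x =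
      f x • bracket a b x + cderiv1 V f x (anchor x (a x)) • b x
  bracket_jacobi : ∀ (U : Set M), IsOpen U → ∀ a b c : Π x, Fiber x,
    toHolVectorBundle.IsHol a U → toHolVectorBundle.IsHol b U → toHolVectorBundle.IsHol c U →
    ∀ x ∈ U, bracket a (bracket b c) x = bracket (bracket a b) c x + bracket b (bracket a c) x
  anchor_bracket : ∀ (U : Set M), IsOpen U → ∀ a b : Π x, Fiber x,
    toHolVectorBundle.IsHol a U → toHolVectorBundle.IsHol b U →
    ∀ x ∈ U, anchor x (bracket a b x) =
      cLie V (fun y => anchor y (a y)) (fun y => anchor y (b y)) x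
  bracket_invariant : ∀ (U : Set M), IsOpen U → ∀ a b c : Π x, Fiber x,
    toHolVectorBundle.IsHol a U → toHolVectorBundle.IsHol b U → toHolVectorBundle.IsHol c U →
    ∀ x ∈ U, cderiv1 V (fun y => pairing y (b y) (c y)) x (anchor x (a x)) =
      pairing x (bracket a b x) (c x) + pairing x (b x) (bracket a c x)
  bracket_symm_part : ∀ (U : Set M), IsOpen U → ∀ a b : Π x, Fiber x,
    toHolVectorBundle.IsHol a U → toHolVectorBundle.IsHol b U →
    ∀ x ∈ U, ∀ z : Fiber x, pairing x (bracket a b x + bracket b a x) z =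
      cderiv1 V (fun y => pairing y (a y) (b y)) x (anchor x z)

/-- A holomorphic Dirac structure: a holomorphic (i.e. smooth and `dbar`-invariant) subbundle which
is maximal isotropic (equal to its orthogonal complement) and whose holomorphic sections are closed
under the bracket. -/
structure HolCourantAlgebroid.IsHolDirac {V : Type u} [NormedAddCommGroup V] [NormedSpace ℝ V]
    {M : Type v} [TopologicalSpace M] [ChartedSpace V M] [IsManifold 𝓘(ℝ, V) ∞ M]
    {J : TEnd V M} (𝓔 : HolCourantAlgebroid.{u, v, w} J) (A : Π x, Submodule ℂ (𝓔.Fiber x)) :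
    Prop where
  subbundle : ∀ x₀ : M, ∃ U : Set M, IsOpen U ∧ x₀ ∈ U ∧
    ∃ (n : ℕ) (e : Fin n → Π x, 𝓔.Fiber x), (∀ i, 𝓔.IsSmooth (e i) U) ∧
      ∀ y ∈ U, LinearIndependent ℂ (fun i => e i y) ∧
        Submodule.span ℂ (range fun i => e i y) = A y
  dbar_mem : ∀ (U : Set M), IsOpen U → ∀ (X : Π x : M, CT V x) (s : Π x, 𝓔.Fiber x),
    IsVF01 J X U → 𝓔.IsSmooth s U → (∀ x ∈ U, s x ∈ A x) → ∀ x ∈ U, 𝓔.dbar X s x ∈ A x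
  maximal_isotropic : ∀ x, (𝓔.pairing x).orthogonal (A x) = A x
  involutive : ∀ (U : Set M), IsOpen U → ∀ a b : Π x, 𝓔.Fiber x,
    𝓔.toHolVectorBundle.IsHol a U → 𝓔.toHolVectorBundle.IsHol b U →
    (∀ x ∈ U, a x ∈ A x) → (∀ x ∈ U, b x ∈ A x) → ∀ x ∈ U, 𝓔.bracket a b x ∈ A x

/-! ### Smooth real Courant algebroids -/

section Courant

variable (V : Type u) [NormedAddCommGroup V] [NormedSpace ℝ V]
  {M : Type v} [TopologicalSpace M] [ChartedSpace V M] [IsManifold 𝓘(ℝ, V) ∞ M]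
  (F : Type*) [NormedAddCommGroup F] [NormedSpace ℝ F]
  (E : M → Type w) [∀ x, AddCommGroup (E x)] [∀ x, Module ℝ (E x)]
  [TopologicalSpace (TotalSpace F E)] [∀ x, TopologicalSpace (E x)] [FiberBundle F E]

/-- An exact real Courant algebroid structure on the vector bundle `E`: a smooth nondegenerate
symmetric pairing, a smooth surjective anchor whose kernel is its own orthogonal complement (so that
it is the image of the cotangent bundle under the adjoint of the anchor), and a bracket on the sheaf
of smooth sections, subject to the usual axioms.  The bracket of sections defined near a point is
encoded by an operation on arbitrary sections, of which only the values on smooth sections are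
meaningful.  The last axiom says that `[a, b] + [b, a]` is the differential of the pairing of `a`
and `b`, where a one-form `ξ` is the element of `E` whose pairing with `z` is `ξ (anchor z) / 2`;
thus `[a, a] = d ⟨a, a⟩`. -/
structure ExactCourantAlgebroid where
  pairing : Π x, LinearMap.BilinForm ℝ (E x)
  pairing_symm : ∀ x a b, pairing x a b = pairing x b a
  pairing_nondeg : ∀ x a, (∀ b, pairing x a b = 0) → a = 0
  pairing_smooth : ∀ (U : Set M), IsOpen U → ∀ s t : Π x, E x,
    SmoothSec V F s U → SmoothSec V F t U → SmoothFun V (fun x => pairing x (s x) (t x)) U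
  anchor : Π x : M, E x →ₗ[ℝ] TangentSpace 𝓘(ℝ, V) x
  anchor_smooth : ∀ (U : Set M), IsOpen U → ∀ s : Π x, E x,
    SmoothSec V F s U → SmoothSec V V (fun x => anchor x (s x)) U
  anchor_surjective : ∀ x, Function.Surjective (anchor x)
  anchor_ker : ∀ x, (pairing x).orthogonal (LinearMap.ker (anchor x)) = LinearMap.ker (anchor x)
  bracket : (Π x, E x) → (Π x, E x) → Π x, E x
  bracket_congr : ∀ (U : Set M), IsOpen U → ∀ a a' b b' : Π x, E x,
    SmoothSec V F a U → SmoothSec V F b U →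
    (∀ x ∈ U, a x = a' x) → (∀ x ∈ U, b x = b' x) → ∀ x ∈ U, bracket a b x = bracket a' b' x
  bracket_smooth : ∀ (U : Set M), IsOpen U → ∀ a b : Π x, E x,
    SmoothSec V F a U → SmoothSec V F b U → SmoothSec V F (bracket a b) U
  bracket_add_left : ∀ (U : Set M), IsOpen U → ∀ a a' b : Π x, E x,
    SmoothSec V F a U → SmoothSec V F a' U → SmoothSec V F b U →
    ∀ x ∈ U, bracket (fun y => a y + a' y) b x = bracket a b x + bracket a' b x
  bracket_add_right : ∀ (U : Set M), IsOpen U → ∀ a b b' : Π x, E x,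
    SmoothSec V F a U → SmoothSec V F b U → SmoothSec V F b' U →
    ∀ x ∈ U, bracket a (fun y => b y + b' y) x = bracket a b x + bracket a b' x
  bracket_smul_left : ∀ (U : Set M), IsOpen U → ∀ (c : ℝ) (a b : Π x, E x),
    SmoothSec V F a U → SmoothSec V F b U →
    ∀ x ∈ U, bracket (fun y => c • a y) b x = c • bracket a b x
  bracket_leibniz : ∀ (U : Set M), IsOpen U → ∀ (f : M → ℝ) (a b : Π x, E x),
    SmoothFun V f U → SmoothSec V F a U → SmoothSec V F b U →
    ∀ x ∈ U, bracket a (fun y => f y • b y) x =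
      f x • bracket a b x + deriv1 V f x (anchor x (a x)) • b x
  bracket_jacobi : ∀ (U : Set M), IsOpen U → ∀ a b c : Π x, E x,
    SmoothSec V F a U → SmoothSec V F b U → SmoothSec V F c U →
    ∀ x ∈ U, bracket a (bracket b c) x = bracket (bracket a b) c x + bracket b (bracket a c) x
  anchor_bracket : ∀ (U : Set M), IsOpen U → ∀ a b : Π x, E x,
    SmoothSec V F a U → SmoothSec V F b U →
    ∀ x ∈ U, anchor x (bracket a b x) = VectorField.mlieBracket 𝓘(ℝ, V)
      (fun y => anchor y (a y)) (fun y => anchor y (b y)) x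
  bracket_invariant : ∀ (U : Set M), IsOpen U → ∀ a b c : Π x, E x,
    SmoothSec V F a U → SmoothSec V F b U → SmoothSec V F c U →
    ∀ x ∈ U, deriv1 V (fun y => pairing y (b y) (c y)) x (anchor x (a x)) =
      pairing x (bracket a b x) (c x) + pairing x (b x) (bracket a c x)
  bracket_symm_part : ∀ (U : Set M), IsOpen U → ∀ a b : Π x, E x,
    SmoothSec V F a U → SmoothSec V F b U →
    ∀ x ∈ U, ∀ z : E x, pairing x (bracket a b x + bracket b a x) z =
      deriv1 V (fun y => pairing y (a y) (b y)) x (anchor x z)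

end Courant

namespace ExactCourantAlgebroid

variable {V : Type u} [NormedAddCommGroup V] [NormedSpace ℝ V]
  {M : Type v} [TopologicalSpace M] [ChartedSpace V M] [IsManifold 𝓘(ℝ, V) ∞ M]
  {F : Type*} [NormedAddCommGroup F] [NormedSpace ℝ F]
  {E : M → Type w} [∀ x, AddCommGroup (E x)] [∀ x, Module ℝ (E x)]
  [TopologicalSpace (TotalSpace F E)] [∀ x, TopologicalSpace (E x)] [FiberBundle F E]
  (C : ExactCourantAlgebroid V F E)

/-- The complex bilinear pairing on the complexification of `E`. -/
def cPairing (x : M) : LinearMap.BilinForm ℂ (ℂ ⊗[ℝ] E x) :=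
  LinearMap.BilinForm.baseChange ℂ (C.pairing x)

/-- The anchor of the complexification of `E`. -/
def cAnchor (x : M) : ℂ ⊗[ℝ] E x →ₗ[ℂ] CT V x := (C.anchor x).baseChange ℂ

/-- The complex bilinear Courant bracket on sections of the complexification of `E`. -/
def cBracket (s t : Π x, ℂ ⊗[ℝ] E x) : Π x, ℂ ⊗[ℝ] E x := complexify C.bracket s t

/-- The orthogonal complement of a family of subspaces. -/
def perp (D : Π x, Submodule ℂ (ℂ ⊗[ℝ] E x)) (x : M) : Submodule ℂ (ℂ ⊗[ℝ] E x) :=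
  (C.cPairing x).orthogonal (D x)

/-- The bracket of two smooth local sections of `D` and `L` is a section of `L`.  For `L = D` this
is involutivity of `D`. -/
def BracketMem (D L : Π x, Submodule ℂ (ℂ ⊗[ℝ] E x)) : Prop :=
  ∀ (U : Set M), IsOpen U → ∀ s t : Π x, ℂ ⊗[ℝ] E x,
    SmoothCSec V F s U → SmoothCSec V F t U → (∀ x ∈ U, s x ∈ D x) → (∀ x ∈ U, t x ∈ L x) →
    ∀ x ∈ U, C.cBracket s t x ∈ L x

/-- A Dirac structure in the complexification of `E`. -/
structure IsDirac (L : Π x, Submodule ℂ (ℂ ⊗[ℝ] E x)) : Prop where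
  subbundle : IsSmoothSubbundle V F L
  maximal_isotropic : ∀ x, C.perp L x = L x
  involutive : C.BracketMem L L

/-- A lifting of the antiholomorphic tangent bundle `T01` of `(M, J)` to the complexification of
`E`: an isotropic, involutive subbundle mapped isomorphically to `T01` by the anchor. -/
structure IsLifting (J : TEnd V M) (D : Π x, Submodule ℂ (ℂ ⊗[ℝ] E x)) : Prop where
  subbundle : IsSmoothSubbundle V F D
  isotropic : ∀ x, D x ≤ C.perp D x
  involutive : C.BracketMem D D
  anchor_bijOn : ∀ x, BijOn (C.cAnchor x) (D x : Set (ℂ ⊗[ℝ] E x)) (T01 J x : Set (CT V x))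

/-- A Dirac structure `L` can be reduced by `D` if `L ∩ D^⊥` has constant rank and `L` is invariant
under `D`. -/
structure IsReducible (D L : Π x, Submodule ℂ (ℂ ⊗[ℝ] E x)) : Prop where
  dirac : C.IsDirac L
  constant_rank : ∃ r : ℕ, ∀ x, Module.finrank ℂ ↥(L x ⊓ C.perp D x) = r
  invariant : C.BracketMem D L

/-- A holomorphic Courant algebroid `𝓔` over `(M, J)` together with an identification of `𝓔` with
the quotient `D^⊥ / D` (the map `q` is the quotient map), such that
* the smooth sections of `𝓔` are those that lift locally to smooth sections of `D^⊥`;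
* the pairing is induced by the pairing of `E`;
* the anchor is the `(1,0)`-part of the anchor of `E`;
* the Dolbeault operator is `dbar X s = [X', s'] mod D`, for `X'` the section of `D` over `X` and
  `s'` any section of `D^⊥` which lifts `s`;
* the bracket of holomorphic sections is `[s', t'] mod D`, for any sections `s'`, `t'` of `D^⊥`
  which lift them.
These requirements determine `𝓔` up to unique isomorphism. -/
structure Reduction (J : TEnd V M) (D : Π x, Submodule ℂ (ℂ ⊗[ℝ] E x)) where
  𝓔 : HolCourantAlgebroid.{u, v, w} J
  q : Π x : M, C.perp D x →ₗ[ℂ] 𝓔.Fiber x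
  q_surjective : ∀ x, Function.Surjective (q x)
  q_eq_zero_iff : ∀ x (a : C.perp D x), q x a = 0 ↔ (a : ℂ ⊗[ℝ] E x) ∈ D x
  smooth_iff : ∀ (U : Set M), IsOpen U → ∀ s : Π x, 𝓔.Fiber x,
    𝓔.IsSmooth s U ↔ ∀ x ∈ U, ∃ W : Set M, IsOpen W ∧ x ∈ W ∧ ∃ a : Π y, C.perp D y,
      SmoothCSec V F (fun y => (a y : ℂ ⊗[ℝ] E y)) W ∧ ∀ y ∈ W, q y (a y) = s y
  pairing_eq : ∀ x (a b : C.perp D x), 𝓔.pairing x (q x a) (q x b) = C.cPairing x a b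
  anchor_eq : ∀ x (a : C.perp D x), 𝓔.anchor x (q x a) = P10 J x (C.cAnchor x a)
  dbar_eq : ∀ (U : Set M), IsOpen U → ∀ (d : Π y, D y) (a : Π y, C.perp D y),
    SmoothCSec V F (fun y => (d y : ℂ ⊗[ℝ] E y)) U →
    SmoothCSec V F (fun y => (a y : ℂ ⊗[ℝ] E y)) U →
    ∀ x ∈ U, ∃ c : C.perp D x,
      (c : ℂ ⊗[ℝ] E x) =
        C.cBracket (fun y => (d y : ℂ ⊗[ℝ] E y)) (fun y => (a y : ℂ ⊗[ℝ] E y)) x ∧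
      𝓔.dbar (fun y => C.cAnchor y (d y)) (fun y => q y (a y)) x = q x c
  bracket_eq : ∀ (U : Set M), IsOpen U → ∀ a b : Π y, C.perp D y,
    SmoothCSec V F (fun y => (a y : ℂ ⊗[ℝ] E y)) U →
    SmoothCSec V F (fun y => (b y : ℂ ⊗[ℝ] E y)) U →
    𝓔.toHolVectorBundle.IsHol (fun y => q y (a y)) U →
    𝓔.toHolVectorBundle.IsHol (fun y => q y (b y)) U →
    ∀ x ∈ U, ∃ c : C.perp D x,
      (c : ℂ ⊗[ℝ] E x) =
        C.cBracket (fun y => (a y : ℂ ⊗[ℝ] E y)) (fun y => (b y : ℂ ⊗[ℝ] E y)) x ∧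
      𝓔.bracket (fun y => q y (a y)) (fun y => q y (b y)) x = q x c

/-- The reduction `(L ∩ D^⊥ + D) / D` of `L`. -/
def Reduction.reduce {C : ExactCourantAlgebroid V F E} {J : TEnd V M}
    {D : Π x, Submodule ℂ (ℂ ⊗[ℝ] E x)} (R : C.Reduction J D)
    (L : Π x, Submodule ℂ (ℂ ⊗[ℝ] E x)) (x : M) : Submodule ℂ (R.𝓔.Fiber x) :=
  ((L x).comap (C.perp D x).subtype).map (R.q x)

/-! ### Generalized complex and generalized Kähler structures -/

/-- The `c`-eigenbundle, in the complexification of `E`, of a real endomorphism of `E`. -/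
def eigenbundle (𝒥 : Π x, E x →ₗ[ℝ] E x) (c : ℂ) (x : M) : Submodule ℂ (ℂ ⊗[ℝ] E x) :=
  Module.End.eigenspace ((𝒥 x).baseChange ℂ) c

/-- A generalized complex structure on `E`: a smooth orthogonal endomorphism with square `-1` whose
`+i`-eigenbundle is involutive. -/
structure IsGenComplex (𝒥 : Π x, E x →ₗ[ℝ] E x) : Prop where
  smooth : ∀ (U : Set M), IsOpen U → ∀ s : Π x, E x,
    SmoothSec V F s U → SmoothSec V F (fun x => 𝒥 x (s x)) U
  orthogonal : ∀ x a b, C.pairing x (𝒥 x a) (𝒥 x b) = C.pairing x a b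
  sq : ∀ x a, 𝒥 x (𝒥 x a) = -a
  involutive : C.BracketMem (eigenbundle 𝒥 Complex.I) (eigenbundle 𝒥 Complex.I)

/-- A generalized Kähler structure on `E`: two commuting generalized complex structures such that
`G (a, b) = ⟨Jp a, Jm b⟩` is positive definite. -/
structure GenKahler where
  Jp : Π x, E x →ₗ[ℝ] E x
  Jm : Π x, E x →ₗ[ℝ] E x
  isGenComplex_p : C.IsGenComplex Jp
  isGenComplex_m : C.IsGenComplex Jm
  comm : ∀ x a, Jp x (Jm x a) = Jm x (Jp x a)
  posDef : ∀ x a, a ≠ 0 → 0 < C.pairing x (Jp x a) (Jm x a)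

namespace GenKahler

variable {C} (K : C.GenKahler)

/-- The generalized metric as an endomorphism, `G = - Jp Jm`. -/
def G (x : M) : E x →ₗ[ℝ] E x := -(K.Jp x ∘ₗ K.Jm x)

/-- The positive definite subbundle `C_+`, the `+1`-eigenbundle of `G`. -/
def Cplus (x : M) : Submodule ℝ (E x) := Module.End.eigenspace (K.G x) 1

/-- The negative definite subbundle `C_-`, the `-1`-eigenbundle of `G`. -/
def Cminus (x : M) : Submodule ℝ (E x) := Module.End.eigenspace (K.G x) (-1)

/-- The `c`-eigenbundle of `J_+`. -/
def eigP (c : ℂ) : Π x : M, Submodule ℂ (ℂ ⊗[ℝ] E x) := eigenbundle K.Jp c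

/-- The `c`-eigenbundle of `J_-`. -/
def eigM (c : ℂ) : Π x : M, Submodule ℂ (ℂ ⊗[ℝ] E x) := eigenbundle K.Jm c

/-- `ℓ̄_+ = conj L_+ ∩ conj L_-`, where `L_±` is the `+i`-eigenbundle of `J_±`, so that its complex
conjugate is the `-i`-eigenbundle. -/
def ellBarPlus (x : M) : Submodule ℂ (ℂ ⊗[ℝ] E x) :=
  K.eigP (-Complex.I) x ⊓ K.eigM (-Complex.I) x

/-- `ℓ̄_- = conj L_+ ∩ L_-`, where `L_±` is the `+i`-eigenbundle of `J_±`. -/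
def ellBarMinus (x : M) : Submodule ℂ (ℂ ⊗[ℝ] E x) :=
  K.eigP (-Complex.I) x ⊓ K.eigM Complex.I x

/-- The restriction of the anchor to `C_+`. -/
def anchorPlus (x : M) : K.Cplus x →ₗ[ℝ] TangentSpace 𝓘(ℝ, V) x :=
  (C.anchor x).domRestrict (K.Cplus x)

/-- The restriction of the anchor to `C_-`. -/
def anchorMinus (x : M) : K.Cminus x →ₗ[ℝ] TangentSpace 𝓘(ℝ, V) x :=
  (C.anchor x).domRestrict (K.Cminus x)

theorem pairing_G (x : M) (a b : E x) :
    C.pairing x (K.G x a) b = C.pairing x (K.Jp x a) (K.Jm x b) := by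
  have h : K.G x a = -(K.Jm x (K.Jp x a)) := by simp [G, K.comm]
  rw [h, ← K.isGenComplex_m.orthogonal x (-(K.Jm x (K.Jp x a))) b, map_neg,
    K.isGenComplex_m.sq, neg_neg]

theorem G_sq (x : M) (a : E x) : K.G x (K.G x a) = a := by
  simp [G, ← K.comm, K.isGenComplex_m.sq, K.isGenComplex_p.sq]

theorem anchor_isotropic (x : M) (a : E x) (ha : C.anchor x a = 0) : C.pairing x a a = 0 := by
  have h : a ∈ (C.pairing x).orthogonal (LinearMap.ker (C.anchor x)) := by
    rw [C.anchor_ker]; exact ha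
  exact h a ha

theorem anchorPlus_injective (x : M) : Function.Injective (K.anchorPlus x) := by
  rw [← LinearMap.ker_eq_bot, LinearMap.ker_eq_bot']
  rintro ⟨a, ha⟩ h
  have hG : K.G x a = a := by simpa [Cplus] using ha
  by_contra hne
  have hpos := K.posDef x a (fun h0 => hne (Subtype.ext h0))
  rw [← K.pairing_G, hG, anchor_isotropic x a h] at hpos
  exact lt_irrefl _ hpos

theorem anchorMinus_injective (x : M) : Function.Injective (K.anchorMinus x) := by
  rw [← LinearMap.ker_eq_bot, LinearMap.ker_eq_bot']
  rintro ⟨a, ha⟩ h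
  have hG : K.G x a = -a := by simpa [Cminus] using ha
  by_contra hne
  have hpos := K.posDef x a (fun h0 => hne (Subtype.ext h0))
  rw [← K.pairing_G, hG, map_neg, LinearMap.neg_apply, anchor_isotropic x a h] at hpos
  simp at hpos

theorem Cplus_sup_Cminus (x : M) : K.Cplus x ⊔ K.Cminus x = ⊤ := by
  rw [eq_top_iff]
  intro a _
  rw [Submodule.mem_sup]
  refine ⟨(1 / 2 : ℝ) • (a + K.G x a), ?_, (1 / 2 : ℝ) • (a - K.G x a), ?_, ?_⟩
  · simp [Cplus, K.G_sq, add_comm]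
  · simp [Cminus, K.G_sq]
  · rw [← smul_add]
    have : a + K.G x a + (a - K.G x a) = (2 : ℝ) • a := by rw [two_smul]; abel
    rw [this, smul_smul]
    norm_num

section

variable [FiniteDimensional ℝ V] [FiniteDimensional ℝ F] [VectorBundle ℝ F E]

theorem anchor_surjective_pm (x : M) :
    Function.Surjective (K.anchorPlus x) ∧ Function.Surjective (K.anchorMinus x) := by
  have fE : FiniteDimensional ℝ (E x) :=
    LinearEquiv.finiteDimensional ((trivializationAt F E x).continuousLinearEquivAt ℝ x
      (FiberBundle.mem_baseSet_trivializationAt F E x)).toLinearEquiv.symm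
  have fT : FiniteDimensional ℝ (TangentSpace 𝓘(ℝ, V) x) :=
    inferInstanceAs (FiniteDimensional ℝ V)
  have h1 := LinearMap.finrank_le_finrank_of_injective (K.anchorPlus_injective x)
  have h2 := LinearMap.finrank_le_finrank_of_injective (K.anchorMinus_injective x)
  have h3 := Submodule.finrank_add_le_finrank_add_finrank (K.Cplus x) (K.Cminus x)
  rw [K.Cplus_sup_Cminus, finrank_top] at h3
  have h4 := LinearMap.finrank_range_add_finrank_ker (C.anchor x)
  rw [LinearMap.range_eq_top.2 (C.anchor_surjective x), finrank_top] at h4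
  have hrefl : (C.pairing x).IsRefl := fun a b h => by rw [C.pairing_symm]; exact h
  have hnd : (C.pairing x).Nondegenerate :=
    (hrefl.nondegenerate_iff_separatingLeft).2 (fun a h => C.pairing_nondeg x a h)
  have h5 := LinearMap.BilinForm.finrank_orthogonal hnd (LinearMap.ker (C.anchor x))
  rw [C.anchor_ker] at h5
  have h6 := Submodule.finrank_le (LinearMap.ker (C.anchor x))
  refine ⟨(LinearMap.injective_iff_surjective_of_finrank_eq_finrank (by omega)).1
    (K.anchorPlus_injective x), (LinearMap.injective_iff_surjective_of_finrank_eq_finrank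
      (by omega)).1 (K.anchorMinus_injective x)⟩

/-- The splitting `s_+` of the anchor with image `C_+`. -/
def sPlus (x : M) : TangentSpace 𝓘(ℝ, V) x ≃ₗ[ℝ] K.Cplus x :=
  (LinearEquiv.ofBijective (K.anchorPlus x)
    ⟨K.anchorPlus_injective x, (K.anchor_surjective_pm x).1⟩).symm

/-- The splitting `s_-` of the anchor with image `C_-`. -/
def sMinus (x : M) : TangentSpace 𝓘(ℝ, V) x ≃ₗ[ℝ] K.Cminus x :=
  (LinearEquiv.ofBijective (K.anchorMinus x)
    ⟨K.anchorMinus_injective x, (K.anchor_surjective_pm x).2⟩).symm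

/-- The complex structure `I_+` of `X_+`: the transport to the tangent bundle, under the splitting
`s_+`, of the restriction of `J_+` to `C_+`. -/
def Iplus : TEnd V M := fun x =>
  C.anchor x ∘ₗ K.Jp x ∘ₗ (K.Cplus x).subtype ∘ₗ (K.sPlus x).toLinearMap

/-- The complex structure `I_-` of `X_-`: the transport to the tangent bundle, under the splitting
`s_-`, of the restriction of `J_+` to `C_-`. -/
def Iminus : TEnd V M := fun x =>
  C.anchor x ∘ₗ K.Jp x ∘ₗ (K.Cminus x).subtype ∘ₗ (K.sMinus x).toLinearMap

end

end GenKahler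

end ExactCourantAlgebroid

end GKGeom

end

/-! Write `E = C_+ ⊕ C_-` for the eigenbundles of the involution `-Jp Jm`. Positivity makes the
anchor injective on both summands, since its kernel is isotropic, and a dimension count makes it
bijective there. `SplitPair` keeps only what is needed afterwards: two commuting generalized complex
structures and the inverse splittings `σ`, `τ` of the anchor. Replacing `Jm` by `-Jm` exchanges `σ`
and `τ` (`swap`), so both signs follow from the single `reduction_theorem`.

Let `D` be the common `-i`-eigenbundle. The algebraic core is that `D^⊥` is the direct sum of `D`
and the complexified `C_-` (`sub_Q_mem`, `mem_perp_D`). Hence `D^⊥ / D` can be modelled by the range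
of the self-adjoint projection `Q = (1 + Jp Jm) / 2`, with the operations of `E` followed by `Q`.

The differential input is `[D, D] ⊂ D`, inherited from the two eigenbundles. Invariance of the
pairing then gives `[D, D^⊥] ⊂ D^⊥`, and Jacobi gives flatness of the Dolbeault operator.
Holomorphic sections correspond to sections `a` of `D^⊥` with `[D, a] ⊂ D` (`HolLift`, `isHol_iff`).
These are closed under the bracket by Jacobi, and changing lifts by sections of `D` changes their
brackets by sections of `D`, so the Courant axioms descend. Exactness is a double-orthogonal
computation with `D + ker π`. Integrability of the complex structure holds because `σ` carries `T10`
into the intersection of the two `+i`-eigenbundles, both of which are involutive.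

For the Dirac structures, a `-i`-eigenbundle `L` is Lagrangian, involutive and contains `D`.
Therefore `D ⊂ L = L^⊥ ⊂ D^⊥`, and maximal isotropy, `dbar`-invariance and involutivity pass to `L /
D` (`isHolDirac_reduce`). The argument uses only the defining properties of a `Reduction`, so it
applies to every one of them. Transversality is linear algebra: the two eigenbundles meet in `D`,
and on `C_-` one has `Jm = -Jp`, so the projections of `b` to the two `-i`-eigenbundles, `(b ± i Jp
b) / 2`, add up to `b`.

Smoothness rests on two facts: the image of a smooth field of projections has smooth local frames
(`exists_frame_range`, by Cramer's rule), and the splitting `σ`, as the inverse of a smooth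
isomorphism, preserves smoothness (`smoothCSec_cσ`). -/

noncomputable section

namespace GKGeom

/-! ### Linear algebra of the complexification -/

section Complexification

variable {W : Type*} [AddCommGroup W] [Module ℝ W]

@[simp] theorem cre_tmul (z : ℂ) (a : W) : cre (z ⊗ₜ[ℝ] a) = z.re • a := by simp [cre]

@[simp] theorem cim_tmul (z : ℂ) (a : W) : cim (z ⊗ₜ[ℝ] a) = z.im • a := by simp [cim]

@[simp] theorem cre_cmk (a b : W) : cre (cmk a b) = a := by simp [cmk]

@[simp] theorem cim_cmk (a b : W) : cim (cmk a b) = b := by simp [cmk]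

theorem cre_smul (z : ℂ) (s : ℂ ⊗[ℝ] W) : cre (z • s) = z.re • cre s - z.im • cim s := by
  induction s using TensorProduct.induction_on with
  | zero => simp
  | tmul w a => simp [TensorProduct.smul_tmul', sub_smul, mul_smul]
  | add s t hs ht => simp only [smul_add, map_add, hs, ht]; abel

theorem cim_smul (z : ℂ) (s : ℂ ⊗[ℝ] W) : cim (z • s) = z.re • cim s + z.im • cre s := by
  induction s using TensorProduct.induction_on with
  | zero => simp
  | tmul w a => simp [TensorProduct.smul_tmul', add_smul, mul_smul]
  | add s t hs ht => simp only [smul_add, map_add, hs, ht]; abel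

theorem cmk_cre_cim (s : ℂ ⊗[ℝ] W) : cmk (cre s) (cim s) = s := by
  induction s using TensorProduct.induction_on with
  | zero => simp [cmk]
  | tmul w a =>
    simp only [cmk, cre_tmul, cim_tmul, ← TensorProduct.smul_tmul, ← TensorProduct.add_tmul]
    congr 1
    apply Complex.ext <;> simp
  | add s t hs ht =>
    conv_rhs => rw [← hs, ← ht]
    simp only [cmk, map_add, TensorProduct.tmul_add]; abel

theorem cext {s t : ℂ ⊗[ℝ] W} (h₁ : cre s = cre t) (h₂ : cim s = cim t) : s = t := by
  rw [← cmk_cre_cim s, ← cmk_cre_cim t, h₁, h₂]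

/-- Complex conjugation. -/
def cconj (s : ℂ ⊗[ℝ] W) : ℂ ⊗[ℝ] W := cmk (cre s) (-cim s)

theorem cconj_cconj (s : ℂ ⊗[ℝ] W) : cconj (cconj s) = s :=
  cext (by simp [cconj]) (by simp [cconj])

variable {W' : Type*} [AddCommGroup W'] [Module ℝ W']

@[simp] theorem cre_baseChange (f : W →ₗ[ℝ] W') (s : ℂ ⊗[ℝ] W) :
    cre (f.baseChange ℂ s) = f (cre s) := by
  induction s using TensorProduct.induction_on with
  | zero => simp
  | tmul w a => simp
  | add s t hs ht => simp only [map_add, hs, ht]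

@[simp] theorem cim_baseChange (f : W →ₗ[ℝ] W') (s : ℂ ⊗[ℝ] W) :
    cim (f.baseChange ℂ s) = f (cim s) := by
  induction s using TensorProduct.induction_on with
  | zero => simp
  | tmul w a => simp
  | add s t hs ht => simp only [map_add, hs, ht]

/-- Reduces every identity for the complex pairing to identities between four real pairings. -/
theorem bilinBaseChange_apply (B : LinearMap.BilinForm ℝ W) (s t : ℂ ⊗[ℝ] W) :
    LinearMap.BilinForm.baseChange ℂ B s t =
      ((B (cre s) (cre t) - B (cim s) (cim t) : ℝ) : ℂ) +
        ((B (cre s) (cim t) + B (cim s) (cre t) : ℝ) : ℂ) * Complex.I := by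
  induction s using TensorProduct.induction_on with
  | zero => simp
  | tmul z a =>
    induction t using TensorProduct.induction_on with
    | zero => simp
    | tmul w b =>
      simp only [LinearMap.BilinForm.baseChange_tmul, cre_tmul, cim_tmul, map_smul,
        LinearMap.smul_apply, smul_eq_mul]
      apply Complex.ext <;> simp <;> ring
    | add s t hs ht =>
      rw [map_add, hs, ht]; simp only [map_add]; push_cast; ring
  | add s t hs ht =>
    rw [map_add, LinearMap.add_apply, hs, ht]
    simp only [map_add, LinearMap.add_apply]; push_cast; ring

end Complexification

/-! ### Smooth sections -/

section Smooth

variable {V : Type u} [NormedAddCommGroup V] [NormedSpace ℝ V]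
  {M : Type v} [TopologicalSpace M] [ChartedSpace V M]
  {F : Type*} [NormedAddCommGroup F] [NormedSpace ℝ F]
  {E : M → Type*} [TopologicalSpace (TotalSpace F E)] [∀ x, TopologicalSpace (E x)]
  [FiberBundle F E]

theorem SmoothSec.mono {s : Π x, E x} {U W : Set M} (h : SmoothSec V F s U) (hW : W ⊆ U) :
    SmoothSec V F s W := ContMDiffOn.mono h hW

theorem SmoothSec.congr {s t : Π x, E x} {U : Set M} (h : SmoothSec V F s U)
    (e : ∀ x ∈ U, t x = s x) : SmoothSec V F t U :=
  ContMDiffOn.congr h fun x hx => by rw [e x hx]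

/-- On an open neighbourhood smoothness within the set is smoothness at the point, so the
neighbourhoods need not lie in `U`. -/
theorem smoothSec_of_locally {s : Π x, E x} {U : Set M}
    (h : ∀ x ∈ U, ∃ W : Set M, IsOpen W ∧ x ∈ W ∧ SmoothSec V F s W) : SmoothSec V F s U :=
  fun x hx => let ⟨_, hW, hxW, hs⟩ := h x hx
    (ContMDiffOn.contMDiffAt hs (hW.mem_nhds hxW)).contMDiffWithinAt

variable [∀ x, AddCommGroup (E x)] [∀ x, Module ℝ (E x)]

theorem SmoothCSec.mono {s : Π x, ℂ ⊗[ℝ] E x} {U W : Set M} (h : SmoothCSec V F s U)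
    (hW : W ⊆ U) : SmoothCSec V F s W := ⟨h.1.mono hW, h.2.mono hW⟩

theorem SmoothCSec.congr {s t : Π x, ℂ ⊗[ℝ] E x} {U : Set M} (h : SmoothCSec V F s U)
    (e : ∀ x ∈ U, t x = s x) : SmoothCSec V F t U :=
  ⟨h.1.congr fun x hx => by rw [e x hx], h.2.congr fun x hx => by rw [e x hx]⟩

theorem smoothCSec_of_locally {s : Π x, ℂ ⊗[ℝ] E x} {U : Set M}
    (h : ∀ x ∈ U, ∃ W : Set M, IsOpen W ∧ x ∈ W ∧ SmoothCSec V F s W) : SmoothCSec V F s U :=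
  ⟨smoothSec_of_locally fun x hx => let ⟨W, hW, hx, h⟩ := h x hx; ⟨W, hW, hx, h.1⟩,
    smoothSec_of_locally fun x hx => let ⟨W, hW, hx, h⟩ := h x hx; ⟨W, hW, hx, h.2⟩⟩

theorem SmoothCFun.mono {f : M → ℂ} {U W : Set M} (h : SmoothCFun V f U) (hW : W ⊆ U) :
    SmoothCFun V f W := ContMDiffOn.mono h hW

theorem SmoothCFun.congr {f g : M → ℂ} {U : Set M} (h : SmoothCFun V f U)
    (e : ∀ x ∈ U, g x = f x) : SmoothCFun V g U := ContMDiffOn.congr h e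

theorem SmoothCFun.re {f : M → ℂ} {U : Set M} (h : SmoothCFun V f U) :
    SmoothFun V (fun x => (f x).re) U :=
  (Complex.reCLM.contMDiff (n := ∞)).comp_contMDiffOn h

theorem SmoothCFun.im {f : M → ℂ} {U : Set M} (h : SmoothCFun V f U) :
    SmoothFun V (fun x => (f x).im) U :=
  (Complex.imCLM.contMDiff (n := ∞)).comp_contMDiffOn h

theorem SmoothFun.ofReal {f : M → ℝ} {U : Set M} (h : SmoothFun V f U) :
    SmoothCFun V (fun x => (f x : ℂ)) U :=
  (Complex.ofRealCLM.contMDiff (n := ∞)).comp_contMDiffOn h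

theorem smoothCFun_const (c : ℂ) (U : Set M) : SmoothCFun V (fun _ : M => c) U :=
  contMDiffOn_const

theorem SmoothCFun.add {f g : M → ℂ} {U : Set M} (hf : SmoothCFun V f U)
    (hg : SmoothCFun V g U) : SmoothCFun V (fun x => f x + g x) U := ContMDiffOn.add hf hg

theorem SmoothCFun.mul {f g : M → ℂ} {U : Set M} (hf : SmoothCFun V f U)
    (hg : SmoothCFun V g U) : SmoothCFun V (fun x => f x * g x) U :=
  (contDiff_mul (𝕜 := ℝ) (𝔸 := ℂ)).contMDiff.comp_contMDiffOn (hf.prodMk_space hg)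

theorem SmoothCFun.sum {ι : Type*} {t : Finset ι} {f : ι → M → ℂ} {U : Set M}
    (h : ∀ i ∈ t, SmoothCFun V (f i) U) : SmoothCFun V (fun x => ∑ i ∈ t, f i x) U :=
  contMDiffOn_finsetSum h

theorem smoothCFun_of_re_im {f : M → ℂ} {U : Set M} (h₁ : SmoothFun V (fun x => (f x).re) U)
    (h₂ : SmoothFun V (fun x => (f x).im) U) : SmoothCFun V f U :=
  (h₁.ofReal.add (h₂.ofReal.mul (smoothCFun_const Complex.I U))).congr fun x _ =>
    (Complex.re_add_im (f x)).symm

theorem smoothCSec_cmk {s t : Π x, E x} {U : Set M} (hs : SmoothSec V F s U)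
    (ht : SmoothSec V F t U) : SmoothCSec V F (fun x => cmk (s x) (t x)) U :=
  ⟨hs.congr fun x _ => by simp, ht.congr fun x _ => by simp⟩

variable [VectorBundle ℝ F E]

theorem SmoothSec.add {s t : Π x, E x} {U : Set M} (hs : SmoothSec V F s U)
    (ht : SmoothSec V F t U) : SmoothSec V F (fun x => s x + t x) U :=
  ContMDiffOn.add_section hs ht

theorem SmoothSec.smul {f : M → ℝ} {s : Π x, E x} {U : Set M} (hf : SmoothFun V f U)
    (hs : SmoothSec V F s U) : SmoothSec V F (fun x => f x • s x) U :=
  ContMDiffOn.smul_section hf hs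

theorem SmoothSec.const_smul {s : Π x, E x} {U : Set M} (c : ℝ)
    (hs : SmoothSec V F s U) : SmoothSec V F (fun x => c • s x) U :=
  ContMDiffOn.const_smul_section hs

theorem SmoothSec.neg {s : Π x, E x} {U : Set M}
    (hs : SmoothSec V F s U) : SmoothSec V F (fun x => - s x) U :=
  (hs.const_smul (-1)).congr fun x _ => by simp

theorem SmoothSec.sub {s t : Π x, E x} {U : Set M} (hs : SmoothSec V F s U)
    (ht : SmoothSec V F t U) : SmoothSec V F (fun x => s x - t x) U :=
  (hs.add ht.neg).congr fun x _ => by rw [sub_eq_add_neg]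

theorem smoothSec_zero (U : Set M) : SmoothSec V F (fun x : M => (0 : E x)) U :=
  (contMDiff_zeroSection (IB := 𝓘(ℝ, V)) (n := ∞) ℝ E).contMDiffOn

theorem SmoothCSec.add {s t : Π x, ℂ ⊗[ℝ] E x} {U : Set M} (hs : SmoothCSec V F s U)
    (ht : SmoothCSec V F t U) : SmoothCSec V F (fun x => s x + t x) U :=
  ⟨(hs.1.add ht.1).congr fun x _ => by simp, (hs.2.add ht.2).congr fun x _ => by simp⟩

theorem SmoothCSec.sub {s t : Π x, ℂ ⊗[ℝ] E x} {U : Set M} (hs : SmoothCSec V F s U)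
    (ht : SmoothCSec V F t U) : SmoothCSec V F (fun x => s x - t x) U :=
  ⟨(hs.1.sub ht.1).congr fun x _ => by simp, (hs.2.sub ht.2).congr fun x _ => by simp⟩

theorem SmoothCSec.smul {f : M → ℂ} {s : Π x, ℂ ⊗[ℝ] E x} {U : Set M} (hf : SmoothCFun V f U)
    (hs : SmoothCSec V F s U) : SmoothCSec V F (fun x => f x • s x) U :=
  ⟨((hs.1.smul hf.re).sub (hs.2.smul hf.im)).congr fun _ _ => cre_smul _ _,
    ((hs.2.smul hf.re).add (hs.1.smul hf.im)).congr fun _ _ => cim_smul _ _⟩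

theorem SmoothCSec.const_smul {s : Π x, ℂ ⊗[ℝ] E x} {U : Set M} (c : ℂ)
    (hs : SmoothCSec V F s U) : SmoothCSec V F (fun x => c • s x) U :=
  hs.smul (smoothCFun_const c U)

theorem smoothCSec_zero (U : Set M) : SmoothCSec V F (fun x : M => (0 : ℂ ⊗[ℝ] E x)) U :=
  ⟨(smoothSec_zero U).congr fun _ _ => by simp, (smoothSec_zero U).congr fun _ _ => by simp⟩

theorem SmoothCSec.sum {ι : Type*} {A : Finset ι} {s : ι → Π x, ℂ ⊗[ℝ] E x} {U : Set M}
    (h : ∀ i ∈ A, SmoothCSec V F (s i) U) : SmoothCSec V F (fun x => ∑ i ∈ A, s i x) U := by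
  classical
  induction A using Finset.induction_on with
  | empty => simpa using smoothCSec_zero U
  | insert a A ha ih =>
    exact ((h a (by simp)).add (ih fun i hi => h i (by simp [hi]))).congr fun x _ => by
      rw [Finset.sum_insert ha]

theorem SmoothCSec.cconj {s : Π x, ℂ ⊗[ℝ] E x} {U : Set M} (h : SmoothCSec V F s U) :
    SmoothCSec V F (fun x => cconj (s x)) U := smoothCSec_cmk h.1 h.2.neg

end Smooth

end GKGeom

namespace GKGeom

/-! ### Smooth complex frames -/

section Frames

variable {V : Type u} [NormedAddCommGroup V] [NormedSpace ℝ V]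
  {M : Type v} [TopologicalSpace M] [ChartedSpace V M]

theorem SmoothCFun.prod {ι : Type*} {t : Finset ι} {f : ι → M → ℂ} {U : Set M}
    (h : ∀ i ∈ t, SmoothCFun V (f i) U) : SmoothCFun V (fun x => ∏ i ∈ t, f i x) U := by
  classical
  induction t using Finset.induction_on with
  | empty => simpa using smoothCFun_const 1 U
  | insert a A ha ih =>
    exact ((h a (by simp)).mul (ih fun i hi => h i (by simp [hi]))).congr fun x _ => by
      rw [Finset.prod_insert ha]

theorem SmoothCFun.inv {f : M → ℂ} {U : Set M} (h : SmoothCFun V f U) (h0 : ∀ x ∈ U, f x ≠ 0) :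
    SmoothCFun V (fun x => (f x)⁻¹) U := fun x hx =>
  ((contDiffAt_inv ℝ (h0 x hx)).contMDiffAt).comp_contMDiffWithinAt x (h x hx)

theorem SmoothCFun.det {ι : Type*} [Fintype ι] [DecidableEq ι] {A : M → Matrix ι ι ℂ} {U : Set M}
    (h : ∀ i j, SmoothCFun V (fun x => A x i j) U) : SmoothCFun V (fun x => (A x).det) U := by
  simp only [Matrix.det_apply']
  exact SmoothCFun.sum fun σ _ => (smoothCFun_const _ U).mul (SmoothCFun.prod fun i _ => h _ _)

/-- Cramer's rule: the entries are cofactors divided by a nonvanishing determinant. -/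
theorem SmoothCFun.matrix_inv {ι : Type*} [Fintype ι] [DecidableEq ι] {A : M → Matrix ι ι ℂ}
    {U : Set M} (h : ∀ i j, SmoothCFun V (fun x => A x i j) U) (h0 : ∀ x ∈ U, (A x).det ≠ 0)
    (i j : ι) : SmoothCFun V (fun x => (A x)⁻¹ i j) U := by
  simp only [Matrix.inv_def, Ring.inverse_eq_inv', Matrix.smul_apply, smul_eq_mul,
    Matrix.adjugate_apply]
  refine ((SmoothCFun.det h).inv h0).mul (SmoothCFun.det fun k l => ?_)
  -- The matrix whose determinant is the cofactor has its `j`-th row replaced by a constant row; the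
  -- other rows are those of `A`.
  by_cases hk : k = j
  · subst hk; simpa using smoothCFun_const _ U
  · simpa [Matrix.updateRow_ne hk] using h k l

variable {F : Type*} [NormedAddCommGroup F] [NormedSpace ℝ F] [FiniteDimensional ℝ F]
  {E : M → Type*} [TopologicalSpace (TotalSpace F E)] [∀ x, TopologicalSpace (E x)]
  [FiberBundle F E] [∀ x, AddCommGroup (E x)] [∀ x, Module ℝ (E x)] [VectorBundle ℝ F E]
  [ContMDiffVectorBundle ∞ F E 𝓘(ℝ, V)]

variable (F) in
theorem finiteDimensional_fiber {M : Type*} [TopologicalSpace M] {E : M → Type*}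
    [TopologicalSpace (TotalSpace F E)] [∀ x, TopologicalSpace (E x)] [FiberBundle F E]
    [∀ x, AddCommGroup (E x)] [∀ x, Module ℝ (E x)] [VectorBundle ℝ F E] (x : M) :
    FiniteDimensional ℝ (E x) :=
  LinearEquiv.finiteDimensional ((trivializationAt F E x).continuousLinearEquivAt ℝ x
    (FiberBundle.mem_baseSet_trivializationAt F E x)).toLinearEquiv.symm

theorem finrank_fiber (F : Type*) [NormedAddCommGroup F] [NormedSpace ℝ F] {M : Type*}
    [TopologicalSpace M] {E : M → Type*}
    [TopologicalSpace (TotalSpace F E)] [∀ x, TopologicalSpace (E x)] [FiberBundle F E]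
    [∀ x, AddCommGroup (E x)] [∀ x, Module ℝ (E x)] [VectorBundle ℝ F E] (x : M) :
    Module.finrank ℝ (E x) = Module.finrank ℝ F :=
  LinearEquiv.finrank_eq ((trivializationAt F E x).continuousLinearEquivAt ℝ x
    (FiberBundle.mem_baseSet_trivializationAt F E x)).toLinearEquiv

-- A combination of a local frame with constant coefficients, read off from the coordinates of `v`,
-- does it.
variable (V F) in
theorem exists_smoothSec_eq (x₀ : M) (v : E x₀) :
    ∃ U : Set M, IsOpen U ∧ x₀ ∈ U ∧ ∃ s : Π x, E x, SmoothSec V F s U ∧ s x₀ = v := by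
  let e := trivializationAt F E x₀
  have hx₀ : x₀ ∈ e.baseSet := FiberBundle.mem_baseSet_trivializationAt F E x₀
  let b := Module.finBasis ℝ F
  refine ⟨e.baseSet, e.open_baseSet, hx₀,
    fun y => ∑ i, ((e.basisAt b hx₀).repr v i) • e.localFrame b i y, ?_, ?_⟩
  · exact ContMDiffOn.sum_section fun i _ => ContMDiffOn.const_smul_section
      (Trivialization.contMDiffOn_localFrame_baseSet ∞ e b i)
  · simp only [e.localFrame_apply_of_mem_baseSet b hx₀]
    exact (e.basisAt b hx₀).sum_repr v

variable (V F) in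
theorem exists_smoothCSec_eq (x₀ : M) (v : ℂ ⊗[ℝ] E x₀) :
    ∃ U : Set M, IsOpen U ∧ x₀ ∈ U ∧ ∃ s : Π x, ℂ ⊗[ℝ] E x, SmoothCSec V F s U ∧ s x₀ = v := by
  obtain ⟨U, hU, hxU, s, hs, hsv⟩ := exists_smoothSec_eq V F x₀ (cre v)
  obtain ⟨W, hW, hxW, t, ht, htv⟩ := exists_smoothSec_eq V F x₀ (cim v)
  refine ⟨U ∩ W, hU.inter hW, ⟨hxU, hxW⟩, fun x => cmk (s x) (t x),
    smoothCSec_cmk (hs.mono inter_subset_left) (ht.mono inter_subset_right), ?_⟩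
  simp only [hsv, htv, cmk_cre_cim]

variable (V F) in
/-- Near each point there is a complex basis of the complexified bundle in which the coordinates of
smooth sections are smooth. -/
theorem exists_smooth_basis (x₀ : M) {ι : Type*} [Finite ι]
    (hι : Nat.card ι = Module.finrank ℝ F) :
    ∃ U : Set M, IsOpen U ∧ x₀ ∈ U ∧ ∃ B : Π y, y ∈ U → Module.Basis ι ℂ (ℂ ⊗[ℝ] E y),
      ∃ c : ι → Π y, ℂ ⊗[ℝ] E y → ℂ, (∀ y (hy : y ∈ U) v i, (B y hy).repr v i = c i y v) ∧
        ∀ W : Set M, IsOpen W → W ⊆ U → ∀ s : Π x, ℂ ⊗[ℝ] E x, SmoothCSec V F s W →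
          ∀ i, SmoothCFun V (fun y => c i y (s y)) W := by
  have : Fintype ι := Fintype.ofFinite ι
  let e := trivializationAt F E x₀
  have hx₀ : x₀ ∈ e.baseSet := FiberBundle.mem_baseSet_trivializationAt F E x₀
  let b : Module.Basis ι ℝ F := (Module.finBasis ℝ F).reindex
    (Fintype.equivOfCardEq (by rw [Fintype.card_fin, ← hι, Nat.card_eq_fintype_card]))
  have : ContMDiffVectorBundle 1 F E 𝓘(ℝ, V) := ContMDiffVectorBundle.of_le (n := ∞) (by simp)
  refine ⟨e.baseSet, e.open_baseSet, hx₀, fun y hy => (e.basisAt b hy).baseChange ℂ,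
    fun i y v => (e.localFrameCoeff 𝓘(ℝ, V) b i y (cre v) : ℂ) +
      (e.localFrameCoeff 𝓘(ℝ, V) b i y (cim v) : ℂ) * Complex.I, ?_, ?_⟩
  · intro y hy v i
    -- The frame coefficients are described for sections, so the vector `a` is extended by zero to a
    -- section.
    have h (a : E y) :
        e.localFrameCoeff 𝓘(ℝ, V) b i y a = (e.basisAt b hy).repr a i := by
      classical
      simpa using e.localFrameCoeff_apply_of_mem_baseSet (I := 𝓘(ℝ, V)) b hy
        (Function.update (fun _ => 0) y a) i
    simp only [h]
    induction v using TensorProduct.induction_on with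
    | zero => simp
    | tmul z a =>
      simp only [Module.Basis.baseChange_repr_tmul, cre_tmul, cim_tmul, map_smul]
      apply Complex.ext <;> simp [mul_comm]
    | add v w hv hw =>
      rw [map_add, Finsupp.add_apply, hv, hw]
      simp only [map_add, Finsupp.add_apply]; push_cast; ring
  · intro W hW hWU s hs i
    have h1 (t : Π x, E x) (ht : SmoothSec V F t W) :
        SmoothFun V (fun y => e.localFrameCoeff 𝓘(ℝ, V) b i y (t y)) W :=
      contMDiffOn_localFrameCoeff b hW hWU ht i
    exact (h1 _ hs.1).ofReal.add ((h1 _ hs.2).ofReal.mul (smoothCFun_const _ _))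

variable (V F) in
/-- Smooth complex sections which form a basis at a point form a smooth frame near it. -/
theorem exists_frame_of_basis {ι : Type*} [Finite ι] {U : Set M} (hU : IsOpen U) {x₀ : M}
    (hx₀ : x₀ ∈ U) (e : ι → Π x, ℂ ⊗[ℝ] E x) (he : ∀ i, SmoothCSec V F (e i) U)
    (b₀ : Module.Basis ι ℂ (ℂ ⊗[ℝ] E x₀)) (hb₀ : ∀ i, b₀ i = e i x₀) :
    ∃ W : Set M, IsOpen W ∧ x₀ ∈ W ∧ W ⊆ U ∧ ∃ B : Π y, y ∈ W → Module.Basis ι ℂ (ℂ ⊗[ℝ] E y),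
      (∀ y (hy : y ∈ W) i, B y hy i = e i y) ∧
      ∃ c : ι → Π y, ℂ ⊗[ℝ] E y → ℂ, (∀ y (hy : y ∈ W) v i, (B y hy).repr v i = c i y v) ∧
        ∀ W' : Set M, IsOpen W' → W' ⊆ W → ∀ s : Π x, ℂ ⊗[ℝ] E x, SmoothCSec V F s W' →
          ∀ i, SmoothCFun V (fun y => c i y (s y)) W' := by
  classical
  have : Fintype ι := Fintype.ofFinite ι
  have hι : Nat.card ι = Module.finrank ℝ F := by
    rw [Nat.card_eq_fintype_card, ← Module.finrank_eq_card_basis b₀, Module.finrank_baseChange,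
      finrank_fiber F]
  obtain ⟨U', hU', hxU', B, c, hBc, hc⟩ := exists_smooth_basis V F (E := E) x₀ hι
  let A (y : M) : Matrix ι ι ℂ := fun k i => c k y (e i y)
  have hA (k i : ι) : SmoothCFun V (fun y => A y k i) (U ∩ U') :=
    hc _ (hU.inter hU') inter_subset_right _ ((he i).mono inter_subset_left) k
  have hAB (y : M) (hy : y ∈ U') : A y = (B y hy).toMatrix fun i => e i y := by
    ext k i; simp [A, Module.Basis.toMatrix_apply, hBc]
  have hdet := SmoothCFun.det hA
  -- Being a basis is nonvanishing of a continuous determinant, hence an open condition.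
  have hWo : IsOpen ((U ∩ U') ∩ (fun y => (A y).det) ⁻¹' {0}ᶜ) :=
    (ContMDiffOn.continuousOn hdet).isOpen_inter_preimage (hU.inter hU') isOpen_compl_singleton
  have hbas (y : M) (hy : y ∈ (U ∩ U') ∩ (fun y => (A y).det) ⁻¹' {0}ᶜ) :
      LinearIndependent ℂ (fun i => e i y) ∧ Submodule.span ℂ (range fun i => e i y) = ⊤ := by
    rw [Module.Basis.is_basis_iff_det (B y hy.1.2), Module.Basis.det_apply, ← hAB]
    exact isUnit_iff_ne_zero.2 hy.2
  refine ⟨_, hWo, ⟨⟨hx₀, hxU'⟩, ?_⟩, fun y hy => hy.1.1,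
    fun y hy => Module.Basis.mk (hbas y hy).1 (hbas y hy).2.ge, fun y hy i => by simp,
    fun i y v => ∑ k, (A y)⁻¹ i k * c k y v, ?_, ?_⟩
  · have h := (Module.Basis.is_basis_iff_det (B x₀ hxU') (v := fun i => e i x₀)).1 
      (funext hb₀ ▸ ⟨b₀.linearIndependent, b₀.span_eq⟩)
    rw [Module.Basis.det_apply, ← hAB] at h
    exact isUnit_iff_ne_zero.1 h
  · intro y hy v i
    set D := Module.Basis.mk (hbas y hy).1 (hbas y hy).2.ge with hD
    have hDe (j : ι) : D j = e j y := by simp [hD]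
    -- The reference coordinates are `A y` applied to the coordinates in the new frame; inverting `A
    -- y` recovers the latter smoothly.
    have h1 (k : ι) : c k y v = ∑ j, A y k j * D.repr v j := by
      rw [← hBc y hy.1.2]
      conv_lhs => rw [← D.sum_repr v]
      simp [hDe, A, ← hBc y hy.1.2, mul_comm]
    have h2 : (fun k => c k y v) = (A y).mulVec (fun j => D.repr v j) := funext h1
    have h3 : (A y)⁻¹.mulVec (fun k => c k y v) = fun j => D.repr v j := by
      rw [h2, Matrix.mulVec_mulVec, Matrix.nonsing_inv_mul _ (isUnit_iff_ne_zero.2 hy.2),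
        Matrix.one_mulVec]
    exact (congrFun h3 i).symm
  · intro W' hW' hWW' s hs i
    exact SmoothCFun.sum fun k _ => (SmoothCFun.matrix_inv
      (fun k l => (hA k l).mono fun y hy => (hWW' hy).1) (fun y hy => (hWW' hy).2) i k).mul
      (hc W' hW' (fun y hy => (hWW' hy).1.2) s hs k)

variable (V F) in
/-- Fibrewise operators that preserve smoothness of local sections. -/
def SmoothOp (P : Π x, ℂ ⊗[ℝ] E x →ₗ[ℂ] ℂ ⊗[ℝ] E x) : Prop :=
  ∀ (U : Set M), IsOpen U → ∀ s : Π x, ℂ ⊗[ℝ] E x,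
    SmoothCSec V F s U → SmoothCSec V F (fun x => P x (s x)) U

/-- The image of a smooth field of projections has smooth local frames. -/
theorem exists_frame_range {P : Π x, ℂ ⊗[ℝ] E x →ₗ[ℂ] ℂ ⊗[ℝ] E x} (hP : SmoothOp V F P)
    (hPP : ∀ x v, P x (P x v) = P x v) (x₀ : M) :
    ∃ U : Set M, IsOpen U ∧ x₀ ∈ U ∧ ∃ (n : ℕ) (e : Fin n → Π x, ℂ ⊗[ℝ] E x),
      (∀ i, SmoothCSec V F (e i) U) ∧ (∀ i y, P y (e i y) = e i y) ∧
      (∀ y ∈ U, LinearIndependent ℂ (fun i => e i y) ∧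
        Submodule.span ℂ (range fun i => e i y) = LinearMap.range (P y)) ∧
      ∃ c : Fin n → Π y, ℂ ⊗[ℝ] E y → ℂ,
        (∀ y ∈ U, ∀ v, P y v = v → v = ∑ i, c i y v • e i y) ∧
        ∀ W : Set M, IsOpen W → W ⊆ U → ∀ s : Π x, ℂ ⊗[ℝ] E x, SmoothCSec V F s W →
          ∀ i, SmoothCFun V (fun y => c i y (s y)) W := by
  have : FiniteDimensional ℝ (E x₀) := finiteDimensional_fiber F x₀
  let b₁ := Module.finBasis ℂ (LinearMap.range (P x₀))
  let b₂ := Module.finBasis ℂ (LinearMap.ker (P x₀))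
  have hc : IsCompl (LinearMap.range (P x₀)) (LinearMap.ker (P x₀)) :=
    LinearMap.IsIdempotentElem.isCompl (LinearMap.ext fun v => hPP x₀ v)
  let b := (b₁.prod b₂).map (Submodule.prodEquivOfIsCompl _ _ hc)
  have hb₁ (i) : b (Sum.inl i) = b₁ i := by simp [b]
  have hb₂ (i) : b (Sum.inr i) = b₂ i := by simp [b]
  choose U hU hxU s hs hsv using fun i => exists_smoothCSec_eq V F x₀ (b i)
  -- Local extensions of a basis adapted to range and kernel at `x₀` are corrected by `P` and `1 -
  -- P`. The resulting frame is adapted to range and kernel at every nearby point, not only at `x₀`.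
  let e : Fin _ ⊕ Fin _ → Π x, ℂ ⊗[ℝ] E x :=
    Sum.elim (fun i x => P x (s (Sum.inl i) x)) (fun i x => s (Sum.inr i) x - P x (s (Sum.inr i) x))
  have he (i) : SmoothCSec V F (e i) (⋂ j, U j) := by
    have h (j) := (hs j).mono (iInter_subset U j)
    have hPU (j) := hP _ (isOpen_iInter_of_finite hU) _ (h j)
    rcases i with i | i
    exacts [hPU _, (h _).sub (hPU _)]
  obtain ⟨W, hW, hxW, hWU, B, hB, c, hBc, hcs⟩ := exists_frame_of_basis V F
    (isOpen_iInter_of_finite hU) (mem_iInter.2 hxU) e he b (by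
      rintro (i | i)
      · obtain ⟨v, hv⟩ := (b₁ i).2
        simp only [e, Sum.elim_inl, hsv, hb₁, ← hv, hPP]
      · have hv : P x₀ (b₂ i) = 0 := (b₂ i).2
        simp only [e, Sum.elim_inr, hsv, hb₂, hv, sub_zero])
  have hPe (i y) : P y (e (Sum.inl i) y) = e (Sum.inl i) y := hPP y _
  have hPe' (i y) : P y (e (Sum.inr i) y) = 0 := by simp [e, hPP]
  have hsum (y) (hy : y ∈ W) (v) (hv : P y v = v) :
      v = ∑ i, c (Sum.inl i) y v • e (Sum.inl i) y := by
    -- Applying `P y` to the expansion of `v = P y v` kills the terms from the kernel part of the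
    -- frame.
    have h := congrArg (P y) ((B y hy).sum_repr v)
    rw [hv] at h
    conv_lhs => rw [← h]
    simp [Fintype.sum_sum_type, hB, hBc, hPe, hPe']
  have hli (y) (hy : y ∈ W) : LinearIndependent ℂ fun i => e i y :=
    funext (hB y hy) ▸ (B y hy).linearIndependent
  refine ⟨W, hW, hxW, _, fun i => e (Sum.inl i), fun i => ?_, hPe, fun y hy => ⟨?_, ?_⟩,
    fun i => c (Sum.inl i), hsum, fun W' hW' hWW' s hs i => hcs W' hW' hWW' s hs _⟩
  · exact (he _).mono hWU
  · exact (hli y hy).comp _ Sum.inl_injective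
  · refine le_antisymm (Submodule.span_le.2 ?_) ?_
    · rintro _ ⟨i, rfl⟩
      exact ⟨_, hPe i y⟩
    · rintro _ ⟨v, rfl⟩
      rw [hsum y hy _ (hPP y v)]
      exact Submodule.sum_mem _ fun i _ => Submodule.smul_mem _ _ (Submodule.subset_span ⟨i, rfl⟩)

theorem isSmoothSubbundle_range {P : Π x, ℂ ⊗[ℝ] E x →ₗ[ℂ] ℂ ⊗[ℝ] E x} (hP : SmoothOp V F P)
    (hPP : ∀ x v, P x (P x v) = P x v) :
    IsSmoothSubbundle V F fun x => LinearMap.range (P x) := fun x₀ =>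
  let ⟨U, hU, hx, n, e, he, _, hs, _⟩ := exists_frame_range hP hPP x₀
  ⟨U, hU, hx, n, e, he, hs⟩

end Frames

end GKGeom

namespace GKGeom

/-! ### Derivatives of complex functions -/

section Deriv

variable {V : Type u} [NormedAddCommGroup V] [NormedSpace ℝ V]
  {M : Type v} [TopologicalSpace M] [ChartedSpace V M] {U : Set M} {x : M}

theorem SmoothFun.mdifferentiableAt {f : M → ℝ} (hf : SmoothFun V f U) (hU : IsOpen U)
    (hx : x ∈ U) : MDifferentiableAt 𝓘(ℝ, V) 𝓘(ℝ, ℝ) f x :=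
  (ContMDiffOn.contMDiffAt hf (hU.mem_nhds hx)).mdifferentiableAt (by simp)

theorem deriv1_add {f g : M → ℝ} (hU : IsOpen U) (hf : SmoothFun V f U) (hg : SmoothFun V g U)
    (hx : x ∈ U) (a : TangentSpace 𝓘(ℝ, V) x) :
    deriv1 V (fun y => f y + g y) x a = deriv1 V f x a + deriv1 V g x a := by
  have h := mfderiv_add (hf.mdifferentiableAt hU hx) (hg.mdifferentiableAt hU hx)
  exact congrArg (fun L : TangentSpace 𝓘(ℝ, V) x →L[ℝ] ℝ => L a) h

theorem deriv1_sub {f g : M → ℝ} (hU : IsOpen U) (hf : SmoothFun V f U) (hg : SmoothFun V g U)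
    (hx : x ∈ U) (a : TangentSpace 𝓘(ℝ, V) x) :
    deriv1 V (fun y => f y - g y) x a = deriv1 V f x a - deriv1 V g x a := by
  have h := mfderiv_sub (hf.mdifferentiableAt hU hx) (hg.mdifferentiableAt hU hx)
  exact congrArg (fun L : TangentSpace 𝓘(ℝ, V) x →L[ℝ] ℝ => L a) h

theorem deriv1_const (c : ℝ) (a : TangentSpace 𝓘(ℝ, V) x) :
    deriv1 V (fun _ : M => c) x a = 0 := by
  rw [deriv1, mfderiv_const]; rfl

variable (V) in
/-- The derivative of a complex function along real tangent vectors. -/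
def cderivLin (f : M → ℂ) (x : M) : TangentSpace 𝓘(ℝ, V) x →ₗ[ℝ] ℂ :=
  (mfderiv 𝓘(ℝ, V) 𝓘(ℝ, ℂ) f x).toLinearMap

theorem cderiv1_def (f : M → ℂ) (x : M) (a : CT V x) :
    cderiv1 V f x a = cderivLin V f x (cre a) + Complex.I * cderivLin V f x (cim a) := rfl

/-- The chain rule for the real-linear maps `re` and `im`. It is the bridge through which the real
axioms involving derivatives pass to the complexification. -/
theorem cderiv1_eq {f : M → ℂ} (hU : IsOpen U) (hf : SmoothCFun V f U) (hx : x ∈ U)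
    (a : CT V x) : cderiv1 V f x a =
      ((deriv1 V (fun y => (f y).re) x (cre a) - deriv1 V (fun y => (f y).im) x (cim a) : ℝ) : ℂ) +
      ((deriv1 V (fun y => (f y).re) x (cim a) + deriv1 V (fun y => (f y).im) x (cre a) : ℝ) : ℂ)
        * Complex.I := by
  have hd : MDifferentiableAt 𝓘(ℝ, V) 𝓘(ℝ, ℂ) f x :=
    (ContMDiffOn.contMDiffAt hf (hU.mem_nhds hx)).mdifferentiableAt (by simp)
  have hre (b) : deriv1 V (fun y => (f y).re) x b =
      (cderivLin V f x b).re := by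
    have h := mfderiv_comp x (Complex.reCLM.mdifferentiableAt (x := f x)) hd
    rw [ContinuousLinearMap.mfderiv_eq] at h
    exact congrArg (fun L : TangentSpace 𝓘(ℝ, V) x →L[ℝ] ℝ => L b) h
  have him (b) : deriv1 V (fun y => (f y).im) x b =
      (cderivLin V f x b).im := by
    have h := mfderiv_comp x (Complex.imCLM.mdifferentiableAt (x := f x)) hd
    rw [ContinuousLinearMap.mfderiv_eq] at h
    exact congrArg (fun L : TangentSpace 𝓘(ℝ, V) x →L[ℝ] ℝ => L b) h
  rw [hre, hre, him, him, cderiv1_def]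
  apply Complex.ext <;> simp <;> ring

theorem cderiv1_add (f : M → ℂ) (x : M) (a b : CT V x) :
    cderiv1 V f x (a + b) = cderiv1 V f x a + cderiv1 V f x b := by
  simp only [cderiv1_def, map_add]
  ring

theorem cderiv1_congr {f g : M → ℂ} (hU : IsOpen U) (hx : x ∈ U) (h : ∀ y ∈ U, f y = g y)
    (a : CT V x) : cderiv1 V f x a = cderiv1 V g x a := by
  have h' : f =ᶠ[𝓝 x] g := Filter.eventually_of_mem (hU.mem_nhds hx) h
  simp only [cderiv1_def, cderivLin, h'.mfderiv_eq]

theorem cderiv1_zero (a : CT V x) : cderiv1 V (fun _ : M => (0 : ℂ)) x a = 0 := by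
  have h : cderivLin V (fun _ : M => (0 : ℂ)) x = 0 := by rw [cderivLin, mfderiv_const]; rfl
  simp [cderiv1_def, h]

end Deriv

namespace ExactCourantAlgebroid

variable {V : Type u} [NormedAddCommGroup V] [NormedSpace ℝ V]
  {M : Type v} [TopologicalSpace M] [ChartedSpace V M] [IsManifold 𝓘(ℝ, V) ∞ M]
  {F : Type*} [NormedAddCommGroup F] [NormedSpace ℝ F]
  {E : M → Type w} [∀ x, AddCommGroup (E x)] [∀ x, Module ℝ (E x)]
  [TopologicalSpace (TotalSpace F E)] [∀ x, TopologicalSpace (E x)] [FiberBundle F E]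
  (C : ExactCourantAlgebroid V F E)

/-! ### Pairing and anchor of the complexification -/

theorem cPairing_re (x : M) (s t : ℂ ⊗[ℝ] E x) : (C.cPairing x s t).re =
    C.pairing x (cre s) (cre t) - C.pairing x (cim s) (cim t) := by
  simp [cPairing, bilinBaseChange_apply]

theorem cPairing_im (x : M) (s t : ℂ ⊗[ℝ] E x) : (C.cPairing x s t).im =
    C.pairing x (cre s) (cim t) + C.pairing x (cim s) (cre t) := by
  simp [cPairing, bilinBaseChange_apply]

theorem cPairing_symm (x : M) (s t : ℂ ⊗[ℝ] E x) : C.cPairing x s t = C.cPairing x t s := by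
  apply Complex.ext
  · rw [cPairing_re, cPairing_re, C.pairing_symm x (cre s), C.pairing_symm x (cim s)]
  · rw [cPairing_im, cPairing_im, C.pairing_symm x (cre s), C.pairing_symm x (cim s), add_comm]

/-- Pairing with real vectors alone already detects the real and imaginary parts. -/
theorem cPairing_nondeg (x : M) (s : ℂ ⊗[ℝ] E x) (h : ∀ t, C.cPairing x s t = 0) : s = 0 := by
  have h1 (b : E x) : C.pairing x (cre s) b = 0 := by
    have := congrArg Complex.re (h (cmk b 0)); rw [cPairing_re] at this; simpa using this
  have h2 (b : E x) : C.pairing x (cim s) b = 0 := by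
    have := congrArg Complex.im (h (cmk b 0)); rw [cPairing_im] at this; simpa using this
  exact cext (by simpa using C.pairing_nondeg x _ h1) (by simpa using C.pairing_nondeg x _ h2)

theorem mem_perp {D : Π x, Submodule ℂ (ℂ ⊗[ℝ] E x)} {x : M} {s : ℂ ⊗[ℝ] E x} :
    s ∈ C.perp D x ↔ ∀ d ∈ D x, C.cPairing x d s = 0 := Iff.rfl

@[simp] theorem cre_cAnchor (x : M) (s : ℂ ⊗[ℝ] E x) :
    cre (C.cAnchor x s) = C.anchor x (cre s) := cre_baseChange _ _

@[simp] theorem cim_cAnchor (x : M) (s : ℂ ⊗[ℝ] E x) :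
    cim (C.cAnchor x s) = C.anchor x (cim s) := cim_baseChange _ _

/-- With `mem_cAnchor_ker`, this says that the complexified kernel of the anchor remains Lagrangian.
-/
theorem cAnchor_ker_isotropic {x : M} {s t : ℂ ⊗[ℝ] E x} (hs : C.cAnchor x s = 0)
    (ht : C.cAnchor x t = 0) : C.cPairing x s t = 0 := by
  have h (a b : E x) (ha : C.anchor x a = 0) (hb : C.anchor x b = 0) : C.pairing x a b = 0 := by
    have h : b ∈ (C.pairing x).orthogonal (LinearMap.ker (C.anchor x)) := by
      rw [C.anchor_ker]; exact hb
    exact h a ha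
  have h1 := congrArg cre hs
  have h2 := congrArg cim hs
  have h3 := congrArg cre ht
  have h4 := congrArg cim ht
  simp only [cre_cAnchor, cim_cAnchor, map_zero] at h1 h2 h3 h4
  apply Complex.ext
  · rw [cPairing_re, h _ _ h1 h3, h _ _ h2 h4]; simp
  · rw [cPairing_im, h _ _ h1 h4, h _ _ h2 h3]; simp

theorem mem_cAnchor_ker {x : M} {s : ℂ ⊗[ℝ] E x}
    (h : ∀ t, C.cAnchor x t = 0 → C.cPairing x t s = 0) : C.cAnchor x s = 0 := by
  have key (a : E x) (ha : ∀ b, C.anchor x b = 0 → C.pairing x b a = 0) : C.anchor x a = 0 := by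
    have h : a ∈ (C.pairing x).orthogonal (LinearMap.ker (C.anchor x)) := fun b hb => ha b hb
    rw [C.anchor_ker] at h
    exact h
  have h0 (b : E x) (hb : C.anchor x b = 0) := h (cmk b 0) (cext (by simpa using hb) (by simp))
  refine cext ?_ ?_
  · rw [cre_cAnchor, map_zero]
    refine key _ fun b hb => ?_
    have := congrArg Complex.re (h0 b hb); rw [cPairing_re] at this; simpa using this
  · rw [cim_cAnchor, map_zero]
    refine key _ fun b hb => ?_
    have := congrArg Complex.im (h0 b hb); rw [cPairing_im] at this; simpa using this

/-! ### The bracket on the complexification -/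

theorem cre_cBracket (s t : Π x, ℂ ⊗[ℝ] E x) (x : M) : cre (C.cBracket s t x) =
    C.bracket (fun y => cre (s y)) (fun y => cre (t y)) x -
      C.bracket (fun y => cim (s y)) (fun y => cim (t y)) x := cre_cmk _ _

theorem cim_cBracket (s t : Π x, ℂ ⊗[ℝ] E x) (x : M) : cim (C.cBracket s t x) =
    C.bracket (fun y => cre (s y)) (fun y => cim (t y)) x +
      C.bracket (fun y => cim (s y)) (fun y => cre (t y)) x := cim_cmk _ _

variable {U : Set M} {x : M}

theorem cBracket_congr (hU : IsOpen U) {s s' t t' : Π x, ℂ ⊗[ℝ] E x} (hs : SmoothCSec V F s U)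
    (ht : SmoothCSec V F t U) (es : ∀ y ∈ U, s y = s' y) (et : ∀ y ∈ U, t y = t' y) (hx : x ∈ U) :
    C.cBracket s t x = C.cBracket s' t' x := by
  have h1 (y) (hy : y ∈ U) : cre (s y) = cre (s' y) := by rw [es y hy]
  have h2 (y) (hy : y ∈ U) : cim (s y) = cim (s' y) := by rw [es y hy]
  have h3 (y) (hy : y ∈ U) : cre (t y) = cre (t' y) := by rw [et y hy]
  have h4 (y) (hy : y ∈ U) : cim (t y) = cim (t' y) := by rw [et y hy]
  refine cext ?_ ?_
  · rw [cre_cBracket, cre_cBracket, C.bracket_congr U hU _ _ _ _ hs.1 ht.1 h1 h3 x hx,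
      C.bracket_congr U hU _ _ _ _ hs.2 ht.2 h2 h4 x hx]
  · rw [cim_cBracket, cim_cBracket, C.bracket_congr U hU _ _ _ _ hs.1 ht.2 h1 h4 x hx,
      C.bracket_congr U hU _ _ _ _ hs.2 ht.1 h2 h3 x hx]

theorem smoothCFun_cPairing (hU : IsOpen U) {s t : Π x, ℂ ⊗[ℝ] E x} (hs : SmoothCSec V F s U)
    (ht : SmoothCSec V F t U) : SmoothCFun V (fun y => C.cPairing y (s y) (t y)) U := by
  refine smoothCFun_of_re_im ?_ ?_
  · simp only [cPairing_re]
    exact ContMDiffOn.sub (C.pairing_smooth U hU _ _ hs.1 ht.1)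
      (C.pairing_smooth U hU _ _ hs.2 ht.2)
  · simp only [cPairing_im]
    exact ContMDiffOn.add (C.pairing_smooth U hU _ _ hs.1 ht.2)
      (C.pairing_smooth U hU _ _ hs.2 ht.1)

theorem smoothCVF_cAnchor (hU : IsOpen U) {s : Π x, ℂ ⊗[ℝ] E x} (hs : SmoothCSec V F s U) :
    SmoothCVF V (fun y => C.cAnchor y (s y)) U :=
  ⟨(C.anchor_smooth U hU _ hs.1).congr fun _ _ => cre_cAnchor _ _ _,
    (C.anchor_smooth U hU _ hs.2).congr fun _ _ => cim_cAnchor _ _ _⟩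

theorem cAnchor_cBracket (hU : IsOpen U) {s t : Π x, ℂ ⊗[ℝ] E x} (hs : SmoothCSec V F s U)
    (ht : SmoothCSec V F t U) (hx : x ∈ U) : C.cAnchor x (C.cBracket s t x) =
      cLie V (fun y => C.cAnchor y (s y)) (fun y => C.cAnchor y (t y)) x := by
  refine cext ?_ ?_
  · simp only [cLie, complexify, cre_cAnchor, cre_cBracket, cre_cmk, cim_cAnchor, map_sub]
    rw [C.anchor_bracket U hU _ _ hs.1 ht.1 x hx, C.anchor_bracket U hU _ _ hs.2 ht.2 x hx]
  · simp only [cLie, complexify, cre_cAnchor, cim_cBracket, cim_cmk, cim_cAnchor, map_add]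
    rw [C.anchor_bracket U hU _ _ hs.1 ht.2 x hx, C.anchor_bracket U hU _ _ hs.2 ht.1 x hx]

theorem cBracket_add_left (hU : IsOpen U) {s s' t : Π x, ℂ ⊗[ℝ] E x} (hs : SmoothCSec V F s U)
    (hs' : SmoothCSec V F s' U) (ht : SmoothCSec V F t U) (hx : x ∈ U) :
    C.cBracket (fun y => s y + s' y) t x = C.cBracket s t x + C.cBracket s' t x := by
  refine cext ?_ ?_
  · simp only [map_add, cre_cBracket]
    rw [C.bracket_add_left U hU _ _ _ hs.1 hs'.1 ht.1 x hx,
      C.bracket_add_left U hU _ _ _ hs.2 hs'.2 ht.2 x hx]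
    abel
  · simp only [map_add, cim_cBracket]
    rw [C.bracket_add_left U hU _ _ _ hs.1 hs'.1 ht.2 x hx,
      C.bracket_add_left U hU _ _ _ hs.2 hs'.2 ht.1 x hx]
    abel

theorem cBracket_add_right (hU : IsOpen U) {s t t' : Π x, ℂ ⊗[ℝ] E x} (hs : SmoothCSec V F s U)
    (ht : SmoothCSec V F t U) (ht' : SmoothCSec V F t' U) (hx : x ∈ U) :
    C.cBracket s (fun y => t y + t' y) x = C.cBracket s t x + C.cBracket s t' x := by
  refine cext ?_ ?_
  · simp only [map_add, cre_cBracket]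
    rw [C.bracket_add_right U hU _ _ _ hs.1 ht.1 ht'.1 x hx,
      C.bracket_add_right U hU _ _ _ hs.2 ht.2 ht'.2 x hx]
    abel
  · simp only [map_add, cim_cBracket]
    rw [C.bracket_add_right U hU _ _ _ hs.1 ht.2 ht'.2 x hx,
      C.bracket_add_right U hU _ _ _ hs.2 ht.1 ht'.1 x hx]
    abel

/-- Both sides are complex trilinear combinations of the eight real identities obtained from the
real and imaginary parts of `r`, `s`, `t`. -/
theorem cBracket_invariant (hU : IsOpen U) {r s t : Π x, ℂ ⊗[ℝ] E x} (hr : SmoothCSec V F r U)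
    (hs : SmoothCSec V F s U) (ht : SmoothCSec V F t U) (hx : x ∈ U) :
    cderiv1 V (fun y => C.cPairing y (s y) (t y)) x (C.cAnchor x (r x)) =
      C.cPairing x (C.cBracket r s x) (t x) + C.cPairing x (s x) (C.cBracket r t x) := by
  have hp {a b : Π x, E x} (ha : SmoothSec V F a U) (hb : SmoothSec V F b U) :=
    C.pairing_smooth U hU a b ha hb
  have hi {a b c : Π x, E x} (ha : SmoothSec V F a U) (hb : SmoothSec V F b U)
    (hc : SmoothSec V F c U) := C.bracket_invariant U hU a b c ha hb hc x hx
  rw [cderiv1_eq hU (C.smoothCFun_cPairing hU hs ht) hx]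
  simp only [cPairing_re, cPairing_im, cre_cAnchor, cim_cAnchor]
  simp only [deriv1_sub hU (hp hs.1 ht.1) (hp hs.2 ht.2) hx,
    deriv1_add hU (hp hs.1 ht.2) (hp hs.2 ht.1) hx, hi hr.1 hs.1 ht.1, hi hr.1 hs.2 ht.2,
    hi hr.1 hs.1 ht.2, hi hr.1 hs.2 ht.1, hi hr.2 hs.1 ht.1, hi hr.2 hs.2 ht.2,
    hi hr.2 hs.1 ht.2, hi hr.2 hs.2 ht.1]
  apply Complex.ext
  · rw [Complex.add_re, Complex.add_re, cPairing_re, cPairing_re]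
    simp [cre_cBracket, cim_cBracket]
    ring
  · rw [Complex.add_im, Complex.add_im, cPairing_im, cPairing_im]
    simp [cre_cBracket, cim_cBracket]
    ring

theorem cBracket_symm_part (hU : IsOpen U) {s t : Π x, ℂ ⊗[ℝ] E x}
    (hs : SmoothCSec V F s U) (ht : SmoothCSec V F t U) (hx : x ∈ U) (z : ℂ ⊗[ℝ] E x) :
    C.cPairing x (C.cBracket s t x + C.cBracket t s x) z =
      cderiv1 V (fun y => C.cPairing y (s y) (t y)) x (C.cAnchor x z) := by
  have hp {a b : Π x, E x} (ha : SmoothSec V F a U) (hb : SmoothSec V F b U) :=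
    C.pairing_smooth U hU a b ha hb
  have hi {a b : Π x, E x} (ha : SmoothSec V F a U) (hb : SmoothSec V F b U) (z : E x) :=
    (C.bracket_symm_part U hU a b ha hb x hx z).symm
  rw [cderiv1_eq hU (C.smoothCFun_cPairing hU hs ht) hx]
  simp only [cPairing_re, cPairing_im, cre_cAnchor, cim_cAnchor]
  simp only [deriv1_sub hU (hp hs.1 ht.1) (hp hs.2 ht.2) hx,
    deriv1_add hU (hp hs.1 ht.2) (hp hs.2 ht.1) hx, hi hs.1 ht.1, hi hs.2 ht.2,
    hi hs.1 ht.2, hi hs.2 ht.1]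
  apply Complex.ext
  · rw [cPairing_re]
    simp [cre_cBracket, cim_cBracket]
    ring
  · rw [cPairing_im]
    simp [cre_cBracket, cim_cBracket]
    ring

/-- Sections with vanishing pairing have skew bracket. -/
theorem cBracket_skew (hU : IsOpen U) {s t : Π x, ℂ ⊗[ℝ] E x}
    (hs : SmoothCSec V F s U) (ht : SmoothCSec V F t U)
    (h : ∀ y ∈ U, C.cPairing y (s y) (t y) = 0) (hx : x ∈ U) :
    C.cBracket s t x = - C.cBracket t s x := by
  refine eq_neg_of_add_eq_zero_left (C.cPairing_nondeg x _ fun z => ?_)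
  rw [C.cBracket_symm_part hU hs ht hx, cderiv1_congr hU hx h, cderiv1_zero]

variable [VectorBundle ℝ F E]

theorem smoothCSec_cBracket (hU : IsOpen U) {s t : Π x, ℂ ⊗[ℝ] E x} (hs : SmoothCSec V F s U)
    (ht : SmoothCSec V F t U) : SmoothCSec V F (C.cBracket s t) U :=
  smoothCSec_cmk ((C.bracket_smooth U hU _ _ hs.1 ht.1).sub (C.bracket_smooth U hU _ _ hs.2 ht.2))
    ((C.bracket_smooth U hU _ _ hs.1 ht.2).add (C.bracket_smooth U hU _ _ hs.2 ht.1))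

theorem bracket_sub_left (hU : IsOpen U) {a a' b : Π x, E x} (ha : SmoothSec V F a U)
    (ha' : SmoothSec V F a' U) (hb : SmoothSec V F b U) (hx : x ∈ U) :
    C.bracket (fun y => a y - a' y) b x = C.bracket a b x - C.bracket a' b x := by
  have h := C.bracket_add_left U hU _ _ b (ha.sub ha') ha' hb x hx
  simp only [sub_add_cancel] at h
  exact eq_sub_of_add_eq h.symm

theorem bracket_sub_right (hU : IsOpen U) {a b b' : Π x, E x} (ha : SmoothSec V F a U)
    (hb : SmoothSec V F b U) (hb' : SmoothSec V F b' U) (hx : x ∈ U) :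
    C.bracket a (fun y => b y - b' y) x = C.bracket a b x - C.bracket a b' x := by
  have h := C.bracket_add_right U hU a _ _ ha (hb.sub hb') hb' x hx
  simp only [sub_add_cancel] at h
  exact eq_sub_of_add_eq h.symm

theorem cBracket_leibniz (hU : IsOpen U) {f : M → ℂ} {s t : Π x, ℂ ⊗[ℝ] E x}
    (hf : SmoothCFun V f U) (hs : SmoothCSec V F s U) (ht : SmoothCSec V F t U) (hx : x ∈ U) :
    C.cBracket s (fun y => f y • t y) x =
      f x • C.cBracket s t x + cderiv1 V f x (C.cAnchor x (s x)) • t x := by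
  -- The real and imaginary parts of `f • t` are a difference and a sum of two real multiples; both
  -- shapes are expanded at once.
  have key (a : Π x, E x) (ha : SmoothSec V F a U) (g h : M → ℝ) (b c : Π x, E x)
      (hg : SmoothFun V g U) (hh : SmoothFun V h U) (hb : SmoothSec V F b U)
      (hc : SmoothSec V F c U) := And.intro
    ((C.bracket_sub_right hU ha (hb.smul hg) (hc.smul hh) hx).trans (congrArg₂ _
      (C.bracket_leibniz U hU g a b hg ha hb x hx) (C.bracket_leibniz U hU h a c hh ha hc x hx)))
    ((C.bracket_add_right U hU _ _ _ ha (hb.smul hg) (hc.smul hh) x hx).trans (congrArg₂ _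
      (C.bracket_leibniz U hU g a b hg ha hb x hx) (C.bracket_leibniz U hU h a c hh ha hc x hx)))
  rw [cderiv1_eq hU hf hx]
  refine cext ?_ ?_
  · simp only [map_add, cre_cBracket, cre_smul, cim_smul, cim_cBracket]
    rw [(key _ hs.1 _ _ _ _ hf.re hf.im ht.1 ht.2).1, (key _ hs.2 _ _ _ _ hf.re hf.im ht.2 ht.1).2]
    simp
    module
  · simp only [map_add, cre_cBracket, cre_smul, cim_smul, cim_cBracket]
    rw [(key _ hs.1 _ _ _ _ hf.re hf.im ht.2 ht.1).2, (key _ hs.2 _ _ _ _ hf.re hf.im ht.1 ht.2).1]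
    simp
    module

theorem cBracket_smul_left (hU : IsOpen U) (c : ℂ) {s t : Π x, ℂ ⊗[ℝ] E x}
    (hs : SmoothCSec V F s U) (ht : SmoothCSec V F t U) (hx : x ∈ U) :
    C.cBracket (fun y => c • s y) t x = c • C.cBracket s t x := by
  have key (r r' : ℝ) (a a' b : Π x, E x) (ha : SmoothSec V F a U) (ha' : SmoothSec V F a' U)
      (hb : SmoothSec V F b U) := And.intro
    ((C.bracket_sub_left hU (ha.const_smul r) (ha'.const_smul r') hb hx).trans (congrArg₂ _
      (C.bracket_smul_left U hU r a b ha hb x hx) (C.bracket_smul_left U hU r' a' b ha' hb x hx)))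
    ((C.bracket_add_left U hU _ _ _ (ha.const_smul r) (ha'.const_smul r') hb x hx).trans
      (congrArg₂ _ (C.bracket_smul_left U hU r a b ha hb x hx)
        (C.bracket_smul_left U hU r' a' b ha' hb x hx)))
  refine cext ?_ ?_
  · simp only [cre_cBracket, cre_smul, cim_smul, cim_cBracket]
    rw [(key _ _ _ _ _ hs.1 hs.2 ht.1).1, (key _ _ _ _ _ hs.2 hs.1 ht.2).2]
    module
  · simp only [cre_cBracket, cre_smul, cim_smul, cim_cBracket]
    rw [(key _ _ _ _ _ hs.1 hs.2 ht.2).1, (key _ _ _ _ _ hs.2 hs.1 ht.1).2]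
    module

theorem cBracket_sub_left (hU : IsOpen U) {s s' t : Π x, ℂ ⊗[ℝ] E x} (hs : SmoothCSec V F s U)
    (hs' : SmoothCSec V F s' U) (ht : SmoothCSec V F t U) (hx : x ∈ U) :
    C.cBracket (fun y => s y - s' y) t x = C.cBracket s t x - C.cBracket s' t x := by
  have h := C.cBracket_add_left hU (hs.sub hs') hs' ht hx
  simp only [sub_add_cancel] at h
  exact eq_sub_of_add_eq h.symm

theorem cBracket_sub_right (hU : IsOpen U) {s t t' : Π x, ℂ ⊗[ℝ] E x} (hs : SmoothCSec V F s U)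
    (ht : SmoothCSec V F t U) (ht' : SmoothCSec V F t' U) (hx : x ∈ U) :
    C.cBracket s (fun y => t y - t' y) x = C.cBracket s t x - C.cBracket s t' x := by
  have h := C.cBracket_add_right hU hs (ht.sub ht') ht' hx
  simp only [sub_add_cancel] at h
  exact eq_sub_of_add_eq h.symm

/-- Each of the real and imaginary parts is a signed sum of four real Jacobi identities; `e1` to
`e4` distribute the outer bracket over the inner sums and differences. -/
theorem cBracket_jacobi (hU : IsOpen U) {r s t : Π x, ℂ ⊗[ℝ] E x} (hr : SmoothCSec V F r U)
    (hs : SmoothCSec V F s U) (ht : SmoothCSec V F t U) (hx : x ∈ U) :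
    C.cBracket r (C.cBracket s t) x =
      C.cBracket (C.cBracket r s) t x + C.cBracket s (C.cBracket r t) x := by
  have hb {a b : Π x, E x} (ha : SmoothSec V F a U) (hb : SmoothSec V F b U) :=
    C.bracket_smooth U hU a b ha hb
  have hj {a b c : Π x, E x} (ha : SmoothSec V F a U) (hb : SmoothSec V F b U)
    (hc : SmoothSec V F c U) := C.bracket_jacobi U hU a b c ha hb hc x hx
  have e1 {a b c d e : Π x, E x} (ha : SmoothSec V F a U) (hb1 : SmoothSec V F b U)
      (hc : SmoothSec V F c U) (hd : SmoothSec V F d U) (he : SmoothSec V F e U) :=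
    C.bracket_sub_right hU ha (hb hb1 hc) (hb hd he) hx
  have e2 {a b c d e : Π x, E x} (ha : SmoothSec V F a U) (hb1 : SmoothSec V F b U)
      (hc : SmoothSec V F c U) (hd : SmoothSec V F d U) (he : SmoothSec V F e U) :=
    C.bracket_add_right U hU _ _ _ ha (hb hb1 hc) (hb hd he) x hx
  have e3 {a b c d e : Π x, E x} (ha : SmoothSec V F a U) (hb1 : SmoothSec V F b U)
      (hc : SmoothSec V F c U) (hd : SmoothSec V F d U) (he : SmoothSec V F e U) :=
    C.bracket_sub_left hU (hb hb1 hc) (hb hd he) ha hx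
  have e4 {a b c d e : Π x, E x} (ha : SmoothSec V F a U) (hb1 : SmoothSec V F b U)
      (hc : SmoothSec V F c U) (hd : SmoothSec V F d U) (he : SmoothSec V F e U) :=
    C.bracket_add_left U hU _ _ _ (hb hb1 hc) (hb hd he) ha x hx
  refine cext ?_ ?_
  · simp only [map_add, cre_cBracket, cim_cBracket]
    rw [e1 hr.1 hs.1 ht.1 hs.2 ht.2, e2 hr.2 hs.1 ht.2 hs.2 ht.1,
      e3 ht.1 hr.1 hs.1 hr.2 hs.2, e4 ht.2 hr.1 hs.2 hr.2 hs.1,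
      e1 hs.1 hr.1 ht.1 hr.2 ht.2, e2 hs.2 hr.1 ht.2 hr.2 ht.1,
      hj hr.1 hs.1 ht.1, hj hr.1 hs.2 ht.2, hj hr.2 hs.1 ht.2, hj hr.2 hs.2 ht.1]
    abel
  · simp only [map_add, cre_cBracket, cim_cBracket]
    rw [e2 hr.1 hs.1 ht.2 hs.2 ht.1, e1 hr.2 hs.1 ht.1 hs.2 ht.2,
      e3 ht.2 hr.1 hs.1 hr.2 hs.2, e4 ht.1 hr.1 hs.2 hr.2 hs.1,
      e2 hs.1 hr.1 ht.2 hr.2 ht.1, e1 hs.2 hr.1 ht.1 hr.2 ht.2,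
      hj hr.1 hs.1 ht.2, hj hr.1 hs.2 ht.1, hj hr.2 hs.1 ht.1, hj hr.2 hs.2 ht.2]
    abel

theorem cBracket_cconj (hU : IsOpen U) {s t : Π x, ℂ ⊗[ℝ] E x}
    (hs : SmoothCSec V F s U) (ht : SmoothCSec V F t U) (hx : x ∈ U) :
    C.cBracket (fun y => cconj (s y)) (fun y => cconj (t y)) x = cconj (C.cBracket s t x) := by
  have hl {a b : Π x, E x} (ha : SmoothSec V F a U) (hb : SmoothSec V F b U) :
      C.bracket (fun y => - a y) b x = - C.bracket a b x := by
    simpa using C.bracket_smul_left U hU (-1) a b ha hb x hx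
  have hr {a b : Π x, E x} (ha : SmoothSec V F a U) (hb : SmoothSec V F b U) :
      C.bracket a (fun y => - b y) x = - C.bracket a b x := by
    simpa [deriv1_const] using
      C.bracket_leibniz U hU (fun _ => -1) a b contMDiffOn_const ha hb x hx
  refine cext ?_ ?_
  · simp only [cre_cBracket, cconj, cre_cmk, cim_cmk]
    rw [hl hs.2 ht.2.neg, hr hs.2 ht.2, neg_neg]
  · simp only [cim_cBracket, cconj, cre_cmk, cim_cmk]
    rw [hl hs.2 ht.1, hr hs.1 ht.2, neg_add]

end ExactCourantAlgebroid

/-- No smoothness is needed, because antisymmetry of the Lie bracket holds for arbitrary fields. -/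
theorem cLie_swap {V : Type u} [NormedAddCommGroup V] [NormedSpace ℝ V]
    {M : Type v} [TopologicalSpace M] [ChartedSpace V M] (X Y : Π x : M, CT V x) (x : M) :
    cLie V X Y x = - cLie V Y X x := by
  refine cext ?_ ?_
  · simp only [cLie, complexify, cre_cmk, map_neg]
    rw [VectorField.mlieBracket_swap_apply,
      VectorField.mlieBracket_swap_apply (V := fun y => cim (X y))]
    abel
  · simp only [cLie, complexify, cim_cmk, map_neg]
    rw [VectorField.mlieBracket_swap_apply,
      VectorField.mlieBracket_swap_apply (V := fun y => cim (X y))]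
    abel

end GKGeom

/-! ### Eigenbundles of generalized complex structures and split pairs -/

namespace GKGeom

namespace ExactCourantAlgebroid

section

variable {M : Type*} {E : M → Type*} [∀ x, AddCommGroup (E x)] [∀ x, Module ℝ (E x)]

theorem mem_eigenbundle {𝒥 : Π x, E x →ₗ[ℝ] E x} {c : ℂ} {x : M} {s : ℂ ⊗[ℝ] E x} :
    s ∈ eigenbundle 𝒥 c x ↔ (𝒥 x).baseChange ℂ s = c • s := Module.End.mem_eigenspace_iff

theorem eigenbundle_neg (𝒥 : Π x, E x →ₗ[ℝ] E x) (c : ℂ) :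
    eigenbundle (fun x => - 𝒥 x) c = eigenbundle 𝒥 (-c) := by
  funext x
  ext s
  rw [mem_eigenbundle, mem_eigenbundle, neg_smul, ← neg_eq_iff_eq_neg, LinearMap.baseChange_neg]
  rfl

theorem cconj_mem_eigenbundle {𝒥 : Π x, E x →ₗ[ℝ] E x} {x : M} {s : ℂ ⊗[ℝ] E x}
    (h : s ∈ eigenbundle 𝒥 Complex.I x) : cconj s ∈ eigenbundle 𝒥 (-Complex.I) x := by
  rw [mem_eigenbundle] at h ⊢
  have h1 := congrArg cre h
  have h2 := congrArg cim h
  simp only [cre_baseChange, cim_baseChange, cre_smul, cim_smul] at h1 h2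
  refine cext ?_ ?_ <;> simp [cre_smul, cim_smul, cconj] <;> simp_all

theorem cconj_mem_eigenbundle' {𝒥 : Π x, E x →ₗ[ℝ] E x} {x : M} {s : ℂ ⊗[ℝ] E x}
    (h : s ∈ eigenbundle 𝒥 (-Complex.I) x) : cconj s ∈ eigenbundle 𝒥 Complex.I x := by
  rw [mem_eigenbundle] at h ⊢
  have h1 := congrArg cre h
  have h2 := congrArg cim h
  simp only [cre_baseChange, cim_baseChange, cre_smul, cim_smul] at h1 h2
  refine cext ?_ ?_ <;> simp [cre_smul, cim_smul, cconj] <;> simp_all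

end

variable {V : Type u} [NormedAddCommGroup V] [NormedSpace ℝ V]
  {M : Type v} [TopologicalSpace M] [ChartedSpace V M] [IsManifold 𝓘(ℝ, V) ∞ M]
  {F : Type*} [NormedAddCommGroup F] [NormedSpace ℝ F]
  {E : M → Type w} [∀ x, AddCommGroup (E x)] [∀ x, Module ℝ (E x)]
  [TopologicalSpace (TotalSpace F E)] [∀ x, TopologicalSpace (E x)] [FiberBundle F E]
  (C : ExactCourantAlgebroid V F E)

/-- Two commuting generalized complex structures together with splittings `σ`, `τ` of the anchor,
with images the eigenbundles of `-Jp Jm` for the eigenvalues `1` and `-1`. -/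
structure SplitPair where
  Jp : Π x, E x →ₗ[ℝ] E x
  Jm : Π x, E x →ₗ[ℝ] E x
  isGenComplex_p : C.IsGenComplex Jp
  isGenComplex_m : C.IsGenComplex Jm
  comm : ∀ x a, Jp x (Jm x a) = Jm x (Jp x a)
  σ : Π x : M, TangentSpace 𝓘(ℝ, V) x →ₗ[ℝ] E x
  τ : Π x : M, TangentSpace 𝓘(ℝ, V) x →ₗ[ℝ] E x
  anchor_σ : ∀ x a, C.anchor x (σ x a) = a
  anchor_τ : ∀ x a, C.anchor x (τ x a) = a
  JpJm_σ : ∀ x a, Jp x (Jm x (σ x a)) = - σ x a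
  JpJm_τ : ∀ x a, Jp x (Jm x (τ x a)) = τ x a
  σ_anchor : ∀ x a, Jp x (Jm x a) = - a → σ x (C.anchor x a) = a
  τ_anchor : ∀ x a, Jp x (Jm x a) = a → τ x (C.anchor x a) = a

variable {C}

/-! ### Generalized complex structures -/

namespace IsGenComplex

variable {𝒥 : Π x, E x →ₗ[ℝ] E x}

theorem baseChange_sq (h : C.IsGenComplex 𝒥) (x : M) (s : ℂ ⊗[ℝ] E x) :
    (𝒥 x).baseChange ℂ ((𝒥 x).baseChange ℂ s) = -s :=
  cext (by simp [h.sq]) (by simp [h.sq])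

/-- An orthogonal endomorphism with square `-1` is skew. -/
theorem skew (h : C.IsGenComplex 𝒥) (x : M) (a b : E x) :
    C.pairing x (𝒥 x a) b = - C.pairing x a (𝒥 x b) := by
  rw [← h.orthogonal x a (𝒥 x b), h.sq, map_neg, neg_neg]

theorem cPairing_skew (h : C.IsGenComplex 𝒥) (x : M) (s t : ℂ ⊗[ℝ] E x) :
    C.cPairing x ((𝒥 x).baseChange ℂ s) t = - C.cPairing x s ((𝒥 x).baseChange ℂ t) := by
  apply Complex.ext
  · simp only [cPairing_re, Complex.neg_re, cre_baseChange, cim_baseChange, h.skew]; ring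
  · simp only [cPairing_im, Complex.neg_im, cre_baseChange, cim_baseChange, h.skew]; ring

theorem smoothOp (h : C.IsGenComplex 𝒥) : SmoothOp V F fun x => (𝒥 x).baseChange ℂ :=
  fun U hU _ hs => ⟨(h.smooth U hU _ hs.1).congr fun _ _ => cre_baseChange _ _,
    (h.smooth U hU _ hs.2).congr fun _ _ => cim_baseChange _ _⟩

end IsGenComplex

namespace IsGenComplex

variable {𝒥 : Π x, E x →ₗ[ℝ] E x}

/-- The operator `1 + i 𝒥` is twice the projection onto the `-i`-eigenbundle. -/
theorem eigenproj_mem (h : C.IsGenComplex 𝒥) (x : M) (s : ℂ ⊗[ℝ] E x) :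
    s + Complex.I • (𝒥 x).baseChange ℂ s ∈ eigenbundle 𝒥 (-Complex.I) x := by
  rw [mem_eigenbundle, map_add, map_smul, h.baseChange_sq]
  simp [smul_smul, add_comm]

/-- By skewness the transpose of `1 + i 𝒥` is `1 - i 𝒥`, so a vector orthogonal to the image of the
former is killed by the latter. Conversely, on two `-i`-eigenvectors skewness forces the pairing to
equal its own negative. -/
theorem perp_eigenbundle (h : C.IsGenComplex 𝒥) (x : M) :
    C.perp (eigenbundle 𝒥 (-Complex.I)) x = eigenbundle 𝒥 (-Complex.I) x := by
  ext s
  constructor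
  · intro hs
    rw [mem_eigenbundle]
    have h0 : s - Complex.I • (𝒥 x).baseChange ℂ s = 0 := by
      refine C.cPairing_nondeg x _ fun t => ?_
      rw [cPairing_symm, ← hs _ (h.eigenproj_mem x t)]
      simp only [map_sub, map_add, map_smul, LinearMap.add_apply, LinearMap.smul_apply,
        h.cPairing_skew, smul_eq_mul]
      ring
    have h1 := congrArg (fun t => Complex.I • t) (sub_eq_zero.1 h0)
    simp only [smul_smul, Complex.I_mul_I, neg_smul, one_smul] at h1
    rw [neg_smul, h1, neg_neg]
  · intro hs d hd
    have h1 := h.cPairing_skew x d s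
    rw [mem_eigenbundle.1 hs, mem_eigenbundle.1 hd, map_smul, map_smul, LinearMap.smul_apply,
      smul_eq_mul] at h1
    have h2 : Complex.I * C.cPairing x d s = 0 := by linear_combination (-1 / 2 : ℂ) * h1
    exact (mul_eq_zero.1 h2).resolve_left Complex.I_ne_zero

variable [VectorBundle ℝ F E]

/-- The bracket is real, so involutivity of the `+i`-eigenbundle is conjugated to the
`-i`-eigenbundle. -/
theorem involutive_conj (h : C.IsGenComplex 𝒥) :
    C.BracketMem (eigenbundle 𝒥 (-Complex.I)) (eigenbundle 𝒥 (-Complex.I)) := by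
  intro U hU s t hs ht hsL htL x hx
  have := cconj_mem_eigenbundle (h.involutive U hU _ _ hs.cconj ht.cconj
    (fun y hy => cconj_mem_eigenbundle' (hsL y hy))
    (fun y hy => cconj_mem_eigenbundle' (htL y hy)) x hx)
  rwa [C.cBracket_cconj hU hs ht hx, cconj_cconj] at this

/-- Changing the sign interchanges the two eigenbundles, and both are involutive. This is what
permits `swap`. -/
theorem neg (h : C.IsGenComplex 𝒥) : C.IsGenComplex fun x => - 𝒥 x where
  smooth U hU s hs := (h.smooth U hU s hs).neg
  orthogonal x a b := by simp [h.orthogonal]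
  sq x a := by simp [h.sq]
  involutive := by rw [eigenbundle_neg]; exact h.involutive_conj

variable [FiniteDimensional ℝ F] [ContMDiffVectorBundle ∞ F E 𝓘(ℝ, V)]

theorem isDirac (h : C.IsGenComplex 𝒥) : C.IsDirac (eigenbundle 𝒥 (-Complex.I)) where
  subbundle := by
    let P (x : M) : ℂ ⊗[ℝ] E x →ₗ[ℂ] ℂ ⊗[ℝ] E x :=
      (1 / 2 : ℂ) • (LinearMap.id + Complex.I • (𝒥 x).baseChange ℂ)
    have hP (x) (s) (hs : s ∈ eigenbundle 𝒥 (-Complex.I) x) : P x s = s := by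
      simp only [P, LinearMap.smul_apply, LinearMap.add_apply, LinearMap.id_apply,
        mem_eigenbundle.1 hs, smul_smul]
      simp only [mul_neg, Complex.I_mul_I]
      module
    have hP' (x) (s) : P x s ∈ eigenbundle 𝒥 (-Complex.I) x :=
      Submodule.smul_mem _ _ (h.eigenproj_mem x s)
    have he : eigenbundle 𝒥 (-Complex.I) = fun x => LinearMap.range (P x) := by
      funext x
      exact le_antisymm (fun s hs => ⟨s, hP x s hs⟩) (by rintro _ ⟨s, rfl⟩; exact hP' x s)
    rw [he]
    exact isSmoothSubbundle_range (fun U hU s hs =>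
      (hs.add ((h.smoothOp U hU s hs).const_smul _)).const_smul _) fun x s => hP x _ (hP' x s)
  maximal_isotropic := h.perp_eigenbundle
  involutive := h.involutive_conj

end IsGenComplex

/-! ### Linear algebra of a split pair -/

namespace SplitPair

variable (S : C.SplitPair)

/-- The complex linear extension of the first structure. -/
abbrev jp (x : M) : ℂ ⊗[ℝ] E x →ₗ[ℂ] ℂ ⊗[ℝ] E x := (S.Jp x).baseChange ℂ

/-- The complex linear extension of the second structure. -/
abbrev jm (x : M) : ℂ ⊗[ℝ] E x →ₗ[ℂ] ℂ ⊗[ℝ] E x := (S.Jm x).baseChange ℂ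

/-- The complex linear extension of the first splitting. -/
def cσ (x : M) : CT V x →ₗ[ℂ] ℂ ⊗[ℝ] E x := (S.σ x).baseChange ℂ

/-- The complex linear extension of the second splitting. -/
def cτ (x : M) : CT V x →ₗ[ℂ] ℂ ⊗[ℝ] E x := (S.τ x).baseChange ℂ

/-- The complex structure transported from the first structure by the first splitting. -/
def J : TEnd V M := fun x => C.anchor x ∘ₗ S.Jp x ∘ₗ S.σ x

/-- The lifting of `T01`. -/
def D (x : M) : Submodule ℂ (ℂ ⊗[ℝ] E x) :=
  eigenbundle S.Jp (-Complex.I) x ⊓ eigenbundle S.Jm (-Complex.I) x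

/-- The projection to the eigenbundle of `-Jp Jm` for the eigenvalue `-1`. -/
def Q (x : M) : ℂ ⊗[ℝ] E x →ₗ[ℂ] ℂ ⊗[ℝ] E x :=
  (1 / 2 : ℂ) • (LinearMap.id + S.jp x ∘ₗ S.jm x)

/-- The projection to `D`. -/
def PD (x : M) : ℂ ⊗[ℝ] E x →ₗ[ℂ] ℂ ⊗[ℝ] E x :=
  (1 / 4 : ℂ) • ((LinearMap.id + Complex.I • S.jp x) ∘ₗ (LinearMap.id + Complex.I • S.jm x))

variable {x : M}

theorem jp_jp (s : ℂ ⊗[ℝ] E x) : S.jp x (S.jp x s) = -s := S.isGenComplex_p.baseChange_sq x s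

theorem jm_jm (s : ℂ ⊗[ℝ] E x) : S.jm x (S.jm x s) = -s := S.isGenComplex_m.baseChange_sq x s

theorem jm_jp (s : ℂ ⊗[ℝ] E x) : S.jm x (S.jp x s) = S.jp x (S.jm x s) :=
  cext (by simp [S.comm]) (by simp [S.comm])

theorem mem_D {s : ℂ ⊗[ℝ] E x} :
    s ∈ S.D x ↔ S.jp x s = -Complex.I • s ∧ S.jm x s = -Complex.I • s := by
  rw [D, Submodule.mem_inf, mem_eigenbundle, mem_eigenbundle]

theorem Q_apply (s : ℂ ⊗[ℝ] E x) : S.Q x s = (1 / 2 : ℂ) • (s + S.jp x (S.jm x s)) := rfl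

theorem jp_jm_Q (s : ℂ ⊗[ℝ] E x) : S.jp x (S.jm x (S.Q x s)) = S.Q x s := by
  simp only [Q_apply, map_smul, map_add, jm_jp, jm_jm, jp_jp, map_neg, neg_neg, add_comm]

theorem Q_eq_self {s : ℂ ⊗[ℝ] E x} (h : S.jp x (S.jm x s) = s) : S.Q x s = s := by
  rw [Q_apply, h]; module

theorem Q_Q (s : ℂ ⊗[ℝ] E x) : S.Q x (S.Q x s) = S.Q x s := S.Q_eq_self (S.jp_jm_Q s)

/-- A product of two commuting skew operators is self-adjoint. -/
theorem cPairing_Q_left (s t : ℂ ⊗[ℝ] E x) :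
    C.cPairing x (S.Q x s) t = C.cPairing x s (S.Q x t) := by
  simp only [Q_apply, map_smul, map_add, LinearMap.smul_apply, LinearMap.add_apply]
  rw [S.isGenComplex_p.cPairing_skew, S.isGenComplex_m.cPairing_skew, neg_neg, jm_jp]

theorem jp_jm_of_mem_D {s : ℂ ⊗[ℝ] E x} (h : s ∈ S.D x) : S.jp x (S.jm x s) = -s := by
  obtain ⟨h1, h2⟩ := S.mem_D.1 h
  rw [h2, map_smul, h1, smul_smul]; simp

theorem Q_of_mem_D {s : ℂ ⊗[ℝ] E x} (h : s ∈ S.D x) : S.Q x s = 0 := by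
  rw [Q_apply, S.jp_jm_of_mem_D h]; simp

theorem PD_apply (s : ℂ ⊗[ℝ] E x) : S.PD x s = (1 / 4 : ℂ) •
    (s + Complex.I • S.jp x s + Complex.I • S.jm x s - S.jp x (S.jm x s)) := by
  simp only [PD, LinearMap.smul_apply, LinearMap.comp_apply, LinearMap.add_apply,
    LinearMap.id_apply, map_add, map_smul, smul_add, smul_smul, Complex.I_mul_I]
  module

theorem PD_mem (s : ℂ ⊗[ℝ] E x) : S.PD x s ∈ S.D x := by
  rw [PD_apply]
  refine Submodule.smul_mem _ _ (S.mem_D.2 ⟨?_, ?_⟩) <;>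
  simp only [map_add, map_sub, map_smul, jm_jp, jm_jm, jp_jp, map_neg, smul_add, smul_sub,
    smul_smul, neg_mul, Complex.I_mul_I] <;> module

theorem PD_of_mem_D {s : ℂ ⊗[ℝ] E x} (h : s ∈ S.D x) : S.PD x s = s := by
  rw [PD_apply, S.jp_jm_of_mem_D h, (S.mem_D.1 h).1, (S.mem_D.1 h).2, smul_smul]
  simp only [mul_neg, Complex.I_mul_I]
  module

/-- The transpose of `PD` is `(1 - i Jp)(1 - i Jm) / 4`, and it kills `D^⊥`. This gives `s - Jp Jm s
= i (Jp s + Jm s)`, from which both eigenvalue equations for `s - Q s` follow. Together with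
`mem_perp_D` it yields the splitting of `D^⊥` into `D` and the range of `Q`. -/
theorem sub_Q_mem {s : ℂ ⊗[ℝ] E x} (h : s ∈ C.perp S.D x) : s - S.Q x s ∈ S.D x := by
  have h0 : s - Complex.I • S.jp x s - Complex.I • S.jm x s - S.jp x (S.jm x s) = 0 := by
    refine C.cPairing_nondeg x _ fun t => ?_
    have h1 : C.cPairing x (S.PD x t) s = 0 := h _ (S.PD_mem t)
    rw [PD_apply] at h1
    rw [cPairing_symm]
    simp only [map_sub, map_add, map_smul, LinearMap.add_apply, LinearMap.smul_apply,
      LinearMap.sub_apply, S.isGenComplex_p.cPairing_skew, S.isGenComplex_m.cPairing_skew,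
      smul_eq_mul, neg_neg, S.jm_jp] at h1 ⊢
    linear_combination 4 * h1
  have h1 : s - S.jp x (S.jm x s) = Complex.I • (S.jp x s + S.jm x s) := by
    rw [← sub_eq_zero, ← h0]; module
  have h2 : s - S.Q x s = (1 / 2 : ℂ) • (Complex.I • (S.jp x s + S.jm x s)) := by
    rw [← h1, Q_apply]; module
  rw [h2]
  -- The relation multiplied by `i`, which is the form that both eigenvalue equations reduce to.
  have h3 : Complex.I • (s - S.jp x (S.jm x s)) = -(S.jp x s + S.jm x s) := by
    rw [h1, smul_smul, Complex.I_mul_I, neg_one_smul]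
  refine Submodule.smul_mem _ _ (S.mem_D.2 ⟨?_, ?_⟩) <;>
  · simp only [map_add, map_smul, jm_jp, jm_jm, jp_jp]
    simp only [smul_smul, neg_mul, Complex.I_mul_I, neg_neg, one_smul]
    rw [← neg_eq_iff_eq_neg] at h3
    rw [← h3]
    module

/-- The projection `Q` is self-adjoint, fixes `s` and kills `D`. -/
theorem mem_perp_D {s : ℂ ⊗[ℝ] E x} (h : S.jp x (S.jm x s) = s) : s ∈ C.perp S.D x := by
  intro d hd
  change C.cPairing x d s = 0
  rw [← S.Q_eq_self h, ← cPairing_Q_left, S.Q_of_mem_D hd, map_zero,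
    LinearMap.zero_apply]

theorem D_le_perp_D (x : M) : S.D x ≤ C.perp S.D x := by
  intro s hs d hd
  have := hs.1
  rw [← S.isGenComplex_p.perp_eigenbundle] at this
  exact this d hd.1

theorem cAnchor_cσ (X : CT V x) : C.cAnchor x (S.cσ x X) = X :=
  cext (by simp [cσ, S.anchor_σ]) (by simp [cσ, S.anchor_σ])

theorem cAnchor_cτ (X : CT V x) : C.cAnchor x (S.cτ x X) = X :=
  cext (by simp [cτ, S.anchor_τ]) (by simp [cτ, S.anchor_τ])

theorem jp_jm_cσ (X : CT V x) : S.jp x (S.jm x (S.cσ x X)) = - S.cσ x X :=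
  cext (by simp [cσ, S.JpJm_σ]) (by simp [cσ, S.JpJm_σ])

theorem jp_jm_cτ (X : CT V x) : S.jp x (S.jm x (S.cτ x X)) = S.cτ x X :=
  cext (by simp [cτ, S.JpJm_τ]) (by simp [cτ, S.JpJm_τ])

theorem cσ_cAnchor {s : ℂ ⊗[ℝ] E x} (h : S.jp x (S.jm x s) = - s) :
    S.cσ x (C.cAnchor x s) = s := by
  have h1 := congrArg cre h
  have h2 := congrArg cim h
  simp only [cre_baseChange, cim_baseChange, map_neg] at h1 h2
  exact cext (by simp [cσ, S.σ_anchor x _ h1]) (by simp [cσ, S.σ_anchor x _ h2])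

theorem J_baseChange (X : CT V x) :
    (S.J x).baseChange ℂ X = C.cAnchor x (S.jp x (S.cσ x X)) :=
  cext (by simp [cσ, J]) (by simp [cσ, J])

/-- Since `Jp` preserves the image of `σ`, the splitting intertwines the transported structure with
`Jp`. -/
theorem cσ_J (X : CT V x) : S.cσ x ((S.J x).baseChange ℂ X) = S.jp x (S.cσ x X) := by
  rw [J_baseChange, S.cσ_cAnchor]
  rw [jm_jp, jp_jm_cσ, map_neg]

theorem mem_T01 {X : CT V x} : X ∈ T01 S.J x ↔ (S.J x).baseChange ℂ X = -Complex.I • X :=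
  Module.End.mem_eigenspace_iff

theorem mem_T10 {X : CT V x} : X ∈ T10 S.J x ↔ (S.J x).baseChange ℂ X = Complex.I • X :=
  Module.End.mem_eigenspace_iff

/-- On the image of `σ` the two structures coincide, so one eigenvalue equation gives the other. -/
theorem jm_cσ (X : CT V x) : S.jm x (S.cσ x X) = S.jp x (S.cσ x X) := by
  have h := congrArg (S.jp x) (S.jp_jm_cσ X)
  rw [jp_jp, map_neg] at h
  exact neg_injective h

theorem cσ_mem_D {X : CT V x} (h : X ∈ T01 S.J x) : S.cσ x X ∈ S.D x := by
  have h1 : S.jp x (S.cσ x X) = -Complex.I • S.cσ x X := by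
    rw [← cσ_J, S.mem_T01.1 h, map_smul]
  exact S.mem_D.2 ⟨h1, by rw [jm_cσ, h1]⟩

theorem cσ_cAnchor_of_mem_D {s : ℂ ⊗[ℝ] E x} (h : s ∈ S.D x) : S.cσ x (C.cAnchor x s) = s :=
  S.cσ_cAnchor (S.jp_jm_of_mem_D h)

theorem cAnchor_mem_T01 {s : ℂ ⊗[ℝ] E x} (h : s ∈ S.D x) : C.cAnchor x s ∈ T01 S.J x := by
  rw [mem_T01, J_baseChange, S.cσ_cAnchor_of_mem_D h, (S.mem_D.1 h).1, map_smul]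

theorem J_J (X : CT V x) : (S.J x).baseChange ℂ ((S.J x).baseChange ℂ X) = -X := by
  rw [J_baseChange, cσ_J, jp_jp, map_neg, cAnchor_cσ]

theorem P10_apply (X : CT V x) :
    P10 S.J x X = (1 / 2 : ℂ) • (X - Complex.I • (S.J x).baseChange ℂ X) := rfl

theorem P10_mem (X : CT V x) : P10 S.J x X ∈ T10 S.J x := by
  rw [mem_T10, P10_apply]
  simp only [map_smul, map_sub, J_J, smul_sub, smul_smul]
  rw [show Complex.I * (1 / 2 * Complex.I) = -(1 / 2) by
    linear_combination (1 / 2) * Complex.I_mul_I]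
  module

theorem sub_P10_mem (X : CT V x) : X - P10 S.J x X ∈ T01 S.J x := by
  rw [mem_T01, P10_apply]
  simp only [map_smul, map_sub, J_J, smul_sub, smul_smul]
  rw [show -Complex.I * (1 / 2 * Complex.I) = 1 / 2 by
    linear_combination (-1 / 2) * Complex.I_mul_I]
  module

theorem P10_of_mem_T10 {X : CT V x} (h : X ∈ T10 S.J x) : P10 S.J x X = X := by
  rw [P10_apply, S.mem_T10.1 h, smul_smul, Complex.I_mul_I]
  module

theorem P10_of_mem_T01 {X : CT V x} (h : X ∈ T01 S.J x) : P10 S.J x X = 0 := by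
  rw [P10_apply, S.mem_T01.1 h, smul_smul, mul_neg, Complex.I_mul_I]
  module

end SplitPair

end ExactCourantAlgebroid

end GKGeom

set_option linter.unusedSectionVars false

namespace GKGeom

namespace ExactCourantAlgebroid

namespace SplitPair

variable {V : Type u} [NormedAddCommGroup V] [NormedSpace ℝ V]
  {M : Type v} [TopologicalSpace M] [ChartedSpace V M] [IsManifold 𝓘(ℝ, V) ∞ M]
  {F : Type*} [NormedAddCommGroup F] [NormedSpace ℝ F]
  {E : M → Type w} [∀ x, AddCommGroup (E x)] [∀ x, Module ℝ (E x)]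
  [TopologicalSpace (TotalSpace F E)] [∀ x, TopologicalSpace (E x)] [FiberBundle F E]
  [VectorBundle ℝ F E]
  {C : ExactCourantAlgebroid V F E} (S : C.SplitPair) {U : Set M} {x : M}

/-! ### Sections and brackets for a split pair -/

theorem smoothOp_Q : SmoothOp V F S.Q := fun U hU s hs =>
  (hs.add (S.isGenComplex_p.smoothOp U hU _ (S.isGenComplex_m.smoothOp U hU s hs))).const_smul _

theorem smoothOp_PD : SmoothOp V F S.PD := fun U hU s hs => by
  have h := hs.add ((S.isGenComplex_m.smoothOp U hU s hs).const_smul Complex.I)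
  exact (h.add ((S.isGenComplex_p.smoothOp U hU _ h).const_smul Complex.I)).const_smul _

theorem bracketMem_D : C.BracketMem S.D S.D := fun U hU s t hs ht hsD htD x hx =>
  ⟨S.isGenComplex_p.involutive_conj U hU s t hs ht (fun y hy => (hsD y hy).1)
    (fun y hy => (htD y hy).1) x hx,
  S.isGenComplex_m.involutive_conj U hU s t hs ht (fun y hy => (hsD y hy).2)
    (fun y hy => (htD y hy).2) x hx⟩

variable [FiniteDimensional ℝ F] [ContMDiffVectorBundle ∞ F E 𝓘(ℝ, V)]

theorem isSmoothSubbundle_D : IsSmoothSubbundle V F S.D := by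
  have h : S.D = fun x => LinearMap.range (S.PD x) := by
    funext x
    exact le_antisymm (fun s hs => ⟨s, S.PD_of_mem_D hs⟩) (by rintro _ ⟨s, rfl⟩; exact S.PD_mem s)
  rw [h]
  exact isSmoothSubbundle_range S.smoothOp_PD fun x s => S.PD_of_mem_D (S.PD_mem s)

theorem exists_section_D (d : ℂ ⊗[ℝ] E x) (hd : d ∈ S.D x) :
    ∃ W : Set M, IsOpen W ∧ x ∈ W ∧ ∃ s : Π y, ℂ ⊗[ℝ] E y, SmoothCSec V F s W ∧
      (∀ y, s y ∈ S.D y) ∧ s x = d := by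
  obtain ⟨W, hW, hxW, s, hs, hsd⟩ := exists_smoothCSec_eq V F x d
  exact ⟨W, hW, hxW, fun y => S.PD y (s y), S.smoothOp_PD W hW s hs, fun y => S.PD_mem _, by
    simp only [hsd, S.PD_of_mem_D hd]⟩

/-- Differentiate `⟨d, s⟩ = 0` along the anchor of `r`: the result is `⟨[r, d], s⟩ + ⟨d, [r, s]⟩`,
and the first term vanishes because `[r, d]` lies in `D`. -/
theorem cBracket_mem_perp (hU : IsOpen U) {r s : Π x, ℂ ⊗[ℝ] E x} (hr : SmoothCSec V F r U)
    (hs : SmoothCSec V F s U) (hsD : ∀ y ∈ U, s y ∈ C.perp S.D y)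
    (h : ∀ W : Set M, IsOpen W → W ⊆ U → ∀ d : Π x, ℂ ⊗[ℝ] E x, SmoothCSec V F d W →
      (∀ y ∈ W, d y ∈ S.D y) → ∀ y ∈ W, C.cBracket r d y ∈ S.D y) (hx : x ∈ U) :
    C.cBracket r s x ∈ C.perp S.D x := by
  intro d hd
  -- Invariance concerns sections, so the vector `d` is extended to a local section of `D`.
  obtain ⟨W, hW, hxW, e, he, heD, rfl⟩ := S.exists_section_D d hd
  have hUW : IsOpen (U ∩ W) := hU.inter hW
  have h1 := C.cBracket_invariant hUW (hr.mono inter_subset_left) (he.mono inter_subset_right)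
    (hs.mono inter_subset_left) ⟨hx, hxW⟩
  have h2 := h _ hUW inter_subset_left e (he.mono inter_subset_right) (fun y _ => heD y) x ⟨hx, hxW⟩
  have h3 : C.cPairing x (C.cBracket r e x) (s x) = 0 := hsD x hx _ h2
  rw [h3, zero_add, cderiv1_congr hUW ⟨hx, hxW⟩ (g := fun _ => 0) fun y hy => hsD y hy.1 _ (heD y),
    cderiv1_zero] at h1
  exact h1.symm

theorem cBracket_D_mem_perp (hU : IsOpen U) {d s : Π x, ℂ ⊗[ℝ] E x} (hd : SmoothCSec V F d U)
    (hs : SmoothCSec V F s U) (hdD : ∀ y ∈ U, d y ∈ S.D y) (hsD : ∀ y ∈ U, s y ∈ C.perp S.D y)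
    (hx : x ∈ U) : C.cBracket d s x ∈ C.perp S.D x :=
  S.cBracket_mem_perp hU hd hs hsD (fun W hW hWU e he heD => S.bracketMem_D W hW d e (hd.mono hWU)
    he (fun y hy => hdD y (hWU hy)) heD) hx

/-- The difference `s - Q s` is a section of `D`, so its bracket with `d` lies in `D` and dies under
`Q`. Hence the Dolbeault operator does not depend on the lift. -/
theorem Q_cBracket_Q (hU : IsOpen U) {d s : Π x, ℂ ⊗[ℝ] E x} (hd : SmoothCSec V F d U)
    (hs : SmoothCSec V F s U) (hdD : ∀ y ∈ U, d y ∈ S.D y) (hsD : ∀ y ∈ U, s y ∈ C.perp S.D y)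
    (hx : x ∈ U) : S.Q x (C.cBracket d (fun y => S.Q y (s y)) x) = S.Q x (C.cBracket d s x) := by
  have hQs := S.smoothOp_Q U hU s hs
  have h := C.cBracket_sub_right hU hd hs hQs hx
  have h1 := S.Q_of_mem_D (S.bracketMem_D U hU _ _ hd (hs.sub hQs) hdD
    (fun y hy => S.sub_Q_mem (hsD y hy)) x hx)
  rw [h, map_sub, sub_eq_zero] at h1
  exact h1.symm

/-- Sections of `D^⊥` which induce holomorphic sections of the quotient. -/
structure HolLift (s : Π x, ℂ ⊗[ℝ] E x) (U : Set M) : Prop where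
  smooth : SmoothCSec V F s U
  mem : ∀ y ∈ U, s y ∈ C.perp S.D y
  bracket_mem : ∀ W : Set M, IsOpen W → W ⊆ U → ∀ d : Π x, ℂ ⊗[ℝ] E x, SmoothCSec V F d W →
    (∀ y ∈ W, d y ∈ S.D y) → ∀ y ∈ W, C.cBracket d s y ∈ S.D y

namespace HolLift

variable {S} {a b c : Π x, ℂ ⊗[ℝ] E x}

theorem bracket_mem' (h : S.HolLift a U) (W : Set M) (hW : IsOpen W) (hWU : W ⊆ U)
    (d : Π x, ℂ ⊗[ℝ] E x) (hd : SmoothCSec V F d W) (hdD : ∀ y ∈ W, d y ∈ S.D y) (y : M)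
    (hy : y ∈ W) : C.cBracket a d y ∈ S.D y := by
  rw [← neg_neg (C.cBracket a d y), ← C.cBracket_skew hW hd (h.smooth.mono hWU)
    (fun z hz => h.mem z (hWU hz) _ (hdD z hz)) hy]
  exact Submodule.neg_mem _ (h.bracket_mem W hW hWU d hd hdD y hy)

theorem cBracket_mem_perp (ha : S.HolLift a U) (hU : IsOpen U) (hb : SmoothCSec V F b U)
    (hbD : ∀ y ∈ U, b y ∈ C.perp S.D y) (hx : x ∈ U) : C.cBracket a b x ∈ C.perp S.D x :=
  S.cBracket_mem_perp hU ha.smooth hb hbD ha.bracket_mem' hx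

/-- The Jacobi identity expands `[d, [a, b]]` into `[[d, a], b] + [a, [d, b]]`, and both inner
brackets lie in `D`. -/
theorem cBracket (ha : S.HolLift a U) (hb : S.HolLift b U) (hU : IsOpen U) :
    S.HolLift (C.cBracket a b) U where
  smooth := C.smoothCSec_cBracket hU ha.smooth hb.smooth
  mem y hy := ha.cBracket_mem_perp hU hb.smooth hb.mem hy
  bracket_mem W hW hWU d hd hdD y hy := by
    have ha' := ha.smooth.mono hWU
    have hb' := hb.smooth.mono hWU
    rw [C.cBracket_jacobi hW hd ha' hb' hy]
    exact Submodule.add_mem _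
      (hb.bracket_mem W hW hWU _ (C.smoothCSec_cBracket hW hd ha')
        (ha.bracket_mem W hW hWU d hd hdD) y hy)
      (ha.bracket_mem' W hW hWU _ (C.smoothCSec_cBracket hW hd hb')
        (hb.bracket_mem W hW hWU d hd hdD) y hy)

/-- Being a holomorphic lift depends only on the class modulo `D`, because `D` is isotropic and
involutive. -/
theorem of_sub_mem (ha : S.HolLift a U) (hb : SmoothCSec V F b U)
    (hab : ∀ y ∈ U, a y - b y ∈ S.D y) : S.HolLift b U where
  smooth := hb
  mem y hy := by
    simpa using Submodule.sub_mem _ (ha.mem y hy) (S.D_le_perp_D y (hab y hy))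
  bracket_mem W hW hWU d hd hdD y hy := by
    have h1 := ha.bracket_mem W hW hWU d hd hdD y hy
    have h2 := S.bracketMem_D W hW d _ hd ((ha.smooth.mono hWU).sub (hb.mono hWU)) hdD
      (fun z hz => hab z (hWU hz)) y hy
    rw [C.cBracket_sub_right hW hd (ha.smooth.mono hWU) (hb.mono hWU) hy] at h2
    simpa using Submodule.sub_mem _ h1 h2

theorem Q (ha : S.HolLift a U) (hU : IsOpen U) : S.HolLift (fun y => S.Q y (a y)) U :=
  ha.of_sub_mem (S.smoothOp_Q U hU a ha.smooth) fun y hy => S.sub_Q_mem (ha.mem y hy)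

theorem of_Q (ha : S.HolLift (fun y => S.Q y (a y)) U) (haU : SmoothCSec V F a U)
    (haD : ∀ y ∈ U, a y ∈ C.perp S.D y) : S.HolLift a U :=
  ha.of_sub_mem haU fun y hy => by
    rw [← neg_sub]; exact Submodule.neg_mem _ (S.sub_Q_mem (haD y hy))

theorem Q_cBracket_Q_right (ha : S.HolLift a U) (hU : IsOpen U) (hb : SmoothCSec V F b U)
    (hbD : ∀ y ∈ U, b y ∈ C.perp S.D y) (hx : x ∈ U) :
    S.Q x (C.cBracket a (fun y => S.Q y (b y)) x) = S.Q x (C.cBracket a b x) := by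
  have hQb := S.smoothOp_Q U hU b hb
  have h1 := S.Q_of_mem_D (ha.bracket_mem' U hU subset_rfl _ (hb.sub hQb)
    (fun y hy => S.sub_Q_mem (hbD y hy)) x hx)
  rw [C.cBracket_sub_right hU ha.smooth hb hQb hx, map_sub, sub_eq_zero] at h1
  exact h1.symm

theorem Q_cBracket_Q_left (hb : S.HolLift b U) (hU : IsOpen U) (ha : SmoothCSec V F a U)
    (haD : ∀ y ∈ U, a y ∈ C.perp S.D y) (hx : x ∈ U) :
    S.Q x (C.cBracket (fun y => S.Q y (a y)) b x) = S.Q x (C.cBracket a b x) := by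
  have hQa := S.smoothOp_Q U hU a ha
  have h1 := S.Q_of_mem_D (hb.bracket_mem U hU subset_rfl _ (ha.sub hQa)
    (fun y hy => S.sub_Q_mem (haD y hy)) x hx)
  rw [C.cBracket_sub_left hU ha hQa hb.smooth hx, map_sub, sub_eq_zero] at h1
  exact h1.symm

end HolLift

variable [FiniteDimensional ℝ V]

/-- Near a point choose smooth sections `u i` of the complexified `C_+` whose anchors form a frame.
If the anchors have smooth coefficients `c i` in the expansion of `X`, then `σ X` is the combination
of the `u i` with the same coefficients. -/
theorem smoothCSec_cσ (hU : IsOpen U) {X : Π x : M, CT V x} (hX : SmoothCVF V X U) :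
    SmoothCSec V F (fun x => S.cσ x (X x)) U := by
  refine smoothCSec_of_locally fun x₀ hx₀ => ?_
  have : FiniteDimensional ℝ (TangentSpace 𝓘(ℝ, V) x₀) := inferInstanceAs (FiniteDimensional ℝ V)
  let b := Module.finBasis ℂ (CT V x₀)
  choose U' hU' hxU' s hs hsv using fun i => exists_smoothCSec_eq V F x₀ (S.cσ x₀ (b i))
  have hUo : IsOpen (⋂ i, U' i) := isOpen_iInter_of_finite hU'
  -- The operator `1 - Q` is the projection to the complexified `C_+`, where `σ` inverts the anchor.
  let u (i) (x : M) : ℂ ⊗[ℝ] E x := s i x - S.Q x (s i x)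
  have hu (i) : SmoothCSec V F (u i) (⋂ i, U' i) :=
    have h := (hs i).mono (iInter_subset U' i)
    h.sub (S.smoothOp_Q _ hUo _ h)
  have huj (i y) : S.cσ y (C.cAnchor y (u i y)) = u i y := by
    refine S.cσ_cAnchor ?_
    simp only [u, map_sub, S.jp_jm_Q]
    rw [Q_apply]
    module
  obtain ⟨W, hW, hxW, hWU, B, hB, c, hBc, hcs⟩ := exists_frame_of_basis V V
    (E := fun x : M => TangentSpace 𝓘(ℝ, V) x) hUo (mem_iInter.2 hxU')
    (fun i x => C.cAnchor x (u i x)) (fun i => C.smoothCVF_cAnchor hUo (hu i)) b (fun i => by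
      simp only [u, hsv, Q_apply, S.jp_jm_cσ]
      simp [S.cAnchor_cσ])
  refine ⟨W ∩ U, hW.inter hU, ⟨hxW, hx₀⟩, (SmoothCSec.sum (A := Finset.univ) fun i _ =>
    (((hu i).mono (inter_subset_left.trans hWU)).smul (hcs (W ∩ U) (hW.inter hU)
      inter_subset_left X (hX.mono inter_subset_right) i))).congr fun y hy => ?_⟩
  conv_lhs => rw [← (B y hy.1).sum_repr (X y)]
  simp [hB, hBc, huj]

theorem smoothCVF_J (hU : IsOpen U) {X : Π x : M, CT V x} (hX : SmoothCVF V X U) :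
    SmoothCVF V (fun x => (S.J x).baseChange ℂ (X x)) U := by
  simp only [J_baseChange]
  exact C.smoothCVF_cAnchor hU (S.isGenComplex_p.smoothOp U hU _ (S.smoothCSec_cσ hU hX))

theorem smoothCVF_P10 (hU : IsOpen U) {X : Π x : M, CT V x} (hX : SmoothCVF V X U) :
    SmoothCVF V (fun x => P10 S.J x (X x)) U :=
  SmoothCSec.const_smul _ (SmoothCSec.sub hX ((S.smoothCVF_J hU hX).const_smul Complex.I))

theorem cLie_eq (hU : IsOpen U) {X Y : Π x : M, CT V x} (hX : SmoothCVF V X U)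
    (hY : SmoothCVF V Y U) (hx : x ∈ U) : cLie V X Y x =
      C.cAnchor x (C.cBracket (fun y => S.cσ y (X y)) (fun y => S.cσ y (Y y)) x) := by
  rw [C.cAnchor_cBracket hU (S.smoothCSec_cσ hU hX) (S.smoothCSec_cσ hU hY) hx]
  simp only [cAnchor_cσ]

theorem cσ_cLie (hU : IsOpen U) {X Y : Π x : M, CT V x} (hX : IsVF01 S.J X U)
    (hY : IsVF01 S.J Y U) (hx : x ∈ U) : S.cσ x (cLie V X Y x) =
      C.cBracket (fun y => S.cσ y (X y)) (fun y => S.cσ y (Y y)) x := by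
  rw [S.cLie_eq hU hX.1 hY.1 hx]
  exact S.cσ_cAnchor_of_mem_D (S.bracketMem_D U hU _ _ (S.smoothCSec_cσ hU hX.1)
    (S.smoothCSec_cσ hU hY.1) (fun y hy => S.cσ_mem_D (hX.2 y hy))
    (fun y hy => S.cσ_mem_D (hY.2 y hy)) x hx)

theorem cLie_mem_T01 (hU : IsOpen U) {X Y : Π x : M, CT V x} (hX : IsVF01 S.J X U)
    (hY : IsVF01 S.J Y U) (hx : x ∈ U) : cLie V X Y x ∈ T01 S.J x := by
  rw [S.cLie_eq hU hX.1 hY.1 hx]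
  exact S.cAnchor_mem_T01 (S.bracketMem_D U hU _ _ (S.smoothCSec_cσ hU hX.1)
    (S.smoothCSec_cσ hU hY.1) (fun y hy => S.cσ_mem_D (hX.2 y hy))
    (fun y hy => S.cσ_mem_D (hY.2 y hy)) x hx)

/-- Lifting by `σ` turns additivity of the Courant bracket into additivity of the Lie bracket. -/
theorem cLie_add_left (S : C.SplitPair) (hU : IsOpen U) {X X' Y : Π x : M, CT V x}
    (hX : SmoothCVF V X U) (hX' : SmoothCVF V X' U) (hY : SmoothCVF V Y U) (hx : x ∈ U) :
    cLie V (fun y => X y + X' y) Y x = cLie V X Y x + cLie V X' Y x := by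
  rw [S.cLie_eq hU hX hY hx, S.cLie_eq hU hX' hY hx, S.cLie_eq hU (SmoothCSec.add hX hX') hY hx]
  simp only [map_add]
  rw [C.cBracket_add_left hU (S.smoothCSec_cσ hU hX) (S.smoothCSec_cσ hU hX')
    (S.smoothCSec_cσ hU hY) hx, map_add]

theorem cLie_add_right (S : C.SplitPair) (hU : IsOpen U) {X Y Y' : Π x : M, CT V x}
    (hX : SmoothCVF V X U) (hY : SmoothCVF V Y U) (hY' : SmoothCVF V Y' U) (hx : x ∈ U) :
    cLie V X (fun y => Y y + Y' y) x = cLie V X Y x + cLie V X Y' x := by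
  rw [cLie_swap, S.cLie_add_left hU hY hY' hX hx, neg_add, ← cLie_swap, ← cLie_swap]

theorem isComplexStructure_J : IsComplexStructure S.J where
  sq x a := by
    have h := congrArg cre (S.J_J (cmk a 0))
    simpa using h
  smooth U hU X hX := by
    have h := S.smoothCVF_J hU (smoothCSec_cmk hX (smoothSec_zero U))
    exact h.1.congr fun y _ => by simp
  integrable U hU X Y hX hY hX10 hY10 x hx := by
    have hmem (Z : Π x : M, CT V x) (hZ : ∀ x ∈ U, Z x ∈ T10 S.J x) (y : M) (hy : y ∈ U) :
        S.jp y (S.cσ y (Z y)) = Complex.I • S.cσ y (Z y) ∧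
          S.jm y (S.cσ y (Z y)) = Complex.I • S.cσ y (Z y) := by
      have h : S.jp y (S.cσ y (Z y)) = Complex.I • S.cσ y (Z y) := by
        rw [← cσ_J, S.mem_T10.1 (hZ y hy), map_smul]
      exact ⟨h, by rw [jm_cσ, h]⟩
    have hp := mem_eigenbundle.1 (S.isGenComplex_p.involutive U hU _ _ (S.smoothCSec_cσ hU hX)
      (S.smoothCSec_cσ hU hY) (fun y hy => mem_eigenbundle.2 (hmem X hX10 y hy).1)
      (fun y hy => mem_eigenbundle.2 (hmem Y hY10 y hy).1) x hx)
    have hm := mem_eigenbundle.1 (S.isGenComplex_m.involutive U hU _ _ (S.smoothCSec_cσ hU hX)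
      (S.smoothCSec_cσ hU hY) (fun y hy => mem_eigenbundle.2 (hmem X hX10 y hy).2)
      (fun y hy => mem_eigenbundle.2 (hmem Y hY10 y hy).2) x hx)
    -- The bracket of the lifts is a `+i`-eigenvector of both structures, so `Jp Jm` acts on it by
    -- `-1` and `σ` recovers it from its anchor.
    rw [S.cLie_eq hU hX hY hx, mem_T10, J_baseChange, S.cσ_cAnchor, hp, map_smul]
    rw [hm, map_smul, hp, smul_smul, Complex.I_mul_I, neg_one_smul]

theorem isLifting_D : C.IsLifting S.J S.D where
  subbundle := S.isSmoothSubbundle_D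
  isotropic := S.D_le_perp_D
  involutive := S.bracketMem_D
  anchor_bijOn x := ⟨fun _ h => S.cAnchor_mem_T01 h, fun s hs t ht h => by
      rw [← S.cσ_cAnchor_of_mem_D hs, ← S.cσ_cAnchor_of_mem_D ht, h],
    fun X hX => ⟨S.cσ x X, S.cσ_mem_D hX, S.cAnchor_cσ X⟩⟩

end SplitPair

end ExactCourantAlgebroid

end GKGeom

namespace GKGeom

namespace ExactCourantAlgebroid

namespace SplitPair

variable {V : Type u} [NormedAddCommGroup V] [NormedSpace ℝ V] [FiniteDimensional ℝ V]
  {M : Type v} [TopologicalSpace M] [ChartedSpace V M] [IsManifold 𝓘(ℝ, V) ∞ M]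
  {F : Type*} [NormedAddCommGroup F] [NormedSpace ℝ F] [FiniteDimensional ℝ F]
  {E : M → Type w} [∀ x, AddCommGroup (E x)] [∀ x, Module ℝ (E x)]
  [TopologicalSpace (TotalSpace F E)] [∀ x, TopologicalSpace (E x)] [FiberBundle F E]
  [VectorBundle ℝ F E] [ContMDiffVectorBundle ∞ F E 𝓘(ℝ, V)]
  {C : ExactCourantAlgebroid V F E} (S : C.SplitPair) {U : Set M} {x : M}

/-! ### The reduced Courant algebroid -/

/-- The fibre of the reduction, a complement of `D` in `D^⊥`. -/
abbrev Fib (x : M) : Submodule ℂ (ℂ ⊗[ℝ] E x) := LinearMap.range (S.Q x)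

/-- The projection to the fibre of the reduction. -/
def q (x : M) : ℂ ⊗[ℝ] E x →ₗ[ℂ] S.Fib x := (S.Q x).rangeRestrict

@[simp] theorem coe_q (s : ℂ ⊗[ℝ] E x) : (S.q x s : ℂ ⊗[ℝ] E x) = S.Q x s := rfl

@[simp] theorem Q_coe (s : S.Fib x) : S.Q x s = s := by
  obtain ⟨_, t, rfl⟩ := s
  exact S.Q_Q t

theorem jp_jm_coe (s : S.Fib x) : S.jp x (S.jm x s) = (s : ℂ ⊗[ℝ] E x) := by
  rw [← S.Q_coe s]; exact S.jp_jm_Q _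

theorem coe_mem_perp (s : S.Fib x) : (s : ℂ ⊗[ℝ] E x) ∈ C.perp S.D x :=
  S.mem_perp_D (S.jp_jm_coe s)

/-- The smooth complex vector bundle underlying the reduction. -/
def cBundle : SmoothCBundle.{u, v, w} V M where
  Fiber x := S.Fib x
  IsSmooth s U := SmoothCSec V F (fun x => (s x : ℂ ⊗[ℝ] E x)) U
  smooth_iff_locally U hU s := ⟨fun h x hx => ⟨U, hU, hx, h⟩, smoothCSec_of_locally⟩
  exists_frame x₀ := by
    obtain ⟨U, hU, hx, n, e, he, hQe, hs, c, hc, hcs⟩ :=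
      exists_frame_range S.smoothOp_Q (fun x s => S.Q_Q s) x₀
    have hmem (i y) : e i y ∈ S.Fib y := ⟨_, hQe i y⟩
    refine ⟨U, hU, hx, n, fun i y => ⟨e i y, hmem i y⟩, fun y hy => ⟨?_, ?_⟩,
      fun W hW hWU s => ⟨fun h => ⟨fun i y => c i y (s y), hcs W hW hWU _ h, fun y hy =>
        Subtype.ext ?_⟩, ?_⟩⟩
    · exact LinearIndependent.of_comp (S.Fib y).subtype (hs y hy).1
    · refine Submodule.map_injective_of_injective (S.Fib y).injective_subtype ?_
      rw [Submodule.map_span, Submodule.map_top, Submodule.range_subtype, ← range_comp]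
      exact (hs y hy).2
    · simpa using hc y (hWU hy) (s y) (S.Q_coe _)
    · rintro ⟨f, hf, h⟩
      exact (SmoothCSec.sum (A := Finset.univ) fun i _ =>
        ((he i).mono hWU).smul (hf i)).congr fun y hy => by rw [h y hy]; simp

/-- The Dolbeault operator of the reduction. -/
def dbar (X : Π x : M, CT V x) (s : Π x, S.Fib x) (x : M) : S.Fib x :=
  S.q x (C.cBracket (fun y => S.cσ y (X y)) (fun y => s y) x)

/-- The bracket of the reduction. -/
def rBracket (s t : Π x, S.Fib x) (x : M) : S.Fib x :=
  S.q x (C.cBracket (fun y => s y) (fun y => t y) x)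

variable {S} in
theorem _root_.GKGeom.IsVF01.cσ_mem {X : Π x : M, CT V x} (hX : IsVF01 S.J X U) :
    ∀ y ∈ U, S.cσ y (X y) ∈ S.D y := fun y hy => S.cσ_mem_D (hX.2 y hy)

variable {S} in
theorem _root_.GKGeom.IsVF01.smooth_cσ {X : Π x : M, CT V x} (hX : IsVF01 S.J X U)
    (hU : IsOpen U) : SmoothCSec V F (fun y => S.cσ y (X y)) U := S.smoothCSec_cσ hU hX.1

/-- Since `⟨d, s⟩ = 0` the bracket is skew on these sections, so Leibniz applies in the first slot
too. The derivative term is a multiple of `d`, which `Q` kills. -/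
theorem dbar_smul_vf_aux (hU : IsOpen U) {f : M → ℂ} {d s : Π x, ℂ ⊗[ℝ] E x}
    (hf : SmoothCFun V f U) (hd : SmoothCSec V F d U) (hs : SmoothCSec V F s U)
    (hdD : ∀ y ∈ U, d y ∈ S.D y) (hsD : ∀ y ∈ U, s y ∈ C.perp S.D y) (hx : x ∈ U) :
    S.Q x (C.cBracket (fun y => f y • d y) s x) = f x • S.Q x (C.cBracket d s x) := by
  have h0 (y) (hy : y ∈ U) : C.cPairing y (d y) (s y) = 0 := hsD y hy _ (hdD y hy)
  rw [C.cBracket_skew hU (hd.smul hf) hs (fun y hy => by simp [h0 y hy]) hx,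
    C.cBracket_leibniz hU hf hs hd hx, C.cBracket_skew hU hd hs h0 hx]
  simp [S.Q_of_mem_D (hdD x hx)]

section Dolbeault

variable {f : M → ℂ} {X Y : Π x : M, CT V x} {s t : Π x, S.Fib x}

theorem dbar_congr (hU : IsOpen U) {X' : Π x : M, CT V x} {s' : Π x, S.Fib x}
    (hX : IsVF01 S.J X U) (hs : SmoothCSec V F (fun x => (s x : ℂ ⊗[ℝ] E x)) U)
    (eX : ∀ x ∈ U, X x = X' x) (es : ∀ x ∈ U, s x = s' x) (hx : x ∈ U) :
    S.dbar X s x = S.dbar X' s' x :=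
  congrArg (S.q x) (C.cBracket_congr hU (hX.smooth_cσ hU) hs
    (fun y hy => by rw [eX y hy]) (fun y hy => by rw [es y hy]) hx)

theorem smoothCSec_dbar (hU : IsOpen U) (hX : IsVF01 S.J X U)
    (hs : SmoothCSec V F (fun x => (s x : ℂ ⊗[ℝ] E x)) U) :
    SmoothCSec V F (fun x => (S.dbar X s x : ℂ ⊗[ℝ] E x)) U :=
  S.smoothOp_Q U hU _ (C.smoothCSec_cBracket hU (hX.smooth_cσ hU) hs)

theorem dbar_add_vf (hU : IsOpen U) (hX : IsVF01 S.J X U) (hY : IsVF01 S.J Y U)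
    (hs : SmoothCSec V F (fun x => (s x : ℂ ⊗[ℝ] E x)) U) (hx : x ∈ U) :
    S.dbar (fun y => X y + Y y) s x = S.dbar X s x + S.dbar Y s x := by
  simp only [dbar, map_add]
  rw [C.cBracket_add_left hU (hX.smooth_cσ hU) (hY.smooth_cσ hU) hs hx, map_add]

theorem dbar_smul_vf (hU : IsOpen U) (hf : SmoothCFun V f U) (hX : IsVF01 S.J X U)
    (hs : SmoothCSec V F (fun x => (s x : ℂ ⊗[ℝ] E x)) U) (hx : x ∈ U) :
    S.dbar (fun y => f y • X y) s x = f x • S.dbar X s x := by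
  refine Subtype.ext ?_
  simpa [dbar] using S.dbar_smul_vf_aux hU hf (hX.smooth_cσ hU) hs hX.cσ_mem
    (fun y _ => S.coe_mem_perp (s y)) hx

theorem dbar_add (hU : IsOpen U) (hX : IsVF01 S.J X U)
    (hs : SmoothCSec V F (fun x => (s x : ℂ ⊗[ℝ] E x)) U)
    (ht : SmoothCSec V F (fun x => (t x : ℂ ⊗[ℝ] E x)) U) (hx : x ∈ U) :
    S.dbar X (fun y => s y + t y) x = S.dbar X s x + S.dbar X t x := by
  simp only [dbar, Submodule.coe_add]
  rw [C.cBracket_add_right hU (hX.smooth_cσ hU) hs ht hx, map_add]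

theorem dbar_leibniz (hU : IsOpen U) (hf : SmoothCFun V f U) (hX : IsVF01 S.J X U)
    (hs : SmoothCSec V F (fun x => (s x : ℂ ⊗[ℝ] E x)) U) (hx : x ∈ U) :
    S.dbar X (fun y => f y • s y) x = f x • S.dbar X s x + cderiv1 V f x (X x) • s x := by
  simp only [dbar, Submodule.coe_smul]
  rw [C.cBracket_leibniz hU hf (hX.smooth_cσ hU) hs hx, cAnchor_cσ]
  exact Subtype.ext (by simp)

/-- The inner `Q` may be dropped, because `[σ Y, s]` is a section of `D^⊥`. -/
theorem coe_dbar_dbar (hU : IsOpen U) (hX : IsVF01 S.J X U) (hY : IsVF01 S.J Y U)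
    (hs : SmoothCSec V F (fun x => (s x : ℂ ⊗[ℝ] E x)) U) (hx : x ∈ U) :
    (S.dbar X (S.dbar Y s) x : ℂ ⊗[ℝ] E x) = S.Q x (C.cBracket (fun y => S.cσ y (X y))
      (C.cBracket (fun y => S.cσ y (Y y)) fun y => s y) x) :=
  S.Q_cBracket_Q hU (hX.smooth_cσ hU) (C.smoothCSec_cBracket hU (hY.smooth_cσ hU) hs)
    hX.cσ_mem (fun _ hy => S.cBracket_D_mem_perp hU (hY.smooth_cσ hU) hs hY.cσ_mem
      (fun z _ => S.coe_mem_perp (s z)) hy) hx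

/-- The Jacobi identity, with `[σ X, σ Y] = σ [X, Y]` for fields of type `(0,1)`. -/
theorem dbar_flat (hU : IsOpen U) (hX : IsVF01 S.J X U) (hY : IsVF01 S.J Y U)
    (hs : SmoothCSec V F (fun x => (s x : ℂ ⊗[ℝ] E x)) U) (hx : x ∈ U) :
    S.dbar X (S.dbar Y s) x - S.dbar Y (S.dbar X s) x = S.dbar (cLie V X Y) s x := by
  have hX' := hX.smooth_cσ hU
  have hY' := hY.smooth_cσ hU
  have h1 := C.cBracket_jacobi hU hX' hY' hs hx
  have h2 := C.cBracket_congr hU (C.smoothCSec_cBracket hU hX' hY') hs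
    (s' := fun y => S.cσ y (cLie V X Y y)) (fun y hy => (S.cσ_cLie hU hX hY hy).symm)
    (fun y _ => rfl) hx
  refine Subtype.ext ?_
  rw [Submodule.coe_sub, S.coe_dbar_dbar hU hX hY hs hx, S.coe_dbar_dbar hU hY hX hs hx, ← map_sub,
    dbar, coe_q, ← h2, h1, add_sub_cancel_right]

end Dolbeault

/-- The holomorphic vector bundle underlying the reduction. -/
def holBundle : HolVectorBundle.{u, v, w} S.J where
  toSmoothCBundle := S.cBundle
  dbar := S.dbar
  dbar_congr _ hU _ _ _ _ hX hs eX es _ hx := S.dbar_congr hU hX hs eX es hx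
  dbar_smooth _ hU _ _ hX hs := S.smoothCSec_dbar hU hX hs
  dbar_add_vf _ hU _ _ _ hX hY hs _ hx := S.dbar_add_vf hU hX hY hs hx
  dbar_smul_vf _ hU _ _ _ hf hX hs _ hx := S.dbar_smul_vf hU hf hX hs hx
  dbar_add _ hU _ _ _ hX hs ht _ hx := S.dbar_add hU hX hs ht hx
  dbar_leibniz _ hU _ _ _ hf hX hs _ hx := S.dbar_leibniz hU hf hX hs hx
  dbar_flat _ hU _ _ _ hX hY hs _ hx := S.dbar_flat hU hX hY hs hx

/-- Every section of `D` is `σ` of its anchor, and an element of `D^⊥` such as `[d, s]` is killed by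
`Q` exactly when it lies in `D`. -/
theorem isHol_iff {s : Π x, S.Fib x} :
    S.holBundle.IsHol s U ↔ S.HolLift (fun y => (s y : ℂ ⊗[ℝ] E y)) U := by
  constructor
  · rintro ⟨h1, h2⟩
    refine ⟨h1, fun y _ => S.coe_mem_perp _, fun W hW hWU d hd hdD y hy => ?_⟩
    have hs : SmoothCSec V F (fun y => (s y : ℂ ⊗[ℝ] E y)) W := SmoothCSec.mono h1 hWU
    have h3 : C.cBracket (fun y => S.cσ y (C.cAnchor y (d y))) (fun y => s y) y =
        C.cBracket d (fun y => s y) y :=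
      (C.cBracket_congr hW hd hs (fun z hz => (S.cσ_cAnchor_of_mem_D (hdD z hz)).symm)
        (fun z _ => rfl) hy).symm
    have h4 : S.Q y (C.cBracket (fun y => S.cσ y (C.cAnchor y (d y))) (fun y => s y) y) = 0 :=
      congrArg Subtype.val (h2 W hW hWU (fun y => C.cAnchor y (d y))
        ⟨C.smoothCVF_cAnchor hW hd, fun z hz => S.cAnchor_mem_T01 (hdD z hz)⟩ y hy)
    have h5 := S.sub_Q_mem (S.cBracket_D_mem_perp hW hd hs hdD (fun z _ => S.coe_mem_perp (s z)) hy)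
    rwa [← h3, h4, sub_zero, h3] at h5
  · intro h
    refine ⟨h.smooth, fun W hW hWU X hX y hy => Subtype.ext ?_⟩
    exact S.Q_of_mem_D (h.bracket_mem W hW hWU _ (hX.smooth_cσ hW) hX.cσ_mem y hy)

/-- The pairing of the reduction. -/
def rPairing (x : M) : LinearMap.BilinForm ℂ (S.Fib x) :=
  (C.cPairing x).domRestrict₁₂ (S.Fib x) (S.Fib x)

/-- The anchor of the reduction. -/
def rAnchor (x : M) : S.Fib x →ₗ[ℂ] CT V x := P10 S.J x ∘ₗ C.cAnchor x ∘ₗ (S.Fib x).subtype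

theorem rPairing_apply (a b : S.Fib x) : S.rPairing x a b = C.cPairing x a b := rfl

theorem rAnchor_apply (a : S.Fib x) : S.rAnchor x a = P10 S.J x (C.cAnchor x a) := rfl

theorem cPairing_eq_of_mem_perp {a b : ℂ ⊗[ℝ] E x} (ha : a ∈ C.perp S.D x)
    (hb : b ∈ C.perp S.D x) : C.cPairing x (S.Q x a) (S.Q x b) = C.cPairing x a b := by
  have h1 : C.cPairing x (a - S.Q x a) b = 0 := hb _ (S.sub_Q_mem ha)
  rw [cPairing_Q_left, Q_Q, ← cPairing_Q_left]
  rw [map_sub, LinearMap.sub_apply, sub_eq_zero] at h1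
  exact h1.symm

theorem P10_cAnchor_Q {a : ℂ ⊗[ℝ] E x} (ha : a ∈ C.perp S.D x) :
    P10 S.J x (C.cAnchor x (S.Q x a)) = P10 S.J x (C.cAnchor x a) := by
  have h := S.P10_of_mem_T01 (S.cAnchor_mem_T01 (S.sub_Q_mem ha))
  rw [map_sub, map_sub, sub_eq_zero] at h
  exact h.symm

theorem mem_T01_of_P10_eq_zero {X : CT V x} (h : P10 S.J x X = 0) : X ∈ T01 S.J x := by
  have := S.sub_P10_mem X
  rwa [h, sub_zero] at this

/-- The splitting `τ` takes values in the range of `Q`, which provides preimages. -/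
theorem range_rAnchor (x : M) : LinearMap.range (S.rAnchor x) = T10 S.J x := by
  refine le_antisymm ?_ fun X hX => ?_
  · rintro _ ⟨a, rfl⟩
    exact S.P10_mem _
  · refine ⟨S.q x (S.cτ x X), ?_⟩
    rw [rAnchor_apply, coe_q, S.Q_eq_self (S.jp_jm_cτ X), cAnchor_cτ, S.P10_of_mem_T10 hX]

theorem rPairing_nondeg (a : S.Fib x) (h : ∀ b, S.rPairing x a b = 0) : a = 0 := by
  refine Subtype.ext (C.cPairing_nondeg x _ fun t => ?_)
  rw [← S.Q_coe a, cPairing_Q_left]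
  exact h (S.q x t)

/-- The space `D^⊥ ∩ ker π` is the orthogonal complement of `D + ker π`, as `ker π` is Lagrangian.
By the double-orthogonal theorem `a` lies in `D + ker π`, and the anchor maps this into `T01`. -/
theorem cAnchor_mem_T01_of_perp (a : S.Fib x)
    (h : ∀ k ∈ C.perp S.D x, C.cAnchor x k = 0 → C.cPairing x k a = 0) :
    C.cAnchor x a ∈ T01 S.J x := by
  have : FiniteDimensional ℝ (E x) := finiteDimensional_fiber F x
  have hr : (C.cPairing x).IsRefl := fun s t h => by rw [cPairing_symm]; exact h
  have hn : (C.cPairing x).Nondegenerate :=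
    hr.nondegenerate_iff_separatingLeft.2 fun s h => C.cPairing_nondeg x s h
  have h1 : (a : ℂ ⊗[ℝ] E x) ∈ (C.cPairing x).orthogonal ((C.cPairing x).orthogonal
      (S.D x ⊔ LinearMap.ker (C.cAnchor x))) := fun k hk =>
    h k (fun d hd => hk d (Submodule.mem_sup_left hd))
      (C.mem_cAnchor_ker fun t ht => hk t (Submodule.mem_sup_right ht))
  rw [LinearMap.BilinForm.orthogonal_orthogonal hn hr] at h1
  obtain ⟨d, hd, k, hk, hdk⟩ := Submodule.mem_sup.1 h1
  rw [← hdk, map_add, LinearMap.mem_ker.1 hk, add_zero]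
  exact S.cAnchor_mem_T01 hd

theorem orthogonal_ker_rAnchor (x : M) :
    (S.rPairing x).orthogonal (LinearMap.ker (S.rAnchor x)) = LinearMap.ker (S.rAnchor x) := by
  ext a
  constructor
  · intro h
    refine S.P10_of_mem_T01 (S.cAnchor_mem_T01_of_perp a fun k hk hk0 => ?_)
    have h1 : S.q x k ∈ LinearMap.ker (S.rAnchor x) := by
      rw [LinearMap.mem_ker, rAnchor_apply, coe_q, S.P10_cAnchor_Q hk, hk0, map_zero]
    have h2 : S.rPairing x (S.q x k) a = 0 := LinearMap.BilinForm.mem_orthogonal_iff.1 h _ h1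
    rwa [rPairing_apply, coe_q, cPairing_Q_left, Q_coe] at h2
  · intro ha
    refine LinearMap.BilinForm.mem_orthogonal_iff.2 fun b hb => ?_
    -- An element of the kernel of the reduced anchor agrees modulo `ker π` with an element of `D`.
    -- As `ker π` and `D` are isotropic and `D` is orthogonal to the fibre, two such elements pair
    -- to zero.
    have key (c : S.Fib x) (hc : c ∈ LinearMap.ker (S.rAnchor x)) :
        ∃ d ∈ S.D x, C.cAnchor x (c - d) = 0 :=
      ⟨S.cσ x (C.cAnchor x c), S.cσ_mem_D (S.mem_T01_of_P10_eq_zero hc), by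
        rw [map_sub, cAnchor_cσ, sub_self]⟩
    obtain ⟨d, hd, hd0⟩ := key a ha
    obtain ⟨e, he, he0⟩ := key b hb
    have h1 := C.cAnchor_ker_isotropic he0 hd0
    have h2 : C.cPairing x e a = 0 := S.coe_mem_perp a e he
    have h3 : C.cPairing x d b = 0 := S.coe_mem_perp b d hd
    have h4 : C.cPairing x e d = 0 := S.D_le_perp_D x hd e he
    change S.rPairing x b a = 0
    rw [rPairing_apply]
    rw [cPairing_symm] at h3
    simpa [h2, h3, h4] using h1

end SplitPair

end ExactCourantAlgebroid

end GKGeom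

/-! ### Courant axioms for the reduced bracket -/

namespace GKGeom

namespace ExactCourantAlgebroid

namespace SplitPair

variable {V : Type u} [NormedAddCommGroup V] [NormedSpace ℝ V] [FiniteDimensional ℝ V]
  {M : Type v} [TopologicalSpace M] [ChartedSpace V M] [IsManifold 𝓘(ℝ, V) ∞ M]
  {F : Type*} [NormedAddCommGroup F] [NormedSpace ℝ F] [FiniteDimensional ℝ F]
  {E : M → Type w} [∀ x, AddCommGroup (E x)] [∀ x, Module ℝ (E x)]
  [TopologicalSpace (TotalSpace F E)] [∀ x, TopologicalSpace (E x)] [FiberBundle F E]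
  [VectorBundle ℝ F E] [ContMDiffVectorBundle ∞ F E 𝓘(ℝ, V)]
  {C : ExactCourantAlgebroid V F E} (S : C.SplitPair) {U : Set M} {x : M}

theorem isVF01_sub_P10 (hU : IsOpen U) {X : Π x : M, CT V x} (hX : SmoothCVF V X U) :
    IsVF01 S.J (fun x => X x - P10 S.J x (X x)) U :=
  ⟨SmoothCSec.sub hX (S.smoothCVF_P10 hU hX), fun _ _ => S.sub_P10_mem _⟩

/-- The `(0,1)`-part of `Y` contributes a bracket of type `(0,1)`, which `P10` kills. -/
theorem P10_cLie (hU : IsOpen U) {X Y : Π x : M, CT V x} (hX : IsVF01 S.J X U)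
    (hY : SmoothCVF V Y U) (hx : x ∈ U) :
    P10 S.J x (cLie V X (fun y => P10 S.J y (Y y)) x) = P10 S.J x (cLie V X Y x) := by
  have h := S.cLie_add_right hU hX.1 (S.smoothCVF_P10 hU hY) (S.isVF01_sub_P10 hU hY).1 hx
  simp only [add_sub_cancel] at h
  rw [h, map_add, S.P10_of_mem_T01 (S.cLie_mem_T01 hU hX (S.isVF01_sub_P10 hU hY) hx), add_zero]

theorem cderiv1_P10 {f : M → ℂ} (hf : ∀ X ∈ T01 S.J x, cderiv1 V f x X = 0) (X : CT V x) :
    cderiv1 V f x (P10 S.J x X) = cderiv1 V f x X := by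
  have h := cderiv1_add f x (P10 S.J x X) (X - P10 S.J x X)
  rw [add_sub_cancel, hf _ (S.sub_P10_mem X), add_zero] at h
  exact h.symm

theorem cPairing_Q_right (s : ℂ ⊗[ℝ] E x) (a : S.Fib x) :
    C.cPairing x (S.Q x s) a = C.cPairing x s a := by rw [cPairing_Q_left, Q_coe]

section Hol

variable {S} {a b c : Π x, ℂ ⊗[ℝ] E x}

/-- Lift `X` to a section `d` of `D`. The derivative is `⟨[d, a], b⟩ + ⟨a, [d, b]⟩`, in which both
brackets lie in `D` and both sections in `D^⊥`. -/
theorem HolLift.cderiv1_cPairing (ha : S.HolLift a U) (hb : S.HolLift b U) (hU : IsOpen U)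
    (hx : x ∈ U) {X : CT V x} (hX : X ∈ T01 S.J x) :
    cderiv1 V (fun y => C.cPairing y (a y) (b y)) x X = 0 := by
  obtain ⟨W, hW, hxW, d, hd, hdD, hdX⟩ := S.exists_section_D _ (S.cσ_mem_D hX)
  have hUW := hU.inter hW
  have h := C.cBracket_invariant hUW (hd.mono inter_subset_right)
    (ha.smooth.mono inter_subset_left) (hb.smooth.mono inter_subset_left) ⟨hx, hxW⟩
  have h1 := ha.bracket_mem _ hUW inter_subset_left d (hd.mono inter_subset_right)
    (fun y _ => hdD y) x ⟨hx, hxW⟩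
  have h2 := hb.bracket_mem _ hUW inter_subset_left d (hd.mono inter_subset_right)
    (fun y _ => hdD y) x ⟨hx, hxW⟩
  have h3 : C.cPairing x (C.cBracket d a x) (b x) = 0 := hb.mem x hx _ h1
  have h4 : C.cPairing x (C.cBracket d b x) (a x) = 0 := ha.mem x hx _ h2
  rwa [hdX, cAnchor_cσ, h3, C.cPairing_symm x (a x), h4, add_zero] at h

theorem HolLift.P10_cLie_eq_zero (hb : S.HolLift b U) (hU : IsOpen U) {X : Π x : M, CT V x}
    (hX : IsVF01 S.J X U) (hx : x ∈ U) :
    P10 S.J x (cLie V X (fun y => C.cAnchor y (b y)) x) = 0 := by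
  have h := C.cAnchor_cBracket hU (hX.smooth_cσ hU) hb.smooth hx
  simp only [cAnchor_cσ] at h
  rw [← h]
  exact S.P10_of_mem_T01 (S.cAnchor_mem_T01
    (hb.bracket_mem U hU subset_rfl _ (hX.smooth_cσ hU) hX.cσ_mem x hx))

/-- Split both anchors by type. Brackets with a `(0,1)`-part have no `(1,0)`-component because the
lifts are holomorphic, and the bracket of the `(1,0)`-parts is already of type `(1,0)` by
integrability. -/
theorem HolLift.P10_cAnchor_cBracket (ha : S.HolLift a U) (hb : S.HolLift b U) (hU : IsOpen U)
    (hx : x ∈ U) : P10 S.J x (C.cAnchor x (C.cBracket a b x)) =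
      cLie V (fun y => P10 S.J y (C.cAnchor y (a y)))
        (fun y => P10 S.J y (C.cAnchor y (b y))) x := by
  have hπa := C.smoothCVF_cAnchor hU ha.smooth
  have hπb := C.smoothCVF_cAnchor hU hb.smooth
  have hPa := S.smoothCVF_P10 hU hπa
  have hPb := S.smoothCVF_P10 hU hπb
  have h1 := S.cLie_add_left hU hPa (S.isVF01_sub_P10 hU hπa).1 hπb hx
  have h2 := S.cLie_add_right hU hPa hPb (S.isVF01_sub_P10 hU hπb).1 hx
  simp only [add_sub_cancel] at h1 h2
  have h3 := hb.P10_cLie_eq_zero hU (S.isVF01_sub_P10 hU hπa) hx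
  have h4 := ha.P10_cLie_eq_zero hU (S.isVF01_sub_P10 hU hπb) hx
  -- The full anchor of `a` is replaced by its `(1,0)`-part, which is what remains after the first
  -- splitting.
  rw [← S.P10_cLie hU (S.isVF01_sub_P10 hU hπb) hπa hx] at h4
  rw [C.cAnchor_cBracket hU ha.smooth hb.smooth hx, h1, map_add, h3, add_zero, h2, map_add,
    cLie_swap (fun y => P10 S.J y (C.cAnchor y (a y))) (fun y => _ - _), map_neg, h4, neg_zero,
    add_zero]
  exact S.P10_of_mem_T10 (S.isComplexStructure_J.integrable U hU _ _ hPa hPb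
    (fun y _ => S.P10_mem _) (fun y _ => S.P10_mem _) x hx)

end Hol

section Fields

variable {s t r : Π x, S.Fib x} {X : Π x : M, CT V x}

theorem cderiv1_rPairing (hU : IsOpen U) (hX : IsVF01 S.J X U)
    (hs : SmoothCSec V F (fun x => (s x : ℂ ⊗[ℝ] E x)) U)
    (ht : SmoothCSec V F (fun x => (t x : ℂ ⊗[ℝ] E x)) U) (hx : x ∈ U) :
    cderiv1 V (fun y => S.rPairing y (s y) (t y)) x (X x) =
      S.rPairing x (S.dbar X s x) (t x) + S.rPairing x (s x) (S.dbar X t x) := by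
  have h := C.cBracket_invariant hU (hX.smooth_cσ hU) hs ht hx
  rw [cAnchor_cσ] at h
  simp only [rPairing_apply, dbar, coe_q, cPairing_Q_right]
  rw [h, ← cPairing_Q_left, Q_coe]

theorem rAnchor_dbar (hU : IsOpen U) (hX : IsVF01 S.J X U)
    (hs : SmoothCSec V F (fun x => (s x : ℂ ⊗[ℝ] E x)) U) (hx : x ∈ U) :
    S.rAnchor x (S.dbar X s x) = P10 S.J x (cLie V X (fun y => S.rAnchor y (s y)) x) := by
  simp only [rAnchor_apply]
  rw [S.P10_cLie hU hX (C.smoothCVF_cAnchor hU hs) hx, dbar, coe_q, P10_cAnchor_Q,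
    C.cAnchor_cBracket hU (hX.smooth_cσ hU) hs hx]
  · simp only [cAnchor_cσ]
  · exact S.cBracket_D_mem_perp hU (hX.smooth_cσ hU) hs hX.cσ_mem
      (fun y _ => S.coe_mem_perp _) hx

theorem isHol_rBracket (hU : IsOpen U) (hs : S.holBundle.IsHol s U) (ht : S.holBundle.IsHol t U) :
    S.holBundle.IsHol (S.rBracket s t) U := by
  rw [isHol_iff] at hs ht ⊢
  exact (hs.cBracket ht hU).Q hU

/-- The inner projections can be removed since all entries are holomorphic lifts; what is left is
`Q` of the Jacobi identity upstairs. -/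
theorem rBracket_jacobi (hU : IsOpen U) (hr : S.holBundle.IsHol r U) (hs : S.holBundle.IsHol s U)
    (ht : S.holBundle.IsHol t U) (hx : x ∈ U) : S.rBracket r (S.rBracket s t) x =
      S.rBracket (S.rBracket r s) t x + S.rBracket s (S.rBracket r t) x := by
  rw [isHol_iff] at hr hs ht
  have h1 := hr.Q_cBracket_Q_right hU (hs.cBracket ht hU).smooth (hs.cBracket ht hU).mem hx
  have h2 := hs.Q_cBracket_Q_right hU (hr.cBracket ht hU).smooth (hr.cBracket ht hU).mem hx
  have h3 := ht.Q_cBracket_Q_left hU (hr.cBracket hs hU).smooth (hr.cBracket hs hU).mem hx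
  refine Subtype.ext ?_
  refine h1.trans ((congrArg (S.Q x)
    (C.cBracket_jacobi hU hr.smooth hs.smooth ht.smooth hx)).trans ?_)
  rw [map_add, ← h2, ← h3]
  rfl

theorem rAnchor_rBracket (hU : IsOpen U) (hs : S.holBundle.IsHol s U)
    (ht : S.holBundle.IsHol t U) (hx : x ∈ U) : S.rAnchor x (S.rBracket s t x) =
      cLie V (fun y => S.rAnchor y (s y)) (fun y => S.rAnchor y (t y)) x := by
  rw [isHol_iff] at hs ht
  rw [rAnchor_apply, rBracket, coe_q, S.P10_cAnchor_Q ((hs.cBracket ht hU).mem x hx)]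
  exact hs.P10_cAnchor_cBracket ht hU hx

theorem rBracket_leibniz (hU : IsOpen U) {f : M → ℂ} (hf : IsHolFun S.J f U)
    (hs : S.holBundle.IsHol s U) (ht : S.holBundle.IsHol t U) (hx : x ∈ U) :
    S.rBracket s (fun y => f y • t y) x =
      f x • S.rBracket s t x + cderiv1 V f x (S.rAnchor x (s x)) • t x := by
  rw [isHol_iff] at hs ht
  rw [rAnchor_apply, S.cderiv1_P10 (hf.2 x hx)]
  simp only [rBracket, Submodule.coe_smul]
  rw [C.cBracket_leibniz hU hf.1 hs.smooth ht.smooth hx]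
  exact Subtype.ext (by simp)

theorem rBracket_invariant (hU : IsOpen U) (hr : S.holBundle.IsHol r U)
    (hs : S.holBundle.IsHol s U) (ht : S.holBundle.IsHol t U) (hx : x ∈ U) :
    cderiv1 V (fun y => S.rPairing y (s y) (t y)) x (S.rAnchor x (r x)) =
      S.rPairing x (S.rBracket r s x) (t x) + S.rPairing x (s x) (S.rBracket r t x) := by
  rw [isHol_iff] at hr hs ht
  simp only [rPairing_apply, rBracket, coe_q, cPairing_Q_right, rAnchor_apply]
  rw [S.cderiv1_P10 fun X hX => hs.cderiv1_cPairing ht hU hx hX,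
    C.cBracket_invariant hU hr.smooth hs.smooth ht.smooth hx, ← cPairing_Q_left, Q_coe]

theorem rBracket_symm_part (hU : IsOpen U) (hs : S.holBundle.IsHol s U)
    (ht : S.holBundle.IsHol t U) (hx : x ∈ U) (z : S.Fib x) :
    S.rPairing x (S.rBracket s t x + S.rBracket t s x) z =
      cderiv1 V (fun y => S.rPairing y (s y) (t y)) x (S.rAnchor x z) := by
  rw [isHol_iff] at hs ht
  simp only [rPairing_apply, rBracket, Submodule.coe_add, coe_q, rAnchor_apply]
  rw [S.cderiv1_P10 fun X hX => hs.cderiv1_cPairing ht hU hx hX,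
    ← C.cBracket_symm_part hU hs.smooth ht.smooth hx, ← map_add, cPairing_Q_right]

theorem rBracket_add_left (hU : IsOpen U) (hr : S.holBundle.IsHol r U)
    (hs : S.holBundle.IsHol s U) (ht : S.holBundle.IsHol t U) (hx : x ∈ U) :
    S.rBracket (fun y => r y + s y) t x = S.rBracket r t x + S.rBracket s t x := by
  rw [isHol_iff] at hr hs ht
  simp only [rBracket, Submodule.coe_add]
  rw [C.cBracket_add_left hU hr.smooth hs.smooth ht.smooth hx, map_add]

theorem rBracket_add_right (hU : IsOpen U) (hr : S.holBundle.IsHol r U)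
    (hs : S.holBundle.IsHol s U) (ht : S.holBundle.IsHol t U) (hx : x ∈ U) :
    S.rBracket r (fun y => s y + t y) x = S.rBracket r s x + S.rBracket r t x := by
  rw [isHol_iff] at hr hs ht
  simp only [rBracket, Submodule.coe_add]
  rw [C.cBracket_add_right hU hr.smooth hs.smooth ht.smooth hx, map_add]

theorem rBracket_smul_left (hU : IsOpen U) (c : ℂ) (hs : S.holBundle.IsHol s U)
    (ht : S.holBundle.IsHol t U) (hx : x ∈ U) :
    S.rBracket (fun y => c • s y) t x = c • S.rBracket s t x := by
  rw [isHol_iff] at hs ht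
  simp only [rBracket, Submodule.coe_smul]
  rw [C.cBracket_smul_left hU c hs.smooth ht.smooth hx, map_smul]

theorem rBracket_congr (hU : IsOpen U) {s' t' : Π x, S.Fib x} (hs : S.holBundle.IsHol s U)
    (ht : S.holBundle.IsHol t U) (es : ∀ x ∈ U, s x = s' x) (et : ∀ x ∈ U, t x = t' x)
    (hx : x ∈ U) : S.rBracket s t x = S.rBracket s' t' x := by
  rw [isHol_iff] at hs ht
  exact congrArg (S.q x) (C.cBracket_congr hU hs.smooth ht.smooth
    (fun y hy => by rw [es y hy]) (fun y hy => by rw [et y hy]) hx)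

end Fields

/-- The reduction as a holomorphic Courant algebroid. -/
def holCourant : HolCourantAlgebroid.{u, v, w} S.J where
  toHolVectorBundle := S.holBundle
  pairing := S.rPairing
  pairing_symm x _ _ := C.cPairing_symm x _ _
  pairing_nondeg _ a h := S.rPairing_nondeg a h
  pairing_smooth _ hU _ _ hs ht := C.smoothCFun_cPairing hU hs ht
  pairing_holomorphic _ hU _ _ _ hX hs ht _ hx := S.cderiv1_rPairing hU hX hs ht hx
  anchor := S.rAnchor
  anchor_range := S.range_rAnchor
  anchor_ker := S.orthogonal_ker_rAnchor
  anchor_smooth _ hU _ hs := S.smoothCVF_P10 hU (C.smoothCVF_cAnchor hU hs)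
  anchor_holomorphic _ hU _ _ hX hs _ hx := S.rAnchor_dbar hU hX hs hx
  bracket := S.rBracket
  bracket_congr _ hU _ _ _ _ ha hb ea eb _ hx := S.rBracket_congr hU ha hb ea eb hx
  bracket_hol _ hU _ _ ha hb := S.isHol_rBracket hU ha hb
  bracket_add_left _ hU _ _ _ ha ha' hb _ hx := S.rBracket_add_left hU ha ha' hb hx
  bracket_add_right _ hU _ _ _ ha hb hb' _ hx := S.rBracket_add_right hU ha hb hb' hx
  bracket_smul_left _ hU c _ _ ha hb _ hx := S.rBracket_smul_left hU c ha hb hx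
  bracket_leibniz _ hU _ _ _ hf ha hb _ hx := S.rBracket_leibniz hU hf ha hb hx
  bracket_jacobi _ hU _ _ _ ha hb hc _ hx := S.rBracket_jacobi hU ha hb hc hx
  anchor_bracket _ hU _ _ ha hb _ hx := S.rAnchor_rBracket hU ha hb hx
  bracket_invariant _ hU _ _ _ ha hb hc _ hx := S.rBracket_invariant hU ha hb hc hx
  bracket_symm_part _ hU _ _ ha hb _ hx z := S.rBracket_symm_part hU ha hb hx z

theorem dbar_q (hU : IsOpen U) {d a : Π x, ℂ ⊗[ℝ] E x} (hd : SmoothCSec V F d U)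
    (ha : SmoothCSec V F a U) (hdD : ∀ y, d y ∈ S.D y) (haD : ∀ y, a y ∈ C.perp S.D y)
    (hx : x ∈ U) : S.dbar (fun y => C.cAnchor y (d y)) (fun y => S.q y (a y)) x =
      S.q x (C.cBracket d a x) := by
  simp only [dbar, S.cσ_cAnchor_of_mem_D (hdD _), coe_q]
  exact Subtype.ext (S.Q_cBracket_Q hU hd ha (fun y _ => hdD y) (fun y _ => haD y) hx)

theorem holLift_of_isHol_q {a : Π x, ℂ ⊗[ℝ] E x} (ha : SmoothCSec V F a U)
    (haD : ∀ y, a y ∈ C.perp S.D y) (h : S.holBundle.IsHol (fun y => S.q y (a y)) U) :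
    S.HolLift a U := by
  rw [isHol_iff] at h
  exact HolLift.of_Q h ha fun y _ => haD y

/-- Replacing both lifts by their images under `Q`, one at a time, changes the bracket only by
elements of `D`. -/
theorem rBracket_q (hU : IsOpen U) {a b : Π x, ℂ ⊗[ℝ] E x} (ha : S.HolLift a U)
    (hb : S.HolLift b U) (hx : x ∈ U) :
    S.rBracket (fun y => S.q y (a y)) (fun y => S.q y (b y)) x = S.q x (C.cBracket a b x) :=
  Subtype.ext (((ha.Q hU).Q_cBracket_Q_right hU hb.smooth hb.mem hx).trans
    (hb.Q_cBracket_Q_left hU ha.smooth ha.mem hx))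

/-- The reduction of the Courant algebroid by `D`. -/
def reduction : C.Reduction S.J S.D where
  𝓔 := S.holCourant
  q x := S.q x ∘ₗ (C.perp S.D x).subtype
  q_surjective x := fun a : S.Fib x => ⟨⟨a, S.coe_mem_perp a⟩, Subtype.ext (S.Q_coe a)⟩
  q_eq_zero_iff x a := by
    constructor
    · intro h
      have h1 : S.Q x a = 0 := congrArg Subtype.val h
      have h2 := S.sub_Q_mem a.2
      rwa [h1, sub_zero] at h2
    · exact fun h => Subtype.ext (S.Q_of_mem_D h)
  smooth_iff U hU s := by
    constructor
    · intro h x hx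
      exact ⟨U, hU, hx, fun y => ⟨_, S.coe_mem_perp (s y)⟩, h, fun y _ =>
        Subtype.ext (S.Q_coe (s y))⟩
    · intro h
      refine smoothCSec_of_locally fun x hx => ?_
      obtain ⟨W, hW, hxW, a, ha, has⟩ := h x hx
      exact ⟨W, hW, hxW, (S.smoothOp_Q W hW _ ha).congr fun y hy =>
        (congrArg Subtype.val (has y hy)).symm⟩
  pairing_eq x a b := S.cPairing_eq_of_mem_perp a.2 b.2
  anchor_eq x a := S.P10_cAnchor_Q a.2
  dbar_eq U hU d a hd ha x hx := ⟨⟨_, S.cBracket_D_mem_perp hU hd ha (fun y _ => (d y).2)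
    (fun y _ => (a y).2) hx⟩, rfl, S.dbar_q hU hd ha (fun y => (d y).2) (fun y => (a y).2) hx⟩
  bracket_eq U hU a b ha hb hha hhb x hx :=
    have ha' := S.holLift_of_isHol_q ha (fun y => (a y).2) hha
    have hb' := S.holLift_of_isHol_q hb (fun y => (b y).2) hhb
    ⟨⟨_, (ha'.cBracket hb' hU).mem x hx⟩, rfl, S.rBracket_q hU ha' hb' hx⟩

end SplitPair

end ExactCourantAlgebroid

end GKGeom

namespace GKGeom

namespace ExactCourantAlgebroid

variable {V : Type u} [NormedAddCommGroup V] [NormedSpace ℝ V]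
  {M : Type v} [TopologicalSpace M] [ChartedSpace V M] [IsManifold 𝓘(ℝ, V) ∞ M]
  {F : Type*} [NormedAddCommGroup F] [NormedSpace ℝ F]
  {E : M → Type w} [∀ x, AddCommGroup (E x)] [∀ x, Module ℝ (E x)]
  [TopologicalSpace (TotalSpace F E)] [∀ x, TopologicalSpace (E x)] [FiberBundle F E]
  {C : ExactCourantAlgebroid V F E}

/-! ### Reductions of Dirac structures -/

namespace Reduction

variable {J : TEnd V M} {D L : Π x, Submodule ℂ (ℂ ⊗[ℝ] E x)} (R : C.Reduction J D)
  {U W : Set M} {x : M}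

theorem isSmooth_of_eqOn {s t : Π x, R.𝓔.Fiber x} (hU : IsOpen U) (hW : IsOpen W) (hWU : W ⊆ U)
    (hs : R.𝓔.IsSmooth s U) (h : ∀ y ∈ W, s y = t y) : R.𝓔.IsSmooth t W := by
  rw [R.smooth_iff _ hW]
  intro x hx
  obtain ⟨W', hW', hxW', a, ha, has⟩ := (R.smooth_iff _ hU s).1 hs x (hWU hx)
  exact ⟨W' ∩ W, hW'.inter hW, ⟨hxW', hx⟩, a, ha.mono inter_subset_left, fun y hy => by
    rw [has y hy.1, h y hy.2]⟩

theorem isHol_of_eqOn {s t : Π x, R.𝓔.Fiber x} (hU : IsOpen U) (hW : IsOpen W) (hWU : W ⊆ U)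
    (hs : R.𝓔.toHolVectorBundle.IsHol s U) (h : ∀ y ∈ W, s y = t y) :
    R.𝓔.toHolVectorBundle.IsHol t W := by
  refine ⟨R.isSmooth_of_eqOn hU hW hWU hs.1 h, fun W' hW' hWW' X hX x hx => ?_⟩
  rw [← hs.2 W' hW' (hWW'.trans hWU) X hX x hx]
  exact (R.𝓔.dbar_congr W' hW' X X s t hX (R.isSmooth_of_eqOn hU hW' (hWW'.trans hWU) hs.1
    fun _ _ => rfl) (fun _ _ => rfl) (fun y hy => h y (hWW' hy)) x hx).symm

/-- The fibres of the quotient map are cosets of `D`, and `L` is saturated as it contains `D`. -/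
theorem q_mem_reduce (hDL : D x ≤ L x) (a : C.perp D x) :
    R.q x a ∈ R.reduce L x ↔ (a : ℂ ⊗[ℝ] E x) ∈ L x := by
  constructor
  · rintro ⟨b, hb, hab⟩
    have h : R.q x (b - a) = 0 := by rw [map_sub, hab, sub_self]
    have h1 := hDL ((R.q_eq_zero_iff x _).1 h)
    have h2 := Submodule.sub_mem _ (show (b : ℂ ⊗[ℝ] E x) ∈ L x from hb) h1
    simpa using h2
  · exact fun h => ⟨a, h, rfl⟩

end Reduction

/-- From `D ⊂ L` one gets `L = L^⊥ ⊂ D^⊥`. -/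
theorem IsDirac.le_perp {L D : Π x, Submodule ℂ (ℂ ⊗[ℝ] E x)} (hL : C.IsDirac L) {x : M}
    (h : D x ≤ L x) : L x ≤ C.perp D x := by
  intro s hs d hd
  rw [← hL.maximal_isotropic] at hs
  exact hs d (h hd)

theorem IsDirac.isReducible [VectorBundle ℝ F E] [FiniteDimensional ℝ F]
    {L D : Π x, Submodule ℂ (ℂ ⊗[ℝ] E x)} (hL : C.IsDirac L) (h : ∀ x, D x ≤ L x) :
    C.IsReducible D L where
  dirac := hL
  constant_rank := by
    -- Here `L ∩ D^⊥ = L`, and a subspace equal to its orthogonal complement has half the total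
    -- dimension.
    refine ⟨Module.finrank ℝ F / 2, fun x => ?_⟩
    have : FiniteDimensional ℝ (E x) := finiteDimensional_fiber F x
    rw [inf_eq_left.2 (hL.le_perp (h x))]
    have hr : (C.cPairing x).IsRefl := fun s t h => by rw [cPairing_symm]; exact h
    have hn : (C.cPairing x).Nondegenerate :=
      hr.nondegenerate_iff_separatingLeft.2 fun s h => C.cPairing_nondeg x s h
    have h1 := LinearMap.BilinForm.finrank_orthogonal hn (L x)
    have h2 : (C.cPairing x).orthogonal (L x) = L x := hL.maximal_isotropic x
    have h3 := Submodule.finrank_le (L x)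
    rw [h2, Module.finrank_baseChange, finrank_fiber F] at h1
    rw [Module.finrank_baseChange, finrank_fiber F] at h3
    omega
  invariant U hU s t hs ht hsD htL := hL.involutive U hU s t hs ht (fun x hx => h x (hsD x hx)) htL

/-! ### Holomorphic Dirac structures and transversality -/

namespace SplitPair

variable [FiniteDimensional ℝ V] [FiniteDimensional ℝ F] [VectorBundle ℝ F E]
  [ContMDiffVectorBundle ∞ F E 𝓘(ℝ, V)] (S : C.SplitPair)
  {L : Π x, Submodule ℂ (ℂ ⊗[ℝ] E x)} (R : C.Reduction S.J S.D)

/-- A Dirac structure which contains `D`, with a smooth projection to a complement of `D`, reduces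
to a holomorphic Dirac structure. -/
theorem isHolDirac_reduce (hL : C.IsDirac L) (hDL : ∀ x, S.D x ≤ L x)
    {P : Π x, ℂ ⊗[ℝ] E x →ₗ[ℂ] ℂ ⊗[ℝ] E x} (hP : SmoothOp V F P)
    (hPP : ∀ x s, P x (P x s) = P x s) (hPL : ∀ x s, P x s ∈ L x)
    (hLP : ∀ x, ∀ s ∈ L x, s - P x s ∈ S.D x) (hPD : ∀ x, ∀ s ∈ S.D x, P x s = 0) :
    R.𝓔.IsHolDirac (R.reduce L) where
  subbundle x₀ := by
    obtain ⟨U, hU, hx, n, e, he, hPe, hs, -⟩ := exists_frame_range hP hPP x₀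
    have heL (i y) : e i y ∈ L y := hPe i y ▸ hPL y _
    have hep (i y) : e i y ∈ C.perp S.D y := hL.le_perp (hDL y) (heL i y)
    refine ⟨U, hU, hx, n, fun i y => R.q y ⟨e i y, hep i y⟩, fun i => ?_, fun y hy => ⟨?_, ?_⟩⟩
    · exact (R.smooth_iff U hU _).2 fun x hx =>
        ⟨U, hU, hx, fun y => ⟨e i y, hep i y⟩, he i, fun _ _ => rfl⟩
    · refine Fintype.linearIndependent_iff.2 fun g hg => ?_
      have h1 : R.q y (∑ i, g i • ⟨e i y, hep i y⟩) = 0 := by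
        rw [map_sum]; simp only [map_smul]; exact hg
      have h2 := hPD y _ ((R.q_eq_zero_iff y _).1 h1)
      -- A relation in the quotient puts the combination in `D`. Since `P` kills `D` but fixes each
      -- `e i`, the relation already holds upstairs.
      exact Fintype.linearIndependent_iff.1 (hs y hy).1 g (by simpa [hPe] using h2)
    · refine le_antisymm (Submodule.span_le.2 ?_) ?_
      · rintro _ ⟨i, rfl⟩
        exact (R.q_mem_reduce (hDL y) _).2 (heL i y)
      · rintro _ ⟨a, ha, rfl⟩
        have h1 : P y a ∈ Submodule.span ℂ (range fun i => e i y) := by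
          rw [(hs y hy).2]; exact ⟨_, rfl⟩
        obtain ⟨g, hg⟩ := (Submodule.mem_span_range_iff_exists_fun ℂ).1 h1
        have h2 : R.q y (a - ∑ i, g i • ⟨e i y, hep i y⟩) = 0 := by
          rw [R.q_eq_zero_iff]
          simpa [hg] using hLP y a ha
        rw [map_sub, sub_eq_zero] at h2
        rw [h2, map_sum]
        simp only [map_smul]
        exact Submodule.sum_mem _ fun i _ => Submodule.smul_mem _ _ (Submodule.subset_span ⟨i, rfl⟩)
  dbar_mem U hU X s hX hs hsA x hx := by
    obtain ⟨W', hW', hxW', a, ha, has⟩ := (R.smooth_iff U hU s).1 hs x hx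
    have hW := hW'.inter hU
    have hXW : IsVF01 S.J X (W' ∩ U) :=
      ⟨SmoothCSec.mono hX.1 inter_subset_right, fun y hy => hX.2 y hy.2⟩
    -- The lift must lie in `D` at every point, whereas `X` is of type `(0,1)` only on `U`; `PD`
    -- enforces this and changes nothing over `W' ∩ U`.
    let d (y : M) : S.D y := ⟨S.PD y (S.cσ y (X y)), S.PD_mem _⟩
    have hd : SmoothCSec V F (fun y => (d y : ℂ ⊗[ℝ] E y)) (W' ∩ U) :=
      S.smoothOp_PD _ hW _ (hXW.smooth_cσ hW)
    have hdX (y) (hy : y ∈ W' ∩ U) : X y = C.cAnchor y (d y) := by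
      simp only [d]
      rw [S.PD_of_mem_D (hXW.cσ_mem y hy), cAnchor_cσ]
    have ha' := ha.mono (inter_subset_left (t := U))
    obtain ⟨c, hc, hcd⟩ := R.dbar_eq _ hW d a hd ha' x ⟨hxW', hx⟩
    rw [R.𝓔.dbar_congr _ hW X _ s _ hXW (R.isSmooth_of_eqOn hU hW inter_subset_right hs
      fun _ _ => rfl) hdX (fun y hy => (has y hy.1).symm) x ⟨hxW', hx⟩, hcd,
      R.q_mem_reduce (hDL x), hc]
    -- As `D ⊂ L`, invariance under `D` is a case of involutivity of `L`.
    refine hL.involutive _ hW _ _ hd ha' (fun y _ => hDL y (d y).2) (fun y hy => ?_) x ⟨hxW', hx⟩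
    rw [← R.q_mem_reduce (hDL y), has y hy.1]
    exact hsA y hy.2
  maximal_isotropic x := by
    ext z
    obtain ⟨a, rfl⟩ := R.q_surjective x z
    rw [R.q_mem_reduce (hDL x), ← hL.maximal_isotropic, LinearMap.BilinForm.mem_orthogonal_iff,
      mem_perp]
    constructor
    · intro h l hl
      have h1 : R.𝓔.pairing x (R.q x ⟨l, hL.le_perp (hDL x) hl⟩) (R.q x a) = 0 :=
        h _ ((R.q_mem_reduce (hDL x) _).2 hl)
      rwa [R.pairing_eq] at h1
    · intro h z hz
      obtain ⟨l, hl, rfl⟩ := hz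
      change R.𝓔.pairing x (R.q x l) (R.q x a) = 0
      rw [R.pairing_eq]
      exact h l hl
  involutive U hU s t hs ht hsA htA x hx := by
    obtain ⟨W, hW, hxW, a, ha, has⟩ := (R.smooth_iff U hU s).1 hs.1 x hx
    obtain ⟨W', hW', hxW', b, hb, hbt⟩ := (R.smooth_iff U hU t).1 ht.1 x hx
    have hO := (hW.inter hW').inter hU
    have hxO : x ∈ (W ∩ W') ∩ U := ⟨⟨hxW, hxW'⟩, hx⟩
    have hOU : (W ∩ W') ∩ U ⊆ U := inter_subset_right
    have ha' := ha.mono fun y (hy : y ∈ (W ∩ W') ∩ U) => hy.1.1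
    have hb' := hb.mono fun y (hy : y ∈ (W ∩ W') ∩ U) => hy.1.2
    have ea (y) (hy : y ∈ (W ∩ W') ∩ U) : s y = R.q y (a y) := (has y hy.1.1).symm
    have eb (y) (hy : y ∈ (W ∩ W') ∩ U) : t y = R.q y (b y) := (hbt y hy.1.2).symm
    obtain ⟨c, hc, hcd⟩ := R.bracket_eq _ hO a b ha' hb' (R.isHol_of_eqOn hU hO hOU hs ea)
      (R.isHol_of_eqOn hU hO hOU ht eb) x hxO
    rw [R.𝓔.bracket_congr _ hO s _ t _ (R.isHol_of_eqOn hU hO hOU hs fun _ _ => rfl)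
      (R.isHol_of_eqOn hU hO hOU ht fun _ _ => rfl) ea eb x hxO, hcd, R.q_mem_reduce (hDL x), hc]
    refine hL.involutive _ hO _ _ ha' hb' (fun y hy => ?_) (fun y hy => ?_) x hxO
    · rw [← R.q_mem_reduce (hDL y), ← ea y hy]
      exact hsA y hy.2
    · rw [← R.q_mem_reduce (hDL y), ← eb y hy]
      exact htA y hy.2

theorem isHolDirac_eigenbundle {𝒥 : Π x, E x →ₗ[ℝ] E x} (h : C.IsGenComplex 𝒥)
    (hD : ∀ x, S.D x ≤ eigenbundle 𝒥 (-Complex.I) x)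
    (hQ : ∀ x s, S.Q x ((𝒥 x).baseChange ℂ s) = (𝒥 x).baseChange ℂ (S.Q x s)) :
    R.𝓔.IsHolDirac (R.reduce (eigenbundle 𝒥 (-Complex.I))) := by
  -- The projection `Q` followed by the projection to the `-i`-eigenbundle. It maps onto the part of
  -- that eigenbundle inside the range of `Q`, a complement of `D` in it.
  let P (x : M) : ℂ ⊗[ℝ] E x →ₗ[ℂ] ℂ ⊗[ℝ] E x :=
    (1 / 2 : ℂ) • (S.Q x + Complex.I • (𝒥 x).baseChange ℂ ∘ₗ S.Q x)
  have hPL (x) (s) : P x s ∈ eigenbundle 𝒥 (-Complex.I) x :=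
    Submodule.smul_mem _ _ (h.eigenproj_mem x (S.Q x s))
  have hPQ (x) (s) (hs : s ∈ eigenbundle 𝒥 (-Complex.I) x) : P x s = S.Q x s := by
    simp only [P, LinearMap.smul_apply, LinearMap.add_apply, LinearMap.comp_apply, ← hQ,
      mem_eigenbundle.1 hs, map_smul, smul_smul, mul_neg, Complex.I_mul_I]
    module
  have hQP (x) (s) : S.Q x (P x s) = P x s := by
    simp [P, hQ, Q_Q]
  have hP : SmoothOp V F P := fun U hU s hs =>
    have h1 := S.smoothOp_Q U hU s hs
    (h1.add ((h.smoothOp U hU _ h1).const_smul _)).const_smul _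
  refine S.isHolDirac_reduce R h.isDirac hD hP (fun x s => ?_) hPL (fun x s hs => ?_)
    fun x s hs => ?_
  · rw [hPQ x _ (hPL x s), hQP]
  · rw [hPQ x s hs]
    exact S.sub_Q_mem (h.isDirac.le_perp (hD x) hs)
  · simp [P, S.Q_of_mem_D hs]

theorem isCompl_reduce (x : M) : IsCompl (R.reduce (eigenbundle S.Jp (-Complex.I)) x)
    (R.reduce (eigenbundle S.Jm (-Complex.I)) x) := by
  have hDp : S.D x ≤ eigenbundle S.Jp (-Complex.I) x := inf_le_left
  have hDm : S.D x ≤ eigenbundle S.Jm (-Complex.I) x := inf_le_right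
  refine ⟨Submodule.disjoint_def.2 fun z hz hz' => ?_,
    codisjoint_iff.2 (eq_top_iff.2 fun z _ => ?_)⟩
  · obtain ⟨a, rfl⟩ := R.q_surjective x z
    rw [R.q_mem_reduce hDp] at hz
    rw [R.q_mem_reduce hDm] at hz'
    exact (R.q_eq_zero_iff x a).2 ⟨hz, hz'⟩
  · obtain ⟨a, rfl⟩ := R.q_surjective x z
    set b := S.Q x a with hb
    have hbQ : S.jp x (S.jm x b) = b := S.jp_jm_Q _
    -- On the range of `Q` the structures differ by a sign, so one vector yields eigenvectors of
    -- both from `b ± i Jp b`.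
    have hbj : S.jm x b = - S.jp x b := by
      have h := congrArg (S.jp x) hbQ
      rw [jp_jp] at h
      rw [← h, neg_neg]
    have h1 : b + Complex.I • S.jp x b ∈ eigenbundle S.Jp (-Complex.I) x :=
      S.isGenComplex_p.eigenproj_mem x b
    have h2 : b - Complex.I • S.jp x b ∈ eigenbundle S.Jm (-Complex.I) x := by
      have h := S.isGenComplex_m.eigenproj_mem x b
      change b + Complex.I • S.jm x b ∈ _ at h
      rwa [hbj, smul_neg, ← sub_eq_add_neg] at h
    have h3 : (a : ℂ ⊗[ℝ] E x) - b ∈ S.D x := S.sub_Q_mem a.2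
    have h1' := S.isGenComplex_p.isDirac.le_perp hDp h1
    have h2' := S.isGenComplex_m.isDirac.le_perp hDm h2
    -- The two halves add up to `b = Q a`, which represents the same class as `a`.
    refine Submodule.mem_sup.2 ⟨R.q x ((1 / 2 : ℂ) • ⟨_, h1'⟩), ?_, R.q x ((1 / 2 : ℂ) • ⟨_, h2'⟩),
      ?_, ?_⟩
    · exact (R.q_mem_reduce hDp _).2 (Submodule.smul_mem _ _ h1)
    · exact (R.q_mem_reduce hDm _).2 (Submodule.smul_mem _ _ h2)
    · rw [← map_add, ← sub_eq_zero, ← map_sub, R.q_eq_zero_iff]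
      convert Submodule.neg_mem _ h3 using 1
      simp only [Submodule.coe_sub, Submodule.coe_add, Submodule.coe_smul]
      module

theorem Q_jp (x : M) (s : ℂ ⊗[ℝ] E x) : S.Q x (S.jp x s) = S.jp x (S.Q x s) := by
  simp only [Q_apply, map_smul, map_add, jm_jp]

theorem Q_jm (x : M) (s : ℂ ⊗[ℝ] E x) : S.Q x (S.jm x s) = S.jm x (S.Q x s) := by
  simp only [Q_apply, map_smul, map_add, jm_jp]

/-- The reduction theorem for a split pair. -/
theorem reduction_theorem :
    IsComplexStructure S.J ∧ C.IsLifting S.J S.D ∧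
      C.IsReducible S.D (eigenbundle S.Jp (-Complex.I)) ∧
      C.IsReducible S.D (eigenbundle S.Jm (-Complex.I)) ∧
      Nonempty (C.Reduction S.J S.D) ∧
      ∀ R : C.Reduction S.J S.D,
        R.𝓔.IsHolDirac (R.reduce (eigenbundle S.Jp (-Complex.I))) ∧
        R.𝓔.IsHolDirac (R.reduce (eigenbundle S.Jm (-Complex.I))) ∧
        ∀ x, IsCompl (R.reduce (eigenbundle S.Jp (-Complex.I)) x)
          (R.reduce (eigenbundle S.Jm (-Complex.I)) x) :=
  ⟨S.isComplexStructure_J, S.isLifting_D,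
    S.isGenComplex_p.isDirac.isReducible fun _ => inf_le_left,
    S.isGenComplex_m.isDirac.isReducible fun _ => inf_le_right, ⟨S.reduction⟩, fun R =>
    ⟨S.isHolDirac_eigenbundle R S.isGenComplex_p (fun _ => inf_le_left) S.Q_jp,
      S.isHolDirac_eigenbundle R S.isGenComplex_m (fun _ => inf_le_right) S.Q_jm,
      S.isCompl_reduce R⟩⟩

/-- The split pair with the sign of the second structure changed. -/
def swap : C.SplitPair where
  Jp := S.Jp
  Jm x := - S.Jm x
  isGenComplex_p := S.isGenComplex_p
  isGenComplex_m := S.isGenComplex_m.neg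
  comm x a := by simp [S.comm]
  σ := S.τ
  τ := S.σ
  anchor_σ := S.anchor_τ
  anchor_τ := S.anchor_σ
  JpJm_σ x a := by simp [S.JpJm_τ]
  JpJm_τ x a := by simp [S.JpJm_σ]
  σ_anchor x a h := S.τ_anchor x a (by simpa using h)
  τ_anchor x a h := S.σ_anchor x a (by rw [← neg_eq_iff_eq_neg]; simpa using h)

end SplitPair

/-- The split pair of a generalized Kähler structure. -/
def GenKahler.toSplitPair [FiniteDimensional ℝ V] [FiniteDimensional ℝ F] [VectorBundle ℝ F E]
    (K : C.GenKahler) : C.SplitPair where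
  Jp := K.Jp
  Jm := K.Jm
  isGenComplex_p := K.isGenComplex_p
  isGenComplex_m := K.isGenComplex_m
  comm := K.comm
  σ x := (K.Cplus x).subtype ∘ₗ (K.sPlus x).toLinearMap
  τ x := (K.Cminus x).subtype ∘ₗ (K.sMinus x).toLinearMap
  anchor_σ x a := (K.sPlus x).symm_apply_apply a
  anchor_τ x a := (K.sMinus x).symm_apply_apply a
  JpJm_σ x a := by
    have h := (K.sPlus x a).2
    simp only [Cplus, G, Module.End.mem_eigenspace_iff, one_smul, LinearMap.neg_apply] at h
    exact neg_eq_iff_eq_neg.1 h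
  JpJm_τ x a := by
    have h := (K.sMinus x a).2
    simp only [Cminus, G, Module.End.mem_eigenspace_iff, neg_smul, one_smul,
      LinearMap.neg_apply] at h
    exact neg_injective h
  σ_anchor x a h := by
    have ha : a ∈ K.Cplus x := by
      simp only [Cplus, G, Module.End.mem_eigenspace_iff, one_smul, LinearMap.neg_apply]
      exact neg_eq_iff_eq_neg.2 h
    exact congrArg Subtype.val ((K.sPlus x).apply_symm_apply ⟨a, ha⟩)
  τ_anchor x a h := by
    have ha : a ∈ K.Cminus x := by
      simp only [Cminus, G, Module.End.mem_eigenspace_iff, neg_smul, one_smul, LinearMap.neg_apply]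
      exact congrArg _ h
    exact congrArg Subtype.val ((K.sMinus x).apply_symm_apply ⟨a, ha⟩)

theorem GenKahler.swap_D [FiniteDimensional ℝ V] [FiniteDimensional ℝ F] [VectorBundle ℝ F E]
    (K : C.GenKahler) : K.toSplitPair.swap.D = K.ellBarMinus := by
  have h := eigenbundle_neg K.Jm (-Complex.I)
  rw [neg_neg] at h
  funext x
  exact congrArg (eigenbundle K.Jp (-Complex.I) x ⊓ ·) (congrFun h x)

end ExactCourantAlgebroid

end GKGeom

end

/-! ### The two signs -/

theorem mainTheorem3
    {V : Type u} [NormedAddCommGroup V] [NormedSpace ℝ V] [FiniteDimensional ℝ V]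
    {M : Type v} [TopologicalSpace M] [ChartedSpace V M] [IsManifold 𝓘(ℝ, V) ∞ M]
    [T2Space M] [SigmaCompactSpace M]
    {F : Type*} [NormedAddCommGroup F] [NormedSpace ℝ F] [FiniteDimensional ℝ F]
    {E : M → Type w} [∀ x, AddCommGroup (E x)] [∀ x, Module ℝ (E x)]
    [TopologicalSpace (TotalSpace F E)] [∀ x, TopologicalSpace (E x)]
    [FiberBundle F E] [VectorBundle ℝ F E] [ContMDiffVectorBundle ∞ F E 𝓘(ℝ, V)]
    (C : GKGeom.ExactCourantAlgebroid V F E) (K : C.GenKahler) :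
    (GKGeom.IsComplexStructure K.Iplus ∧
      C.IsLifting K.Iplus K.ellBarPlus ∧
      C.IsReducible K.ellBarPlus (K.eigP (-Complex.I)) ∧
      C.IsReducible K.ellBarPlus (K.eigM (-Complex.I)) ∧
      Nonempty (C.Reduction K.Iplus K.ellBarPlus) ∧
      ∀ R : C.Reduction K.Iplus K.ellBarPlus,
        R.𝓔.IsHolDirac (R.reduce (K.eigP (-Complex.I))) ∧
        R.𝓔.IsHolDirac (R.reduce (K.eigM (-Complex.I))) ∧
        ∀ x, IsCompl (R.reduce (K.eigP (-Complex.I)) x)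
          (R.reduce (K.eigM (-Complex.I)) x)) ∧
    (GKGeom.IsComplexStructure K.Iminus ∧
      C.IsLifting K.Iminus K.ellBarMinus ∧
      C.IsReducible K.ellBarMinus (K.eigP (-Complex.I)) ∧
      C.IsReducible K.ellBarMinus (K.eigM Complex.I) ∧
      Nonempty (C.Reduction K.Iminus K.ellBarMinus) ∧
      ∀ R : C.Reduction K.Iminus K.ellBarMinus,
        R.𝓔.IsHolDirac (R.reduce (K.eigP (-Complex.I))) ∧
        R.𝓔.IsHolDirac (R.reduce (K.eigM Complex.I)) ∧
        ∀ x, IsCompl (R.reduce (K.eigP (-Complex.I)) x)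
          (R.reduce (K.eigM Complex.I) x)) := by
  -- The sign `-` is the sign `+` for the pair `(Jp, -Jm)`; it remains to rewrite the eigenbundles
  -- of `-Jm` as those of `Jm`.
  have h := K.toSplitPair.swap.reduction_theorem
  have hM : GKGeom.ExactCourantAlgebroid.eigenbundle K.toSplitPair.swap.Jm (-Complex.I) =
      K.eigM Complex.I :=
    (GKGeom.ExactCourantAlgebroid.eigenbundle_neg K.Jm _).trans
      (congrArg (GKGeom.ExactCourantAlgebroid.eigenbundle K.Jm) (neg_neg Complex.I))
  rw [hM, K.swap_D] at h
  -- The transported complex structures of the split pairs agree with `Iplus` and `Iminus` by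
  -- definition.
  exact ⟨K.toSplitPair.reduction_theorem, h⟩
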